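/- Model of computation. Time is the number of steps of a deterministic multi-tape Turing machine whose tape cells are blank or hold one rational number. In one step the finite control, which sees only which scanned cells are blank and the signs of the others, changes state, overwrites every scanned cell (leaving it unchanged, or writing a blank, a constant, a copy of a scanned number, or the sum, difference, product or quotient of two scanned numbers), and moves each head by at most one cell. A machine starts with the input word on its input tape and all other tapes blank, and must halt with exactly the output word on its output tape and all other tapes blank. A data set is presented as the word $x_1,y_1,\dots,x_N,y_N$ of $N(d+1)$ rationals. Let $d\ge 1$ and $n\ge 3$ be fixed integers, $X\subseteq\mathbb{Q}^d$, and let $\ell:\mathbb{Q}\to\mathbb{Q}$ be a nonnegative loss function that is computable in a number of steps bounded independently of its argument. Write $\overline{x}=[x^\top,1]^\top$. Let $\mathcal{H}$ be the set of all functions $h:X\to\{1,\dots,n\}$ of the form $h(x)=\operatorname{argmax}_{k}(a_k^\top x+b_k)$ with $a_k\in\mathbb{Q}^d$, $b_k\in\mathbb{Q}$, where ties are broken in favour of the smallest index. Given a data set $(x_i,y_i)_{i=1}^N\in(X\times\mathbb{Q})^N$ with $N\ge n(d+1)$, consider the problem of finding a global solution of $$\min_{w_1,\dots,w_n\in\mathbb{Q}^{d+1},\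 h\in\mathcal{H}}\ \frac1N\sum_{i=1}^N\sum_{j=1}^n \mathbf{1}_{h(x_i)=j}\,\ell\bigl(y_i-w_j^\top\overline{x}_i\bigr).\qquad(1)$$ Assume that there are a nondecreasing, polynomially bounded function $T:\mathbb{N}\to\mathbb{N}$ and a machine that, for every $N\ge1$ and every data set $(x_i,y_i)_{i=1}^N\in(X\times\mathbb{Q})^N$, outputs a minimizer $v\in\mathbb{Q}^{d+1}$ of $\sum_{i=1}^N\ell(y_i-v^\top\overline{x}_i)$ in at most $T(N)$ steps. Then there are a machine and a constant $C$ such that, for every $N\ge n(d+1)$ and every data set $(x_i,y_i)_{i=1}^N\in(X\times\mathbb{Q})^N$ whose points are in general position (no hyperplane of $\mathbb{Q}^d$ contains $x_i$ for more than $d$ indices $i$), the machine outputs a global solution of (1), namely $w_1,\dots,w_n$ and the parameters $(a_k,b_k)_{k=1}^n$ of the classifier $h$, in at most $C\,T(N)\,N^{dn(n-1)/2}$ steps. This bound is itself bounded by a polynomial in $N$. -/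

import Mathlib

/-! ### Turing machines over the rationals

Deterministic multi-tape Turing machines whose tape cells are blank or hold one rational number.
The finite control sees only which scanned cells are blank and the signs of the others.  One step
changes the state, overwrites every scanned cell (by a blank, a constant, or the result of one
arithmetic operation on the scanned numbers), and moves every head by at most one cell. -/

/-- What a step may write in a scanned cell; `i` and `j` name the tapes whose heads are read. -/
inductive QWrite (K : Type) : Type
  | keep : QWrite K
  | erase : QWrite K
  | const (c : ℚ) : QWrite K
  | copy (i : K) : QWrite K
  | add (i j : K) : QWrite K
  | sub (i j : K) : QWrite K
  | mul (i j : K) : QWrite K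
  | div (i j : K) : QWrite K

/-- A multi-tape Turing machine over `ℚ`.  The set of states and the set of tapes are finite, so
that the transition function is a finite table; the value `none` means that the machine halts. -/
structure QMachine : Type 1 where
  State : Type
  [stateFintype : Fintype State]
  start : State
  K : Type
  [tapeFintype : Fintype K]
  [tapeDecidableEq : DecidableEq K]
  inTape : K
  outTape : K
  trans : State → (K → Option SignType) →
    Option (State × (K → QWrite K) × (K → Option Turing.Dir))

attribute [instance] QMachine.stateFintype QMachine.tapeFintype QMachine.tapeDecidableEq

namespace QMachine

/-- The symbol that is written, if the scanned cells contain `s` and `k` is the tape on which the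
write acts.  In arithmetic operations a blank cell counts as `0`, and `a / 0 = 0`. -/
def writeValue {K : Type} (s : K → Option ℚ) (k : K) : QWrite K → Option ℚ
  | .keep => s k
  | .erase => none
  | .const c => some c
  | .copy i => s i
  | .add i j => some ((s i).getD 0 + (s j).getD 0)
  | .sub i j => some ((s i).getD 0 - (s j).getD 0)
  | .mul i j => some ((s i).getD 0 * (s j).getD 0)
  | .div i j => some ((s i).getD 0 / (s j).getD 0)

/-- Moving a head by one cell, or not at all. -/
def moveHead : Option Turing.Dir → Turing.Tape (Option ℚ) → Turing.Tape (Option ℚ)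
  | none, t => t
  | some a, t => t.move a

/-- A configuration: the state and the contents of the tapes with their head positions. -/
structure Cfg (M : QMachine) : Type where
  state : M.State
  tape : M.K → Turing.Tape (Option ℚ)

/-- One step of the machine; `none` if the machine halts in the given configuration. -/
def step (M : QMachine) (c : M.Cfg) : Option M.Cfg :=
  (M.trans c.state (fun k => ((c.tape k).head).map SignType.sign)).map fun r =>
    { state := r.1
      tape := fun k => moveHead (r.2.2 k)
        ((c.tape k).write (writeValue (fun i => (c.tape i).head) k (r.2.1 k))) }

/-- The tapes when tape `k` contains exactly the word `l`, with the head on its first letter, and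
all the other tapes are blank. -/
def wordOn (M : QMachine) (k : M.K) (l : List ℚ) : M.K → Turing.Tape (Option ℚ) :=
  Function.update (fun _ => Turing.Tape.mk₁ []) k (Turing.Tape.mk₁ (l.map some))

/-- The machine, started with the word `inp` on its input tape and all other tapes blank, halts
after at most `t` steps with the word `out` on its output tape and all other tapes blank. -/
def OutputsWithin (M : QMachine) (inp out : List ℚ) (t : ℕ) : Prop :=
  ∃ m ≤ t, ∃ c : M.Cfg,
    (fun o : Option M.Cfg => o.bind M.step)^[m] (some ⟨M.start, M.wordOn M.inTape inp⟩) = some c ∧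
    M.step c = none ∧ c.tape = M.wordOn M.outTape out

end QMachine

/-! ### Piecewise affine regression -/

namespace PWA

/-- The extended vector `[xᵀ, 1]ᵀ`. -/
def extend {d : ℕ} (x : Fin d → ℚ) : Fin (d + 1) → ℚ := Fin.snoc x 1

/-- `j` is the smallest element of `argmax u`. -/
def IsFirstArgmax {n : ℕ} (u : Fin n → ℚ) (j : Fin n) : Prop :=
  (∀ k, u k ≤ u j) ∧ ∀ k < j, u k < u j

/-- `h` is the linear classifier on `X` with parameters `a` and `b`, that is,
`h x = argmax_k (a_k ⬝ x + b_k)` with ties broken in favour of the smallest index. -/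
def IsClassifierOf {d n : ℕ} (X : Set (Fin d → ℚ)) (a : Fin n → Fin d → ℚ) (b : Fin n → ℚ)
    (h : X → Fin n) : Prop :=
  ∀ x : X, IsFirstArgmax (fun k => a k ⬝ᵥ (x : Fin d → ℚ) + b k) (h x)

/-- The set of `n`-category linear classifiers on `X`. -/
def linearClassifiers {d : ℕ} (n : ℕ) (X : Set (Fin d → ℚ)) : Set (X → Fin n) :=
  {h | ∃ (a : Fin n → Fin d → ℚ) (b : Fin n → ℚ), IsClassifierOf X a b h}

/-- The mean error of the piecewise affine model with submodels `w` and classifier `h`. -/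
def risk {d n N : ℕ} {X : Set (Fin d → ℚ)} (loss : ℚ → ℚ) (x : Fin N → X) (y : Fin N → ℚ)
    (w : Fin n → Fin (d + 1) → ℚ) (h : X → Fin n) : ℚ :=
  1 / (N : ℚ) * ∑ i, ∑ j, if h (x i) = j then
    loss (y i - w j ⬝ᵥ extend (x i : Fin d → ℚ)) else 0

/-- `(w, h)`, where `h` is the linear classifier with parameters `a` and `b`, is a global minimizer
of the mean error over all submodels and all `n`-category linear classifiers. -/
def IsGlobalSolution {d n N : ℕ} {X : Set (Fin d → ℚ)} (loss : ℚ → ℚ) (x : Fin N → X)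
    (y : Fin N → ℚ) (w : Fin n → Fin (d + 1) → ℚ) (a : Fin n → Fin d → ℚ) (b : Fin n → ℚ) : Prop :=
  ∃ h : X → Fin n, IsClassifierOf X a b h ∧
    ∀ (w' : Fin n → Fin (d + 1) → ℚ), ∀ h' ∈ linearClassifiers n X,
      risk loss x y w h ≤ risk loss x y w' h'

/-- No hyperplane of `ℚ^d` contains more than `d` of the points. -/
def GeneralPosition {d N : ℕ} (x : Fin N → Fin d → ℚ) : Prop :=
  ∀ (a : Fin d → ℚ) (c : ℚ), a ≠ 0 → (Finset.univ.filter fun i => a ⬝ᵥ x i + c = 0).card ≤ d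

/-- The word `x₁ y₁ x₂ y₂ … x_N y_N` that presents a data set to a machine. -/
def encodeData {d N : ℕ} (x : Fin N → Fin d → ℚ) (y : Fin N → ℚ) : List ℚ :=
  (List.ofFn fun i => List.ofFn (x i) ++ [y i]).flatten

/-- The word `w₁ … w_n a₁ b₁ … a_n b_n` that presents a piecewise affine model. -/
def encodeModel {d n : ℕ} (w : Fin n → Fin (d + 1) → ℚ) (a : Fin n → Fin d → ℚ)
    (b : Fin n → ℚ) : List ℚ :=
  (List.ofFn fun j => List.ofFn (w j)).flatten ++ (List.ofFn fun k => List.ofFn (a k) ++ [b k]).flatten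

/-- The loss function is computed by a machine in a number of steps that is bounded independently
of its argument (the input is a single rational, so it has size one). -/
def LossComputable (loss : ℚ → ℚ) : Prop :=
  ∃ (M : QMachine) (c : ℕ), ∀ e : ℚ, M.OutputsWithin [e] [loss e] c

/-- `v` is a minimizer of the error of a single affine model. -/
def IsRegressionSolution {d N : ℕ} (loss : ℚ → ℚ) (x : Fin N → Fin d → ℚ) (y : Fin N → ℚ)
    (v : Fin (d + 1) → ℚ) : Prop :=
  ∀ v' : Fin (d + 1) → ℚ,
    ∑ i, loss (y i - v ⬝ᵥ extend (x i)) ≤ ∑ i, loss (y i - v' ⬝ᵥ extend (x i))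

/-- Some machine computes, for every nonempty data set of `N` pairs in `X × ℚ`, an affine
regression solution in at most `T N` steps. -/
def RegressionSolvableInTime {d : ℕ} (X : Set (Fin d → ℚ)) (loss : ℚ → ℚ) (T : ℕ → ℕ) : Prop :=
  ∃ M : QMachine, ∀ N : ℕ, 1 ≤ N → ∀ (x : Fin N → X) (y : Fin N → ℚ),
    ∃ v : Fin (d + 1) → ℚ, IsRegressionSolution loss (fun i => (x i : Fin d → ℚ)) y v ∧
      M.OutputsWithin (encodeData (fun i => (x i : Fin d → ℚ)) y) (List.ofFn v) (T N)

end PWA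

/-! The cost of a piecewise affine model depends on the classifier only through the labels of the
data points, and for fixed labels the optimal submodels solve separate regression problems, one for
each nonempty class. So it suffices to list polynomially many classifiers that realize every
labelling coming from a linear classifier, to fit submodels to each of them, and to keep the
cheapest model.

Enumeration. Lowering the intercept of class `k` by a small multiple of `k` makes all comparisons on
the data strict (`exists_strict_classifier`). Subtracting the parameters of class `0` from all
classes changes no margin, so a classifier becomes a vector `η` of dimension `m + 1 = (n - 1)(d +
1)`, and realizing a labelling means `A r ⬝ᵥ η > 0` for finitely many vectors `A r`, each built from
one row and one pair of classes. Rescale so that some coordinate of `η` is `±1`. For small `ε > 0`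
the conditions `A r ⬝ᵥ η ≥ ε` remain solvable on that hyperplane, and a solution can be moved until
`m` independent constraints are tight, each of the form `A r ⬝ᵥ η = ε` or `η c = 0`
(`exists_tight_family`). By Cramer's rule such a point is `p + ε q`, where `p` and `q` are
arithmetic expressions in at most `m` rows. There are finitely many choices of tight constraints, so
a single choice works for a sequence of `ε` tending to `0`; hence each `A r` is positive on `p`, or
vanishes on `p` and is positive on `q` (`exists_lexPositive_vertex`). An explicit positive number, a
product over the rows, can then replace the infinitesimal `ε` (`Candidates.margin_theta_pos`). Apart
from the `m` rows only combinatorial data independent of `N` enter, so finitely many families of `N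
^ m` candidates suffice (`exists_candidates`), and `m ≤ d n (n - 1) / 2`.

Running time. `Does` expresses that one program performs a whole family of tape transformations with
a uniform constant, and is closed under composition, branching, loops and calls. Evaluating a
candidate takes `O(T N + N)` steps, since `T` is monotone and there are `n` classes
(`Does.evalCandidate`); `m` nested loops over the rows run through a family (`Does.sweep`). The term
`N` is absorbed by `T N`: the regression machine has to erase its input, and a step erases at most
one cell of a tape (`QMachine.OutputsWithin.length_le`). -/

/-! ### Programs on a fixed family of tapes -/

/-- The contents of a family of tapes. -/
abbrev Tapes (K : Type) : Type := K → Turing.Tape (Option ℚ)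

namespace Tapes

variable {K : Type}

/-- What the finite control sees. -/
def scan (S : Tapes K) : K → Option SignType := fun k => ((S k).head).map SignType.sign

/-- Write and move on all tapes. -/
def act (S : Tapes K) (w : K → QWrite K) (mv : K → Option Turing.Dir) : Tapes K := fun k =>
  QMachine.moveHead (mv k) ((S k).write (QMachine.writeValue (fun i => (S i).head) k (w k)))

theorem act_idle (S : Tapes K) : S.act (fun _ => .keep) (fun _ => none) = S := by
  funext k
  simp [act, QMachine.moveHead, QMachine.writeValue]

theorem act_keep (S : Tapes K) (mv : K → Option Turing.Dir) (k : K) :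
    S.act (fun _ => .keep) mv k = QMachine.moveHead (mv k) (S k) := by
  simp [act, QMachine.writeValue]

end Tapes

/-- A machine without designated input and output tapes. -/
structure QProg (K : Type) : Type 1 where
  State : Type
  [stateFintype : Fintype State]
  start : State
  trans : State → (K → Option SignType) →
    Option (State × (K → QWrite K) × (K → Option Turing.Dir))

attribute [instance] QProg.stateFintype

namespace QProg

variable {K : Type}

/-- `P.Reaches m q S q' S'`: the program gets from `(q, S)` to `(q', S')` in `m` steps. -/
inductive Reaches (P : QProg K) : ℕ → P.State → Tapes K → P.State → Tapes K → Prop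
  | refl (q : P.State) (S : Tapes K) : Reaches P 0 q S q S
  | head {m : ℕ} {q q₁ q₂ : P.State} {S S₂ : Tapes K} {w : K → QWrite K}
      {mv : K → Option Turing.Dir} : P.trans q S.scan = some (q₁, w, mv) →
      Reaches P m q₁ (S.act w mv) q₂ S₂ → Reaches P (m + 1) q S q₂ S₂

theorem Reaches.trans {P : QProg K} {m m' : ℕ} {q q₁ q₂ : P.State} {S S₁ S₂ : Tapes K}
    (h : P.Reaches m q S q₁ S₁) (h' : P.Reaches m' q₁ S₁ q₂ S₂) :
    P.Reaches (m + m') q S q₂ S₂ := by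
  induction h with
  | refl => simpa using h'
  | head e _ ih =>
    rw [Nat.add_right_comm]
    exact .head e (ih h')

/-- From state `q` the program halts within `t` steps and transforms `S` into `S'`. -/
def RunsFrom (P : QProg K) (q : P.State) (S S' : Tapes K) (t : ℕ) : Prop :=
  ∃ m ≤ t, ∃ q', P.Reaches m q S q' S' ∧ P.trans q' S'.scan = none

/-- The program halts within `t` steps and transforms `S` into `S'`. -/
def Runs (P : QProg K) (S S' : Tapes K) (t : ℕ) : Prop := P.RunsFrom P.start S S' t

theorem RunsFrom.mono {P : QProg K} {q : P.State} {S S' : Tapes K} {t t' : ℕ}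
    (h : P.RunsFrom q S S' t) (ht : t ≤ t') : P.RunsFrom q S S' t' := by
  obtain ⟨m, hm, r⟩ := h
  exact ⟨m, hm.trans ht, r⟩

theorem Runs.mono {P : QProg K} {S S' : Tapes K} {t t' : ℕ}
    (h : P.Runs S S' t) (ht : t ≤ t') : P.Runs S S' t' := RunsFrom.mono h ht

/-- The program that halts at once. -/
def skip : QProg K where
  State := Unit
  start := ()
  trans _ _ := none

theorem runs_skip (S : Tapes K) : (skip : QProg K).Runs S S 0 :=
  ⟨0, le_rfl, (), .refl _ _, rfl⟩

/-- A single step. -/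
def op (w : K → QWrite K) (mv : K → Option Turing.Dir) : QProg K where
  State := Bool
  start := true
  trans b _ := if b then some (false, w, mv) else none

theorem runs_op (w : K → QWrite K) (mv : K → Option Turing.Dir) (S : Tapes K) :
    (op w mv).Runs S (S.act w mv) 1 :=
  ⟨1, le_rfl, false, .head (by simp [op]) (.refl _ _), by simp [op]⟩

/-- The flow chart whose nodes are the programs `P v`; when `P v` halts, the run continues at the
node given by `next v`, or ends. -/
def graph {G : Type} [Fintype G] (P : G → QProg K) (v₀ : G)
    (next : G → (K → Option SignType) → Option G) : QProg K where
  State := Σ v, (P v).State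
  start := ⟨v₀, (P v₀).start⟩
  trans q σ :=
    match (P q.1).trans q.2 σ with
    | some r => some (⟨q.1, r.1⟩, r.2.1, r.2.2)
    | none => (next q.1 σ).map fun v => (⟨v, (P v).start⟩, fun _ => .keep, fun _ => none)

section graph

variable {G : Type} [Fintype G] {P : G → QProg K} {v₀ : G}
  {next : G → (K → Option SignType) → Option G}

theorem Reaches.graph {v : G} {m : ℕ} {q q' : (P v).State} {S S' : Tapes K}
    (h : (P v).Reaches m q S q' S') :
    (graph P v₀ next).Reaches m ⟨v, q⟩ S ⟨v, q'⟩ S' := by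
  induction h with
  | refl => exact .refl _ _
  | head e _ ih =>
    refine .head ?_ ih
    simp [QProg.graph, e]

theorem runsFrom_graph_exit {v : G} {S S' : Tapes K} {t : ℕ} (h : (P v).Runs S S' t)
    (hn : next v S'.scan = none) :
    (graph P v₀ next).RunsFrom ⟨v, (P v).start⟩ S S' t := by
  obtain ⟨m, hm, q, hr, hq⟩ := h
  exact ⟨m, hm, ⟨v, q⟩, hr.graph, by simp [graph, hq, hn]⟩

theorem runsFrom_graph_next {v v' : G} {S S' S'' : Tapes K} {t t' : ℕ} (h : (P v).Runs S S' t)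
    (hn : next v S'.scan = some v')
    (h' : (graph P v₀ next).RunsFrom ⟨v', (P v').start⟩ S' S'' t') :
    (graph P v₀ next).RunsFrom ⟨v, (P v).start⟩ S S'' (t + t' + 1) := by
  obtain ⟨m, hm, q, hr, hq⟩ := h
  obtain ⟨m', hm', q', hr', hq'⟩ := h'
  have e : (graph P v₀ next).trans ⟨v, q⟩ S'.scan =
      some (⟨v', (P v').start⟩, fun _ => .keep, fun _ => none) := by
    simp [graph, hq, hn]
  -- The jump between two nodes is a step that writes and moves nothing; it accounts for the extra
  -- `1` in the bound.
  refine ⟨m + (m' + 1), by omega, q', hr.graph.trans (.head e ?_), hq'⟩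
  rwa [Tapes.act_idle]

end graph

/-- Sequential composition. -/
def seq (P Q : QProg K) : QProg K :=
  graph (fun b : Bool => if b then P else Q) true fun b _ => if b then some false else none

theorem Runs.seq {P Q : QProg K} {S S' S'' : Tapes K} {t t' : ℕ} (h : P.Runs S S' t)
    (h' : Q.Runs S' S'' t') : (P.seq Q).Runs S S'' (t + t' + 1) :=
  runsFrom_graph_next (P := fun b : Bool => if b then P else Q) (v := true) (v' := false) h
    (by simp) (runsFrom_graph_exit (v := false) h' (by simp))

open Classical in
/-- Branching on what the finite control sees. -/
noncomputable def ite (c : (K → Option SignType) → Prop) (P Q : QProg K) : QProg K :=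
  graph (fun b : Option Bool => b.elim skip fun b => if b then P else Q) none
    fun b σ => if b = none then some (some (decide (c σ))) else none

open Classical in
theorem runs_ite_true {c : (K → Option SignType) → Prop} {P Q : QProg K} {S S' : Tapes K} {t : ℕ}
    (hc : c S.scan) (h : P.Runs S S' t) : (ite c P Q).Runs S S' (t + 1) := by
  have := runsFrom_graph_next (P := fun b : Option Bool => b.elim skip fun b => if b then P else Q)
    (v₀ := none) (next := fun b σ => if b = none then some (some (decide (c σ))) else none)
    (v := none) (v' := some true) (runs_skip S) (by simp [hc])
    (runsFrom_graph_exit (v := some true) h (by simp))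
  rwa [zero_add] at this

open Classical in
theorem runs_ite_false {c : (K → Option SignType) → Prop} {P Q : QProg K} {S S' : Tapes K} {t : ℕ}
    (hc : ¬c S.scan) (h : Q.Runs S S' t) : (ite c P Q).Runs S S' (t + 1) := by
  have := runsFrom_graph_next (P := fun b : Option Bool => b.elim skip fun b => if b then P else Q)
    (v₀ := none) (next := fun b σ => if b = none then some (some (decide (c σ))) else none)
    (v := none) (v' := some false) (runs_skip S) (by simp [hc])
    (runsFrom_graph_exit (v := some false) h (by simp))
  rwa [zero_add] at this

open Classical in
/-- Iteration as long as `c` holds. -/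
noncomputable def loop (c : (K → Option SignType) → Prop) (P : QProg K) : QProg K :=
  graph (fun b : Bool => if b then P else skip) false
    fun b σ => if b then some false else if c σ then some true else none

-- Every round makes two jumps, from the test to the body and back, whence `t + 2`.
open Classical in
theorem runs_loop {c : (K → Option SignType) → Prop} {P : QProg K} {S : ℕ → Tapes K} {len t : ℕ}
    (h : ∀ i < len, P.Runs (S i) (S (i + 1)) t) (hc : ∀ i < len, c (S i).scan)
    (hn : ¬c (S len).scan) : (loop c P).Runs (S 0) (S len) (len * (t + 2)) := by
  induction len generalizing S with
  | zero =>
    refine RunsFrom.mono (t := 0) (runsFrom_graph_exit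
      (P := fun b : Bool => if b then P else skip) (v := false) (runs_skip (S 0)) ?_) (by simp)
    simpa using hn
  | succ k ih =>
    have h₁ := ih (S := fun i => S (i + 1)) (fun i hi => h (i + 1) (by omega))
      (fun i hi => hc (i + 1) (by omega)) hn
    have h₂ := runsFrom_graph_next (P := fun b : Bool => if b then P else skip) (v := true)
      (v₀ := false) (v' := false) (next := fun b σ => if b then some false else
        if c σ then some true else none)
      (h 0 (by omega)) (by simp) h₁
    have h₃ := runsFrom_graph_next (P := fun b : Bool => if b then P else skip) (v := false)
      (v₀ := false) (v' := true) (runs_skip (S 0)) (by simpa using hc 0 (by omega)) h₂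
    refine RunsFrom.mono h₃ ?_
    simp only [Nat.succ_mul]
    omega

/-- A program from a machine. -/
def ofMachine (M : QMachine) : QProg M.K where
  State := M.State
  start := M.start
  trans := M.trans

/-- Rename the tape that a write refers to. -/
def mapWrite {K K' : Type} (f : K → K') : QWrite K → QWrite K'
  | .keep => .keep
  | .erase => .erase
  | .const c => .const c
  | .copy i => .copy (f i)
  | .add i j => .add (f i) (f j)
  | .sub i j => .sub (f i) (f j)
  | .mul i j => .mul (f i) (f j)
  | .div i j => .div (f i) (f j)

/-- Run a program on the tapes `f k`; `g` is the partial inverse of `f`. -/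
def embed {K K' : Type} (f : K → K') (g : K' → Option K) (P : QProg K) : QProg K' where
  State := P.State
  start := P.start
  trans q σ := (P.trans q (σ ∘ f)).map fun r => (r.1,
    fun v => (g v).elim .keep fun k => mapWrite f (r.2.1 k),
    fun v => (g v).elim none fun k => r.2.2 k)

/-- The tapes `S`, with those in the range of `f` replaced by `U`. -/
def overlay {K K' : Type} (g : K' → Option K) (U : Tapes K) (S : Tapes K') : Tapes K' :=
  fun v => (g v).elim (S v) U

theorem Reaches.embed {K K' : Type} {f : K → K'} {g : K' → Option K}
    (hfg : ∀ v k, g v = some k ↔ f k = v) {P : QProg K} {m : ℕ} {q q' : P.State}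
    {U U' : Tapes K} (S : Tapes K') (h : P.Reaches m q U q' U') :
    (P.embed f g).Reaches m q (overlay g U S) q' (overlay g U' S) := by
  have hgf : ∀ k, g (f k) = some k := fun k => (hfg _ _).2 rfl
  have hs : ∀ U : Tapes K, (overlay g U S).scan ∘ f = U.scan := fun U => by
    funext k
    simp [overlay, Tapes.scan, hgf]
  induction h with
  | refl => exact .refl _ _
  | @head m q q₁ q₂ U U₂ w mv e _ ih =>
    have ha : overlay g (U.act w mv) S = (overlay g U S).act
        (fun v => (g v).elim .keep fun k => mapWrite f (w k))
        (fun v => (g v).elim none fun k => mv k) := by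
      funext v
      rcases hv : g v with _ | k
      · simp [overlay, Tapes.act, hv, QMachine.moveHead, QMachine.writeValue]
      · simp only [overlay, Tapes.act, hv, Option.elim]
        congr 2
        cases w k <;> simp [mapWrite, QMachine.writeValue, hgf, hv]
    have e' : (P.embed f g).trans q (overlay g U S).scan = some (q₁,
        fun v => (g v).elim .keep fun k => mapWrite f (w k),
        fun v => (g v).elim none fun k => mv k) := by
      simp [QProg.embed, hs, e]
    rw [ha] at ih
    exact .head e' ih

theorem Runs.embed {K K' : Type} {f : K → K'} {g : K' → Option K}
    (hfg : ∀ v k, g v = some k ↔ f k = v) {P : QProg K} {t : ℕ} {U U' : Tapes K} (S : Tapes K')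
    (h : P.Runs U U' t) : (P.embed f g).Runs (overlay g U S) (overlay g U' S) t := by
  obtain ⟨m, hm, q, hr, hq⟩ := h
  refine ⟨m, hm, q, hr.embed hfg S, ?_⟩
  have hs : (overlay g U' S).scan ∘ f = U'.scan := by
    funext k
    simp [overlay, Tapes.scan, (hfg _ _).2 (rfl : f k = f k)]
  simp [QProg.embed, hs, hq]

theorem iterate_bind_none (M : QMachine) (m : ℕ) :
    (fun o : Option M.Cfg => o.bind M.step)^[m] none = none :=
  Function.iterate_fixed rfl m

theorem runs_ofMachine {M : QMachine} {inp out : List ℚ} {t : ℕ}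
    (h : M.OutputsWithin inp out t) :
    (ofMachine M).Runs (M.wordOn M.inTape inp) (M.wordOn M.outTape out) t := by
  obtain ⟨m, hm, c, hc, hs, ho⟩ := h
  have key : ∀ (m : ℕ) (c₀ : M.Cfg),
      (fun o : Option M.Cfg => o.bind M.step)^[m] (some c₀) = some c →
      (ofMachine M).Reaches m c₀.state c₀.tape c.state c.tape := by
    intro m
    induction m with
    | zero =>
      intro c₀ h
      obtain rfl : c₀ = c := by simpa using h
      exact .refl _ _
    | succ m ih =>
      intro c₀ h
      rw [Function.iterate_succ_apply, Option.bind_some] at h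
      rcases hst : M.step c₀ with _ | c₁
      · rw [hst, iterate_bind_none] at h
        cases h
      · rw [hst] at h
        have h₁ := ih _ h
        unfold QMachine.step at hst
        rw [Option.map_eq_some_iff] at hst
        obtain ⟨⟨q, w, mv⟩, hr, rfl⟩ := hst
        exact .head hr h₁
  refine ⟨m, hm, c.state, ho ▸ key m _ hc, ?_⟩
  unfold QMachine.step at hs
  rw [Option.map_eq_none_iff] at hs
  rw [← ho]
  exact hs

/-- A machine from a program. -/
def toMachine [Fintype K] [DecidableEq K] (P : QProg K) (k : K) : QMachine where
  State := P.State
  start := P.start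
  K := K
  inTape := k
  outTape := k
  trans := P.trans

theorem Runs.toMachine [Fintype K] [DecidableEq K] {P : QProg K} {k : K} {inp out : List ℚ}
    {t : ℕ} (h : P.Runs (Function.update (fun _ => Turing.Tape.mk₁ []) k
      (Turing.Tape.mk₁ (inp.map some))) (Function.update (fun _ => Turing.Tape.mk₁ []) k
      (Turing.Tape.mk₁ (out.map some))) t) :
    (P.toMachine k).OutputsWithin inp out t := by
  obtain ⟨m, hm, q, hr, hq⟩ := h
  have key : ∀ {m : ℕ} {q q' : P.State} {S S' : Tapes K}, P.Reaches m q S q' S' →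
      (fun o : Option (P.toMachine k).Cfg => o.bind (P.toMachine k).step)^[m] (some ⟨q, S⟩) =
        some ⟨q', S'⟩ := by
    intro m q q' S S' h
    induction h with
    | refl => rfl
    | @head m q q₁ q₂ S S₂ w mv e _ ih =>
      rw [Function.iterate_succ_apply, Option.bind_some]
      have : (P.toMachine k).step ⟨q, S⟩ = some ⟨q₁, S.act w mv⟩ := by
        unfold QMachine.step
        rw [Option.map_eq_some_iff]
        exact ⟨(q₁, w, mv), e, rfl⟩
      rw [this]
      exact ih
  refine ⟨m, hm, ⟨q, _⟩, key hr, ?_, rfl⟩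
  unfold QMachine.step
  rw [Option.map_eq_none_iff]
  exact hq

end QProg

/-! ### Words on tapes -/

/-- The tape with the word `l.reverse ++ r` whose head scans the first letter of `r`. -/
def wordTape (l r : List ℚ) : Turing.Tape (Option ℚ) :=
  Turing.Tape.mk' (Turing.ListBlank.mk (l.map some)) (Turing.ListBlank.mk (r.map some))

namespace wordTape

@[simp]
theorem head (l r : List ℚ) : (wordTape l r).head = r.head? := by
  cases r <;> rfl

@[simp]
theorem write_some (l r : List ℚ) (v : ℚ) :
    (wordTape l r).write (some v) = wordTape l (v :: r.tail) := by
  simp [wordTape, Turing.Tape.write_mk', Turing.ListBlank.tail_mk, Turing.ListBlank.cons_mk]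

/-- The condition on `r` is needed because a blank inside a word would leave the class of tapes
`wordTape`. Half-tapes are lists up to trailing blanks, so a blank at the end disappears. -/
theorem write_none (l r : List ℚ) (hr : r.tail = []) :
    (wordTape l r).write none = wordTape l [] := by
  have h : Turing.ListBlank.cons none (Turing.ListBlank.mk ([] : List (Option ℚ))) =
    Turing.ListBlank.mk [] := Quotient.sound' (.inr ⟨1, rfl⟩)
  simp only [wordTape, Turing.Tape.write_mk', Turing.ListBlank.tail_mk, ← List.map_tail, hr]
  simp [h]

@[simp]
theorem write_none_nil (l : List ℚ) : (wordTape l []).write none = wordTape l [] :=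
  write_none l [] rfl

@[simp]
theorem write_none_singleton (l : List ℚ) (a : ℚ) :
    (wordTape l [a]).write none = wordTape l [] :=
  write_none l [a] rfl

@[simp]
theorem move_right (l r : List ℚ) (a : ℚ) :
    (wordTape l (a :: r)).move .right = wordTape (a :: l) r := by
  simp [wordTape, Turing.Tape.move_right_mk', Turing.ListBlank.tail_mk, Turing.ListBlank.cons_mk]

@[simp]
theorem move_left (l r : List ℚ) (a : ℚ) :
    (wordTape (a :: l) r).move .left = wordTape l (a :: r) := by
  simp [wordTape, Turing.Tape.move_left_mk', Turing.ListBlank.tail_mk, Turing.ListBlank.cons_mk]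

theorem head_move_left_nil (r : List ℚ) : ((wordTape [] r).move .left).head = none := rfl

/-- The erased cell joins the blank left half of the tape. A word can thus be consumed from the
front, leaving no trace. -/
theorem erase_move_right (r : List ℚ) (a : ℚ) :
    ((wordTape [] (a :: r)).write none).move .right = wordTape [] r := by
  have h : Turing.ListBlank.cons none (Turing.ListBlank.mk ([] : List (Option ℚ))) =
    Turing.ListBlank.mk [] := Quotient.sound' (.inr ⟨1, rfl⟩)
  simp [wordTape, Turing.Tape.write_mk', Turing.Tape.move_right_mk', Turing.ListBlank.tail_mk, h]

end wordTape

/-! ### Arithmetic expressions -/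

/-- Arithmetic expressions; `x / 0 = 0`. -/
inductive QExpr (V : Type) : Type
  | const (c : ℚ) : QExpr V
  | var (v : V) : QExpr V
  | add (e e' : QExpr V) : QExpr V
  | sub (e e' : QExpr V) : QExpr V
  | mul (e e' : QExpr V) : QExpr V
  | div (e e' : QExpr V) : QExpr V

namespace QExpr

variable {V : Type}

/-- The value of an expression. -/
def eval (h : V → ℚ) : QExpr V → ℚ
  | const c => c
  | var v => h v
  | add e e' => e.eval h + e'.eval h
  | sub e e' => e.eval h - e'.eval h
  | mul e e' => e.eval h * e'.eval h
  | div e e' => e.eval h / e'.eval h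

end QExpr

/-- `f` is given by an arithmetic expression. -/
def IsQExpr {V : Type} (f : (V → ℚ) → ℚ) : Prop := ∃ e : QExpr V, ∀ h, e.eval h = f h

namespace IsQExpr

variable {V : Type} {f g : (V → ℚ) → ℚ}

theorem const (c : ℚ) : IsQExpr fun _ : V → ℚ => c := ⟨.const c, fun _ => rfl⟩

theorem var (v : V) : IsQExpr fun h : V → ℚ => h v := ⟨.var v, fun _ => rfl⟩

theorem add (hf : IsQExpr f) (hg : IsQExpr g) : IsQExpr fun h => f h + g h := by
  obtain ⟨e, he⟩ := hf
  obtain ⟨e', he'⟩ := hg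
  exact ⟨.add e e', fun h => by simp [QExpr.eval, he, he']⟩

theorem sub (hf : IsQExpr f) (hg : IsQExpr g) : IsQExpr fun h => f h - g h := by
  obtain ⟨e, he⟩ := hf
  obtain ⟨e', he'⟩ := hg
  exact ⟨.sub e e', fun h => by simp [QExpr.eval, he, he']⟩

theorem mul (hf : IsQExpr f) (hg : IsQExpr g) : IsQExpr fun h => f h * g h := by
  obtain ⟨e, he⟩ := hf
  obtain ⟨e', he'⟩ := hg
  exact ⟨.mul e e', fun h => by simp [QExpr.eval, he, he']⟩

theorem div (hf : IsQExpr f) (hg : IsQExpr g) : IsQExpr fun h => f h / g h := by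
  obtain ⟨e, he⟩ := hf
  obtain ⟨e', he'⟩ := hg
  exact ⟨.div e e', fun h => by simp [QExpr.eval, he, he']⟩

theorem sum {ι : Type*} (s : Finset ι) {f : ι → (V → ℚ) → ℚ} (hf : ∀ i ∈ s, IsQExpr (f i)) :
    IsQExpr fun h => ∑ i ∈ s, f i h := by
  classical
  induction s using Finset.induction_on with
  | empty => simpa using const 0
  | insert a s ha ih =>
    simp_rw [Finset.sum_insert ha]
    exact (hf a (by simp)).add (ih fun i hi => hf i (by simp [hi]))

theorem prod {ι : Type*} (s : Finset ι) {f : ι → (V → ℚ) → ℚ} (hf : ∀ i ∈ s, IsQExpr (f i)) :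
    IsQExpr fun h => ∏ i ∈ s, f i h := by
  classical
  induction s using Finset.induction_on with
  | empty => simpa using const 1
  | insert a s ha ih =>
    simp_rw [Finset.prod_insert ha]
    exact (hf a (by simp)).mul (ih fun i hi => hf i (by simp [hi]))

theorem dotProduct {ι : Type*} [Fintype ι] {f g : (V → ℚ) → ι → ℚ}
    (hf : ∀ i, IsQExpr fun h => f h i) (hg : ∀ i, IsQExpr fun h => g h i) :
    IsQExpr fun h => f h ⬝ᵥ g h :=
  sum _ fun i _ => (hf i).mul (hg i)

theorem det {ι : Type*} [Fintype ι] [DecidableEq ι] {A : (V → ℚ) → Matrix ι ι ℚ}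
    (hA : ∀ i j, IsQExpr fun h => A h i j) : IsQExpr fun h => (A h).det := by
  simp_rw [Matrix.det_apply']
  exact sum _ fun σ _ => (const _).mul (prod _ fun i _ => hA _ _)

/-- Cramer's rule needs no pivoting and hence no branching. A singular matrix has inverse `0`, which
agrees with the convention `x / 0 = 0`, so no case distinction on the determinant arises. -/
theorem inv {ι : Type*} [Fintype ι] [DecidableEq ι] {A : (V → ℚ) → Matrix ι ι ℚ}
    (hA : ∀ i j, IsQExpr fun h => A h i j) (i j : ι) : IsQExpr fun h => (A h)⁻¹ i j := by
  simp_rw [Matrix.inv_def, Ring.inverse_eq_inv', Matrix.smul_apply, smul_eq_mul,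
    Matrix.adjugate_apply]
  have h1 : IsQExpr fun h => ((A h).det)⁻¹ := by
    simpa using (const 1).div (det hA)
  refine h1.mul (det fun k l => ?_)
  by_cases hk : k = j
  · subst hk
    simpa using const _
  · simpa [Matrix.updateRow_ne hk] using hA k l

end IsQExpr

/-! ### Families of state transformations that one program performs -/

namespace Tapes

variable {V : Type}

/-- The scanned number; a blank counts as `0`. -/
def val (S : Tapes V) (v : V) : ℚ := (S v).head.getD 0

/-- Two working tapes are added: a stack and an accumulator. -/
def full (S : Tapes V) (l : List ℚ) (o : Option ℚ) : Tapes (V ⊕ Bool) :=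
  Sum.elim S fun b => if b then wordTape [] o.toList else wordTape l []

/-- The state in which the two operands are scanned on the working tapes. -/
def full₂ (S : Tapes V) (a : ℚ) (l : List ℚ) (b : ℚ) : Tapes (V ⊕ Bool) :=
  Sum.elim S fun c => if c then wordTape [] [b] else wordTape l [a]

end Tapes

/-- Stack evaluation by recursion on `e`; the number of steps depends on `e` alone. The stack `l` is
arbitrary, so that the second operand can be evaluated on top of the stored value of the first. -/
theorem QExpr.exists_prog {V : Type} (e : QExpr V) :
    ∃ (P : QProg (V ⊕ Bool)) (t : ℕ), ∀ (S : Tapes V) (l : List ℚ) (o : Option ℚ),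
      P.Runs (S.full l o) (S.full l (some (e.eval S.val))) t := by
  have hconst : ∀ c : ℚ, ∃ (P : QProg (V ⊕ Bool)) (t : ℕ), ∀ (S : Tapes V) (l : List ℚ)
      (o : Option ℚ), P.Runs (S.full l o) (S.full l (some c)) t := by
    intro c
    refine ⟨.op (Sum.elim (fun _ => .keep) fun b => if b then .const c else .keep)
      fun _ => none, 1, fun S l o => ?_⟩
    convert QProg.runs_op _ _ _ using 1
    funext v
    rcases v with v | v | v <;> cases o <;>
      simp [Tapes.full, Tapes.act, QMachine.moveHead, QMachine.writeValue]
  have hbin : ∀ (w : QWrite (V ⊕ Bool)) (f : ℚ → ℚ → ℚ) (e e' : QExpr V),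
      (∀ (S : Tapes V) (l : List ℚ) (a b : ℚ), QMachine.writeValue
        (fun i => (S.full₂ a l b i).head) (Sum.inr true) w = some (f a b)) →
      (∃ (P : QProg (V ⊕ Bool)) (t : ℕ), ∀ (S : Tapes V) (l : List ℚ) (o : Option ℚ),
        P.Runs (S.full l o) (S.full l (some (e.eval S.val))) t) →
      (∃ (P : QProg (V ⊕ Bool)) (t : ℕ), ∀ (S : Tapes V) (l : List ℚ) (o : Option ℚ),
        P.Runs (S.full l o) (S.full l (some (e'.eval S.val))) t) →
      ∃ (P : QProg (V ⊕ Bool)) (t : ℕ), ∀ (S : Tapes V) (l : List ℚ) (o : Option ℚ),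
        P.Runs (S.full l o) (S.full l (some (f (e.eval S.val) (e'.eval S.val)))) t := by
    rintro w f e e' hw ⟨P, t, h⟩ ⟨P', t', h'⟩
    -- The first operand is pushed, the second one is left in the accumulator, the stack head moves
    -- back so that both are scanned, and the operation is performed while the stack cell is erased.
    refine ⟨P.seq (.seq (.op (Sum.elim (fun _ => .keep) fun b => if b then .keep else
        .copy (.inr true)) (Sum.elim (fun _ => none) fun b => if b then none else some .right))
      (P'.seq (.seq (.op (fun _ => .keep) (Sum.elim (fun _ => none) fun b => if b then none else
        some .left)) (.op (Sum.elim (fun _ => .keep) fun b => if b then w else .erase)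
          fun _ => none)))), _, fun S l o => (h S l o).seq (.seq
      (S' := S.full (e.eval S.val :: l) (some (e.eval S.val))) (t := 1) ?_ ((h' S _ _).seq
      (.seq (S' := S.full₂ (e.eval S.val) l (e'.eval S.val)) (t := 1) (t' := 1) ?_ ?_)))⟩
    · convert QProg.runs_op _ _ _ using 1
      funext v
      rcases v with v | v | v <;>
        simp [Tapes.full, Tapes.act, QMachine.moveHead, QMachine.writeValue]
    · convert QProg.runs_op _ _ _ using 1
      funext v
      rcases v with v | v | v <;>
        simp [Tapes.full, Tapes.full₂, Tapes.act, QMachine.moveHead, QMachine.writeValue]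
    · convert QProg.runs_op _ _ _ using 1
      funext v
      rcases v with v | v | v
      · simp [Tapes.full, Tapes.full₂, Tapes.act, QMachine.moveHead, QMachine.writeValue]
      · simp [Tapes.full, Tapes.full₂, Tapes.act, QMachine.moveHead, QMachine.writeValue]
      · simp [Tapes.full, Tapes.act, QMachine.moveHead, hw]
        simp [Tapes.full₂]
  induction e with
  | const c => exact hconst c
  | var v =>
    -- Copying would transfer a blank as a blank. Adding the scanned cell to `0` reads a blank as
    -- `0`, as `Tapes.val` does.
    obtain ⟨P, t, h⟩ := hconst 0
    refine ⟨P.seq (.op (Sum.elim (fun _ => .keep) fun b =>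
      if b then .add (.inl v) (.inr true) else .keep) fun _ => none), _,
      fun S l o => (h S l o).seq (t' := 1) ?_⟩
    convert QProg.runs_op _ _ _ using 1
    funext v
    rcases v with v | v | v <;>
      simp [Tapes.full, Tapes.act, QMachine.moveHead, QMachine.writeValue, QExpr.eval, Tapes.val]
  | add e e' h h' =>
    exact hbin (.add (.inr false) (.inr true)) (· + ·) e e'
      (fun S l a b => by simp [Tapes.full₂, QMachine.writeValue]) h h'
  | sub e e' h h' =>
    exact hbin (.sub (.inr false) (.inr true)) (· - ·) e e'
      (fun S l a b => by simp [Tapes.full₂, QMachine.writeValue]) h h'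
  | mul e e' h h' =>
    exact hbin (.mul (.inr false) (.inr true)) (· * ·) e e'
      (fun S l a b => by simp [Tapes.full₂, QMachine.writeValue]) h h'
  | div e e' h h' =>
    exact hbin (.div (.inr false) (.inr true)) (· / ·) e e'
      (fun S l a b => by simp [Tapes.full₂, QMachine.writeValue]) h h'

/-- One program transforms `s a` into `s' a`, for all parameters `a` with `pre a`, in
`O(size a + 1)` steps. -/
def Does {V A : Type} (pre : A → Prop) (s s' : A → Tapes V) (size : A → ℕ) : Prop :=
  ∃ (P : QProg (V ⊕ Bool)) (C : ℕ), ∀ a, pre a →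
    P.Runs ((s a).full [] none) ((s' a).full [] none) (C * (size a + 1))

/-! ### Composition rules for uniform programs. -/

namespace Does

variable {V A B : Type} {pre : A → Prop} {s s' s'' : A → Tapes V} {size : A → ℕ}

theorem congr {r r' : A → Tapes V} (h : Does pre r r' size) (hs : ∀ a, pre a → s a = r a)
    (hs' : ∀ a, pre a → s' a = r' a) : Does pre s s' size := by
  obtain ⟨P, C, h⟩ := h
  refine ⟨P, C, fun a ha => ?_⟩
  rw [hs a ha, hs' a ha]
  exact h a ha

theorem mono {size' : A → ℕ} (h : Does pre s s' size) (k : ℕ)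
    (hk : ∀ a, pre a → size a ≤ k * (size' a + 1)) : Does pre s s' size' := by
  obtain ⟨P, C, h⟩ := h
  refine ⟨P, C * (k + 1), fun a ha => (h a ha).mono ?_⟩
  rw [mul_assoc]
  refine Nat.mul_le_mul_left _ ?_
  have := hk a ha
  rw [Nat.add_mul]
  omega

theorem refl (pre : A → Prop) (s : A → Tapes V) (size : A → ℕ) : Does pre s s size :=
  ⟨.skip, 0, fun _ _ => (QProg.runs_skip _).mono (by simp)⟩

theorem trans (h : Does pre s s' size) (h' : Does pre s' s'' size) : Does pre s s'' size := by
  obtain ⟨P, C, h⟩ := h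
  obtain ⟨P', C', h'⟩ := h'
  refine ⟨P.seq P', C + C' + 1, fun a ha => ((h a ha).seq (h' a ha)).mono ?_⟩
  simp only [Nat.add_mul]
  omega

/-- A number of consecutive transformations that does not depend on the parameters. -/
theorem iterate (k : ℕ) (s : ℕ → A → Tapes V) (h : ∀ i < k, Does pre (s i) (s (i + 1)) size) :
    Does pre (s 0) (s k) size := by
  induction k with
  | zero => exact refl _ _ _
  | succ k ih => exact (ih fun i hi => h i (by omega)).trans (h k (by omega))

theorem op (w : V → QWrite V) (mv : V → Option Turing.Dir) (pre : A → Prop) (s : A → Tapes V)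
    (size : A → ℕ) : Does pre s (fun a => (s a).act w mv) size := by
  refine ⟨.op (Sum.elim (fun v => QProg.mapWrite .inl (w v)) fun _ => .keep)
    (Sum.elim mv fun _ => none), 1, fun a _ => ?_⟩
  refine QProg.Runs.mono (t := 1) ?_ (by omega)
  convert QProg.runs_op _ _ _ using 1
  funext v
  rcases v with v | v
  · simp only [Tapes.full, Tapes.act, Sum.elim_inl]
    cases w v <;> rfl
  · cases v <;> simp [Tapes.full, Tapes.act, QMachine.moveHead, QMachine.writeValue]

theorem assign [DecidableEq V] {f : (V → ℚ) → ℚ} (hf : IsQExpr f) (v : V) (pre : A → Prop)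
    (s : A → Tapes V) (size : A → ℕ) : Does pre s
      (fun a => Function.update (s a) v (((s a) v).write (some (f (s a).val)))) size := by
  obtain ⟨e, he⟩ := hf
  obtain ⟨P, t, h⟩ := e.exists_prog
  refine ⟨P.seq (.op (Sum.elim (fun u => if u = v then .copy (.inr true) else .keep)
    fun b => if b then .erase else .keep) fun _ => none), t + 1 + 1, fun a _ => ?_⟩
  refine QProg.Runs.mono ((h (s a) [] none).seq (t' := 1) ?_) (Nat.le_mul_of_pos_right _ (by omega))
  convert QProg.runs_op _ _ _ using 1
  funext u
  rcases u with u | u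
  · by_cases hu : u = v
    · subst hu
      simp [Tapes.full, Tapes.act, QMachine.moveHead, QMachine.writeValue, he]
    · simp [Tapes.full, Tapes.act, QMachine.moveHead, QMachine.writeValue, hu]
  · cases u <;> simp [Tapes.full, Tapes.act, QMachine.moveHead, QMachine.writeValue]

theorem ite (c : (V → Option SignType) → Prop)
    (h : Does (fun a => pre a ∧ c (s a).scan) s s' size)
    (h' : Does (fun a => pre a ∧ ¬c (s a).scan) s s' size) : Does pre s s' size := by
  obtain ⟨P, C, h⟩ := h
  obtain ⟨P', C', h'⟩ := h'
  have hs : ∀ a, ((s a).full [] none).scan ∘ Sum.inl = (s a).scan := fun a => rfl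
  refine ⟨.ite (fun σ => c (σ ∘ Sum.inl)) P P', C + C' + 1, fun a ha => ?_⟩
  by_cases hc : c (s a).scan
  · refine (QProg.runs_ite_true (by rwa [hs]) (h a ⟨ha, hc⟩)).mono ?_
    simp only [Nat.add_mul]
    omega
  · refine (QProg.runs_ite_false (by rwa [hs]) (h' a ⟨ha, hc⟩)).mono ?_
    simp only [Nat.add_mul]
    omega

/-- The round number is part of the parameter of the body, so one program and one constant serve all
rounds. -/
theorem loop (c : (V → Option SignType) → Prop) (len : A → ℕ) (s : A → ℕ → Tapes V)
    (h : Does (fun p : A × ℕ => pre p.1 ∧ p.2 < len p.1) (fun p => s p.1 p.2)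
      (fun p => s p.1 (p.2 + 1)) fun p => size p.1)
    (hc : ∀ a, pre a → ∀ i < len a, c (s a i).scan)
    (hn : ∀ a, pre a → ¬c (s a (len a)).scan) :
    Does pre (fun a => s a 0) (fun a => s a (len a)) fun a => len a * (size a + 1) := by
  obtain ⟨P, C, h⟩ := h
  refine ⟨.loop (fun σ => c (σ ∘ Sum.inl)) P, C + 2, fun a ha => ?_⟩
  refine (QProg.runs_loop (S := fun i => (s a i).full [] none) (t := C * (size a + 1))
    (fun i hi => h (a, i) ⟨ha, hi⟩) (fun i hi => hc a ha i hi) (hn a ha)).mono ?_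
  have : len a * 2 ≤ 2 * (len a * (size a + 1)) := by nlinarith
  calc len a * (C * (size a + 1) + 2) = C * (len a * (size a + 1)) + len a * 2 := by ring
    _ ≤ C * (len a * (size a + 1)) + 2 * (len a * (size a + 1)) := by omega
    _ = (C + 2) * (len a * (size a + 1)) := by ring
    _ ≤ _ := Nat.mul_le_mul_left _ (Nat.le_succ _)

theorem call (M : QMachine) (f : M.K → V) (g : V → Option M.K)
    (hfg : ∀ v k, g v = some k ↔ f k = v) (inp out : A → List ℚ)
    (h : ∀ a, pre a → M.OutputsWithin (inp a) (out a) (size a))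
    (hs : ∀ a, pre a → ∀ k, s a (f k) = M.wordOn M.inTape (inp a) k) :
    Does pre s (fun a => QProg.overlay g (M.wordOn M.outTape (out a)) (s a)) size := by
  refine ⟨(QProg.ofMachine M).embed (Sum.inl ∘ f) (Sum.elim g fun _ => none), 1, fun a ha => ?_⟩
  refine QProg.Runs.mono (t := size a) ?_ (by omega)
  have := (QProg.runs_ofMachine (h a ha)).embed (f := (Sum.inl ∘ f : _ → V ⊕ Bool))
    (g := Sum.elim g fun _ => none) (by rintro (v | b) k <;> simp [hfg]) ((s a).full [] none)
  convert this using 1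
  · funext v
    rcases v with v | v
    · rcases hv : g v with _ | k
      · simp [QProg.overlay, hv]
      · simp only [QProg.overlay, Sum.elim_inl, hv, Option.elim, ← hs a ha, Tapes.full]
        rw [(hfg _ _).1 hv]
    · rfl
  · funext v
    rcases v with v | v <;> rfl

/-- The heads of the tapes in `W` go back to the first letter. -/
theorem rewind (W : V → Prop) (v₀ : V) (h₀ : W v₀) (len : A → ℕ) (l r : A → V → List ℚ)
    (hs : ∀ a, pre a → ∀ v, W v → s a v = wordTape (l a v) (r a v))
    (hl : ∀ a, pre a → ∀ v, W v → (l a v).length = len a) :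
    Does pre s (fun a v => open Classical in
      if W v then wordTape [] ((l a v).reverse ++ r a v) else s a v) len := by
  classical
  -- The heads have made `i + 1` moves to the left. After the last one they scan the blank before
  -- the word, a position that `wordTape` does not describe; hence the explicit move, which a final
  -- step to the right undoes. All words to the left have the same length, so `v₀` alone decides
  -- when to stop.
  let u : A → ℕ → Tapes V := fun a i v => if W v then
    (wordTape ((l a v).drop i) (((l a v).take i).reverse ++ r a v)).move .left else s a v
  have h₁ : Does pre s (fun a => u a 0) len := by
    refine (op (fun _ => .keep) (fun v => if W v then some .left else none) pre s len).congr
      (fun _ _ => rfl) fun a ha => ?_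
    funext v
    by_cases hv : W v <;> simp [u, Tapes.act_keep, hv, hs a ha, QMachine.moveHead]
  have h₂ : Does pre (fun a => u a 0) (fun a => u a (len a)) fun a => len a * (0 + 1) := by
    refine loop (size := fun _ => 0) (fun σ => σ v₀ ≠ none) len u ?_ (fun a ha i hi => ?_)
      fun a ha => ?_
    · refine (op (fun _ => .keep) (fun v => if W v then some .left else none) _ _ _).congr
        (fun _ _ => rfl) ?_
      rintro ⟨a, i⟩ ⟨ha, hi⟩
      funext v
      by_cases hv : W v
      · have hi' : i < (l a v).length := by rw [hl a ha v hv]; exact hi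
        simp only [u, Tapes.act_keep, hv, QMachine.moveHead, if_true]
        rw [List.drop_eq_getElem_cons hi', wordTape.move_left, List.take_succ_eq_append_getElem hi',
          List.reverse_append, List.reverse_singleton, List.singleton_append, List.cons_append]
      · simp [u, Tapes.act_keep, hv, QMachine.moveHead]
    · have hi' : i < (l a v₀).length := by rw [hl a ha v₀ h₀]; exact hi
      simp only [u, Tapes.scan, h₀, if_true]
      rw [List.drop_eq_getElem_cons hi', wordTape.move_left]
      simp
    · simp only [u, Tapes.scan, h₀, if_true]
      rw [List.drop_eq_nil_of_le (hl a ha v₀ h₀).le, wordTape.head_move_left_nil]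
      simp
  refine (h₁.trans (h₂.mono 1 fun a _ => by omega)).trans ?_
  refine (op (fun _ => .keep) (fun v => if W v then some .right else none) pre _ len).congr
    (fun _ _ => rfl) fun a ha => ?_
  funext v
  by_cases hv : W v
  · simp only [u, Tapes.act_keep, hv, QMachine.moveHead, if_true]
    rw [List.drop_eq_nil_of_le (hl a ha v hv).le, List.take_of_length_le (hl a ha v hv).le]
    exact (Turing.Tape.move_left_right _).symm
  · simp [u, Tapes.act_keep, hv, QMachine.moveHead]

end Does

theorem IsQExpr.subst {V W : Type} {f : (V → ℚ) → ℚ} (hf : IsQExpr f) {u : (W → ℚ) → V → ℚ}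
    (hu : ∀ v, IsQExpr fun h => u h v) : IsQExpr fun h => f (u h) := by
  obtain ⟨e, he⟩ := hf
  simp_rw [← he]
  clear he
  induction e with
  | const c => exact .const c
  | var v => exact hu v
  | add e e' h h' => exact h.add h'
  | sub e e' h h' => exact h.sub h'
  | mul e e' h h' => exact h.mul h'
  | div e e' h h' => exact h.div h'

namespace Does

variable {V A : Type} {pre : A → Prop} {s s' : A → Tapes V} {size : A → ℕ}

/-- The assignments are made one after the other. By `hd` the assigned values do not depend on the
target tapes, so earlier assignments do not influence later ones and the result is that of a
simultaneous assignment. -/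
theorem assignFamily [DecidableEq V] {ι : Type} [Finite ι] (t : ι → V) (ht : t.Injective)
    {f : ι → (V → ℚ) → ℚ} (hf : ∀ i, IsQExpr (f i))
    (hd : ∀ a, pre a → ∀ S : Tapes V, (∀ v ∉ Set.range t, S v = s a v) →
      ∀ i, f i S.val = f i (s a).val)
    (h₁ : ∀ a, pre a → ∀ i, s' a (t i) = (s a (t i)).write (some (f i (s a).val)))
    (h₂ : ∀ a, pre a → ∀ v ∉ Set.range t, s' a v = s a v) (size : A → ℕ) :
    Does pre s s' size := by
  classical
  have := Fintype.ofFinite ι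
  let u : Finset ι → A → Tapes V := fun I a v => if ∃ i ∈ I, t i = v then s' a v else s a v
  have key : ∀ I, Does pre s (u I) size := by
    intro I
    induction I using Finset.induction_on with
    | empty => exact (refl pre s size).congr (fun _ _ => rfl) fun a _ => by simp [u]
    | insert i I hi ih =>
      refine ih.trans ((assign (hf i) (t i) pre (u I) size).congr (fun _ _ => rfl) fun a ha => ?_)
      funext v
      by_cases hv : v = t i
      · subst hv
        have hn : ¬∃ i' ∈ I, t i' = t i := by
          rintro ⟨i', hi', e⟩
          exact hi (ht e ▸ hi')
        have hS : f i (u I a).val = f i (s a).val := by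
          refine hd a ha _ (fun v hv => ?_) i
          simp only [u]
          rw [if_neg]
          rintro ⟨i', -, rfl⟩
          exact hv ⟨i', rfl⟩
        rw [Function.update_self, hS]
        simp only [u]
        rw [if_pos ⟨i, by simp, rfl⟩, if_neg hn, h₁ a ha]
      · rw [Function.update_of_ne hv]
        simp only [u, Finset.mem_insert, exists_eq_or_imp, Ne.symm hv, false_or]
  refine (key Finset.univ).congr (fun _ _ => rfl) fun a ha => ?_
  funext v
  simp only [u, Finset.mem_univ, true_and]
  split_ifs with h
  · rfl
  · exact h₂ a ha v h

/-- Append the scanned numbers of a list of tapes to the word on tape `t`. -/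
theorem emit [DecidableEq V] (t : V) (src : List V) (hsrc : t ∉ src) (l : A → List ℚ)
    (hs : ∀ a, pre a → s a t = wordTape (l a) []) (size : A → ℕ) :
    Does pre s (fun a => Function.update (s a) t
      (wordTape ((src.map (s a).val).reverse ++ l a) [])) size := by
  induction src generalizing s l with
  | nil =>
    refine (refl pre s size).congr (fun _ _ => rfl) fun a ha => ?_
    simp [← hs a ha]
  | cons v src ih =>
    rw [List.mem_cons, not_or] at hsrc
    have h₁ : Does pre s (fun a => Function.update (s a) t (wordTape ((s a).val v :: l a) []))
        size := by
      -- The scanned cell of `t` is blank and counts as `0`, so the sum is the number scanned on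
      -- `v`, with `0` in place of a blank. A mere copy could leave a gap in the word.
      refine (op (fun u => if u = t then .add v t else .keep)
        (fun u => if u = t then some .right else none) pre s size).congr (fun _ _ => rfl)
        fun a ha => ?_
      funext u
      by_cases hu : u = t
      · subst hu
        simp [Tapes.act, QMachine.writeValue, QMachine.moveHead, hs a ha, Tapes.val]
      · simp [Tapes.act, QMachine.writeValue, QMachine.moveHead, hu]
    refine h₁.trans ((ih hsrc.2 (s := fun a => Function.update (s a) t (wordTape
      ((s a).val v :: l a) [])) (fun a => (s a).val v :: l a) fun a _ => by simp).congr
      (fun _ _ => rfl) fun a ha => ?_)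
    have hm : src.map (Tapes.val (Function.update (s a) t (wordTape ((s a).val v :: l a) []))) = src.map (s a).val := by
      refine List.map_congr_left fun u hu => ?_
      have : u ≠ t := fun e => hsrc.2 (e ▸ hu)
      simp [Tapes.val, this]
    simp [hm]

/-- Move a word of fixed length from tape `t` to other tapes; `g v` tells which letter tape `v`
receives. -/
theorem absorb [DecidableEq V] (t : V) {k : ℕ} (g : V → Option (Fin k))  (x : A → Fin k → ℚ) (r : A → List ℚ)
    (hs : ∀ a, pre a → s a t = wordTape [] (List.ofFn (x a) ++ r a)) (size : A → ℕ) :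
    Does pre s (fun a => Function.update (fun v => (g v).elim (s a v) fun i =>
      (s a v).write (some (x a i))) t (wordTape [] (r a))) size := by
  let u : ℕ → A → Tapes V := fun j a => Function.update (fun v => (g v).elim (s a v) fun i =>
    if i < j then (s a v).write (some (x a i)) else s a v) t
      (wordTape [] ((List.ofFn (x a)).drop j ++ r a))
  have h : Does pre (u 0) (u k) size := by
    refine iterate k u fun j hj => ?_
    refine (op (fun v => if v = t then .erase else if g v = some ⟨j, hj⟩ then .copy t else .keep)
      (fun v => if v = t then some .right else none) pre (u j) size).congr (fun _ _ => rfl)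
      fun a ha => ?_
    have hdrop : (List.ofFn (x a)).drop j = x a ⟨j, hj⟩ :: (List.ofFn (x a)).drop (j + 1) := by
      rw [List.drop_eq_getElem_cons (by simpa using hj)]
      simp
    funext v
    by_cases hv : v = t
    · subst hv
      simp only [u, Tapes.act, QMachine.writeValue, QMachine.moveHead, Function.update_self,
        if_true]
      rw [hdrop, List.cons_append, wordTape.erase_move_right]
    · simp only [u, Tapes.act, QMachine.moveHead, Function.update_of_ne hv, hv, if_false]
      rcases hgv : g v with _ | i
      · simp [QMachine.writeValue, hv, hgv]
      · by_cases hi : i = ⟨j, hj⟩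
        · subst hi
          simp [QMachine.writeValue, hdrop]
        · have hij : (i : ℕ) ≠ j := fun e => hi (Fin.ext e)
          have hlt : (i : ℕ) ≤ j ↔ (i : ℕ) < j := by omega
          simp [QMachine.writeValue, hi, hlt, hgv, hv]
  refine h.congr (fun a ha => ?_) fun a ha => ?_
  · funext v
    by_cases hv : v = t
    · subst hv
      simp [u, hs a ha]
    · rcases hgv : g v with _ | i <;> simp [u, hv, hgv]
  · funext v
    by_cases hv : v = t
    · subst hv
      simp [u, List.drop_eq_nil_of_le]
    · rcases hgv : g v with _ | i <;> simp [u, hv, hgv]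

end Does

/-! ### Rows of a data set and candidate classifiers -/

/-- A row `x, y` of a data set. -/
abbrev DataRow (d : ℕ) : Type := Fin (d + 1) → ℚ

namespace DataRow

variable {d : ℕ}

/-- The extended vector of a row. -/
def ext (r : DataRow d) : Fin (d + 1) → ℚ := PWA.extend (Fin.init r)

/-- The error of the affine model `v`. -/
def residual (v : Fin (d + 1) → ℚ) (r : DataRow d) : ℚ := r (Fin.last d) - v ⬝ᵥ r.ext

/-- The row belongs to class `j`. -/
def InClass {n : ℕ} (θ : Fin n → Fin (d + 1) → ℚ) (j : Fin n) (r : DataRow d) : Prop :=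
  PWA.IsFirstArgmax (fun k => θ k ⬝ᵥ r.ext) j

/-- By how much class `j` beats class `k`. -/
def margin {n : ℕ} (θ : Fin n → Fin (d + 1) → ℚ) (j k : Fin n) (r : DataRow d) : ℚ :=
  θ j ⬝ᵥ r.ext - θ k ⬝ᵥ r.ext

theorem inClass_iff {n : ℕ} {θ : Fin n → Fin (d + 1) → ℚ} {j : Fin n} {r : DataRow d} :
    r.InClass θ j ↔ (∀ k, 0 ≤ margin θ j k r) ∧ ∀ k < j, 0 < margin θ j k r := by
  simp [InClass, PWA.IsFirstArgmax, margin]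

theorem isQExpr_ext {V : Type} {u : (V → ℚ) → DataRow d} (hu : ∀ c, IsQExpr fun h => u h c)
    (c : Fin (d + 1)) : IsQExpr fun h => (u h).ext c := by
  induction c using Fin.lastCases with
  | last => simpa [ext, PWA.extend] using IsQExpr.const 1
  | cast c => simpa [ext, PWA.extend, Fin.init] using hu c.castSucc

theorem isQExpr_margin {V : Type} {n : ℕ} {θ : (V → ℚ) → Fin n → Fin (d + 1) → ℚ}
    {u : (V → ℚ) → DataRow d} (hθ : ∀ k c, IsQExpr fun h => θ h k c)
    (hu : ∀ c, IsQExpr fun h => u h c) (j k : Fin n) :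
    IsQExpr fun h => margin (θ h) j k (u h) :=
  (IsQExpr.dotProduct (hθ j) (isQExpr_ext hu)).sub (IsQExpr.dotProduct (hθ k) (isQExpr_ext hu))

theorem isQExpr_residual {V : Type} {v : (V → ℚ) → Fin (d + 1) → ℚ}
    {u : (V → ℚ) → DataRow d} (hv : ∀ c, IsQExpr fun h => v h c)
    (hu : ∀ c, IsQExpr fun h => u h c) : IsQExpr fun h => residual (v h) (u h) :=
  (hu _).sub (IsQExpr.dotProduct hv (isQExpr_ext hu))

/-- A number in `(0, 1]` such that multiplying `b` with it or with anything smaller makes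
`b` negligible against `a`, unless `a = 0`. -/
def damp (a b : ℚ) : ℚ := a / a * (a ^ 2 / (a ^ 2 + b ^ 2 + 1)) + (1 - a / a)

theorem isQExpr_damp {V : Type} {f g : (V → ℚ) → ℚ} (hf : IsQExpr f) (hg : IsQExpr g) :
    IsQExpr fun h => damp (f h) (g h) := by
  simp_rw [damp, sq]
  exact ((hf.div hf).mul ((hf.mul hf).div (((hf.mul hf).add (hg.mul hg)).add (.const 1)))).add
    ((IsQExpr.const 1).sub (hf.div hf))

/-- How small a perturbation has to be for the row. -/
def scale {n : ℕ} (p q : Fin n → Fin (d + 1) → ℚ) (r : DataRow d) : ℚ :=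
  ∏ j, ∏ k, damp (margin p j k r) (margin q j k r)

end DataRow

/-- Classifiers `p + ε q` whose parameters are arithmetic expressions in `m` rows. -/
structure Candidates (n d m : ℕ) where
  p : (Fin m → DataRow d) → Fin n → Fin (d + 1) → ℚ
  q : (Fin m → DataRow d) → Fin n → Fin (d + 1) → ℚ
  isQExpr_p : ∀ k c, IsQExpr fun h : Fin m × Fin (d + 1) → ℚ => p (fun t i => h (t, i)) k c
  isQExpr_q : ∀ k c, IsQExpr fun h : Fin m × Fin (d + 1) → ℚ => q (fun t i => h (t, i)) k c

namespace Candidates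

variable {n d m : ℕ} (F : Candidates n d m)

/-- The parameters of the classifier. -/
def theta (z : Fin m → DataRow d) (ε : ℚ) : Fin n → Fin (d + 1) → ℚ :=
  fun k c => F.p z k c + ε * F.q z k c

/-- The size of the perturbation for a data set. -/
def eps (z : Fin m → DataRow d) (ρ : List (DataRow d)) : ℚ :=
  (ρ.map (DataRow.scale (F.p z) (F.q z))).prod

variable {V : Type} {z : (V → ℚ) → Fin m → DataRow d} (hz : ∀ t c, IsQExpr fun h => z h t c)
include hz

theorem isQExpr_p' (k : Fin n) (c : Fin (d + 1)) : IsQExpr fun h => F.p (z h) k c :=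
  (F.isQExpr_p k c).subst (u := fun h v => z h v.1 v.2) fun v => hz v.1 v.2

theorem isQExpr_q' (k : Fin n) (c : Fin (d + 1)) : IsQExpr fun h => F.q (z h) k c :=
  (F.isQExpr_q k c).subst (u := fun h v => z h v.1 v.2) fun v => hz v.1 v.2

theorem isQExpr_theta {ε : (V → ℚ) → ℚ} (hε : IsQExpr ε) (k : Fin n) (c : Fin (d + 1)) :
    IsQExpr fun h => F.theta (z h) (ε h) k c :=
  (F.isQExpr_p' hz k c).add (hε.mul (F.isQExpr_q' hz k c))

theorem isQExpr_scale {u : (V → ℚ) → DataRow d} (hu : ∀ c, IsQExpr fun h => u h c) :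
    IsQExpr fun h => DataRow.scale (F.p (z h)) (F.q (z h)) (u h) :=
  IsQExpr.prod _ fun j _ => IsQExpr.prod _ fun k _ => DataRow.isQExpr_damp
    (DataRow.isQExpr_margin (F.isQExpr_p' hz) hu j k)
    (DataRow.isQExpr_margin (F.isQExpr_q' hz) hu j k)

end Candidates

/-- A classifier, submodels, and the sum of the losses. -/
structure Model (n d : ℕ) where
  cost : ℚ
  w : Fin n → Fin (d + 1) → ℚ
  θ : Fin n → Fin (d + 1) → ℚ

/-! ### The memory of the regression program -/

/-- The registers. -/
inductive Register (n d : ℕ) : Type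
  | eps | cost | diff | best
  | margin (k : Fin n)
  | w (j : Fin n) (c : Fin (d + 1))
  | bestW (j : Fin n) (c : Fin (d + 1))
  | bestT (j : Fin n) (c : Fin (d + 1))
  deriving DecidableEq, Fintype

/-- The tapes: registers, `m + 1` copies of the data set, a tape for input and output, and
the tapes of the two given machines. -/
inductive TapeName (n d m : ℕ) (KM KL : Type) : Type
  | reg (r : Register n d)
  | row (s : Option (Fin m)) (c : Fin (d + 1))
  | io
  | sub (k : KM)
  | los (k : KL)
  deriving DecidableEq, Fintype

/-- The contents of the tapes. -/
structure Memory (n d m : ℕ) (KM KL : Type) where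
  rows : List (DataRow d)
  pos : Option (Fin m) → ℕ
  reg : Register n d → Option ℚ
  sub : Tapes KM
  los : Tapes KL
  io : Turing.Tape (Option ℚ)

namespace Memory

variable {n d m : ℕ} {KM KL : Type}

/-- Replace the registers. -/
@[simps]
def withReg (μ : Memory n d m KM KL) (R : Register n d → Option ℚ) : Memory n d m KM KL :=
  { μ with reg := R }

/-- Move the heads on the copies of the data set. -/
@[simps]
def withPos (μ : Memory n d m KM KL) (p : Option (Fin m) → ℕ) : Memory n d m KM KL :=
  { μ with pos := p }

/-- Replace the tapes of the first machine. -/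
@[simps]
def withSub (μ : Memory n d m KM KL) (U : Tapes KM) : Memory n d m KM KL := { μ with sub := U }

/-- Replace the tapes of the second machine. -/
@[simps]
def withLos (μ : Memory n d m KM KL) (U : Tapes KL) : Memory n d m KM KL := { μ with los := U }

/-- The tapes that present a memory. -/
def tapes (μ : Memory n d m KM KL) : Tapes (TapeName n d m KM KL)
  | .reg r => wordTape [] (μ.reg r).toList
  | .row s c => wordTape (((μ.rows.take (μ.pos s)).map fun r => r c).reverse)
      ((μ.rows.drop (μ.pos s)).map fun r => r c)
  | .io => μ.io
  | .sub k => μ.sub k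
  | .los k => μ.los k

/-- The row scanned on copy `s` of the data set. -/
def row (μ : Memory n d m KM KL) (s : Option (Fin m)) : DataRow d :=
  ((μ.rows.drop (μ.pos s)).head?).getD 0

/-- The rows scanned on the auxiliary copies of the data set. -/
def pointers (μ : Memory n d m KM KL) : Fin m → DataRow d := fun t => μ.row (some t)

@[simp]
theorem val_row (μ : Memory n d m KM KL) (s : Option (Fin m)) (c : Fin (d + 1)) :
    μ.tapes.val (.row s c) = μ.row s c := by
  simp only [Tapes.val, tapes, wordTape.head, row]
  rcases μ.rows.drop (μ.pos s) with _ | ⟨r, l⟩ <;> rfl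

@[simp]
theorem val_reg (μ : Memory n d m KM KL) (r : Register n d) :
    μ.tapes.val (.reg r) = (μ.reg r).getD 0 := by
  simp only [Tapes.val, tapes, wordTape.head]
  cases μ.reg r <;> rfl

variable [DecidableEq KM] [DecidableEq KL]

theorem update_reg (μ : Memory n d m KM KL) (r : Register n d) (x : ℚ) :
    Function.update μ.tapes (.reg r) ((μ.tapes (.reg r)).write (some x)) =
      (μ.withReg (Function.update μ.reg r (some x))).tapes := by
  funext v
  rcases v with r' | _ | _ | _ | _
  · by_cases h : r' = r
    · subst h
      cases hr : μ.reg r' <;> simp [tapes, hr]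
    · simp [tapes, h]
  all_goals rfl

theorem update_sub (μ : Memory n d m KM KL) (k : KM) (t : Turing.Tape (Option ℚ)) :
    Function.update μ.tapes (.sub k) t =
      (μ.withSub (Function.update μ.sub k t)).tapes := by
  funext v
  rcases v with _ | _ | _ | k' | _
  case sub =>
    by_cases h : k' = k
    · subst h
      simp [tapes]
    · simp [tapes, h]
  all_goals rfl

theorem update_los (μ : Memory n d m KM KL) (k : KL) (t : Turing.Tape (Option ℚ)) :
    Function.update μ.tapes (.los k) t =
      (μ.withLos (Function.update μ.los k t)).tapes := by
  funext v
  rcases v with _ | _ | _ | _ | k'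
  case los =>
    by_cases h : k' = k
    · subst h
      simp [tapes]
    · simp [tapes, h]
  all_goals rfl

/-- The classifier that is under consideration. -/
def theta (F : Candidates n d m) (μ : Memory n d m KM KL) : Fin n → Fin (d + 1) → ℚ :=
  F.theta μ.pointers ((μ.reg .eps).getD 0)

end Memory

/-! ### Registers and passes over the rows of the data set. -/

namespace Does

variable {n d m : ℕ} {KM KL A : Type} {pre : A → Prop}
  {μ ν : A → Memory n d m KM KL} {size : A → ℕ}

theorem setReg [DecidableEq KM] [DecidableEq KL] {f : (TapeName n d m KM KL → ℚ) → ℚ} (hf : IsQExpr f) (r : Register n d)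
    (pre : A → Prop) (μ : A → Memory n d m KM KL) (size : A → ℕ) :
    Does pre (fun a => (μ a).tapes) (fun a => ((μ a).withReg
      (Function.update (μ a).reg r (some (f (μ a).tapes.val)))).tapes) size := by
  simp_rw [← Memory.update_reg]
  exact assign hf _ _ _ _

/-- A single step that only overwrites registers. -/
theorem opReg (w : Register n d → QWrite (Register n d)) (pre : A → Prop)
    (μ : A → Memory n d m KM KL) (size : A → ℕ) {R : A → Register n d → Option ℚ}
    (hR : ∀ a, pre a → ∀ r, R a r = QMachine.writeValue (μ a).reg r (w r)) :
    Does pre (fun a => (μ a).tapes) (fun a => ((μ a).withReg (R a)).tapes) size := by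
  refine (op (fun v => match v with
    | .reg r => QProg.mapWrite .reg (w r)
    | _ => .keep) (fun _ => none) pre _ size).congr (fun _ _ => rfl) fun a ha => ?_
  funext v
  rcases v with r | _ | _ | _ | _
  · have hwr : ∀ o o' : Option ℚ, (wordTape [] o.toList).write o' = wordTape [] o'.toList := by
      rintro (_ | _) (_ | _) <;> simp
    have hh : ∀ r, ((μ a).tapes (.reg r)).head = (μ a).reg r := fun r => by
      simp only [Memory.tapes, wordTape.head]
      cases (μ a).reg r <;> rfl
    have hv : QMachine.writeValue (fun i => ((μ a).tapes i).head) (.reg r)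
        (QProg.mapWrite TapeName.reg (w r)) = R a r := by
      rw [hR a ha]
      cases w r <;> simp [QProg.mapWrite, QMachine.writeValue, hh]
    simp only [Tapes.act, QMachine.moveHead, hv]
    exact (hwr _ _).symm
  all_goals exact (Turing.Tape.write_self _).symm

/-- Do something for every row, the head of copy `s` of the data set being on that row. -/
theorem forRows (s : Option (Fin m)) (len : A → ℕ) (μ : A → ℕ → Memory n d m KM KL)
    (hrows : ∀ a, pre a → ∀ i ≤ len a, (μ a i).rows.length = len a)
    (hpos : ∀ a, pre a → ∀ i ≤ len a, (μ a i).pos s = 0)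
    (h : Does (fun p : A × ℕ => pre p.1 ∧ p.2 < len p.1)
      (fun p => ((μ p.1 p.2).withPos (Function.update (μ p.1 p.2).pos s p.2)).tapes)
      (fun p => ((μ p.1 (p.2 + 1)).withPos
        (Function.update (μ p.1 (p.2 + 1)).pos s p.2)).tapes) fun p => size p.1) :
    Does pre (fun a => (μ a 0).tapes) (fun a => (μ a (len a)).tapes)
      fun a => len a * (size a + 1) := by
  let ν : A → ℕ → Memory n d m KM KL := fun a i =>
    (μ a i).withPos (Function.update (μ a i).pos s i)
  have hstep : Does (fun p : A × ℕ => pre p.1 ∧ p.2 < len p.1)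
      (fun p => ((μ p.1 (p.2 + 1)).withPos
        (Function.update (μ p.1 (p.2 + 1)).pos s p.2)).tapes)
      (fun p => (ν p.1 (p.2 + 1)).tapes) fun p => size p.1 := by
    refine (op (fun _ => .keep) (fun v => match v with
      | .row s' _ => if s' = s then some .right else none
      | _ => none) _ _ _).congr (fun _ _ => rfl) ?_
    rintro ⟨a, i⟩ ⟨ha, hi⟩
    funext v
    rw [Tapes.act_keep]
    rcases v with _ | ⟨s', c⟩ | _ | _ | _
    case row =>
      by_cases hs : s' = s
      · subst hs
        have hlen : i < (μ a (i + 1)).rows.length := by rw [hrows a ha _ hi]; exact hi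
        simp only [ν, Memory.tapes, Memory.withPos, Function.update_self, if_true, QMachine.moveHead]
        rw [List.drop_eq_getElem_cons hlen, List.take_succ_eq_append_getElem hlen, List.map_cons,
          wordTape.move_right, List.map_append, List.reverse_append]
        rfl
      · simp [ν, Memory.tapes, hs, QMachine.moveHead]
    all_goals rfl
  have hloop := loop (fun σ => σ (.row s 0) ≠ none) len (fun a i => (ν a i).tapes)
    (h.trans hstep) (fun a ha i hi => by
      have hlen : i < (μ a i).rows.length := by rw [hrows a ha i hi.le]; exact hi
      simp only [ν, Memory.tapes, Tapes.scan, Memory.withPos, Function.update_self, wordTape.head]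
      rw [List.drop_eq_getElem_cons hlen]
      simp [hlen]) (fun a ha => by
      simp only [ν, Memory.tapes, Tapes.scan, Memory.withPos, Function.update_self, wordTape.head]
      rw [List.drop_eq_nil_of_le (hrows a ha _ le_rfl).le]
      simp)
  have hrew := rewind (pre := pre) (s := fun a => (ν a (len a)).tapes) (fun v => ∃ c, v = .row s c)
    (.row s 0) ⟨0, rfl⟩ len
    (fun a v => match v with
      | .row _ c => ((μ a (len a)).rows.map fun r => r c).reverse
      | _ => [])
    (fun _ _ => [])
    (by
      rintro a ha _ ⟨c, rfl⟩
      simp only [ν, Memory.tapes, Memory.withPos, Function.update_self]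
      rw [List.take_of_length_le (hrows a ha _ le_rfl).le,
        List.drop_eq_nil_of_le (hrows a ha _ le_rfl).le]
      rfl)
    (by
      rintro a ha _ ⟨c, rfl⟩
      simp [hrows a ha _ le_rfl])
  refine (hloop.trans (hrew.mono 1 fun a _ => by nlinarith)).congr (fun a ha => ?_) fun a ha => ?_
  · have : Function.update (μ a 0).pos s 0 = (μ a 0).pos := by
      rw [Function.update_eq_self_iff, hpos a ha 0 (Nat.zero_le _)]
    simp only [ν, this]
    rfl
  · funext v
    rcases v with _ | ⟨s', c⟩ | _ | _ | _
    case row =>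
      by_cases hs : s' = s
      · subst hs
        simp [Memory.tapes, hpos a ha _ le_rfl]
      · simp [ν, Memory.tapes, hs]
    all_goals simp [ν, Memory.tapes]

end Does

namespace Does

variable {n d m : ℕ} {KM KL A : Type} [DecidableEq KM] [DecidableEq KL] {pre : A → Prop}
  {μ ν : A → Memory n d m KM KL} {size : A → ℕ} (F : Candidates n d m)

theorem setMargins (j : Fin n) (pre : A → Prop) (μ : A → Memory n d m KM KL) (size : A → ℕ) :
    Does pre (fun a => (μ a).tapes) (fun a => ((μ a).withReg fun
      | .margin k => some (DataRow.margin ((μ a).theta F) j k ((μ a).row none))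
      | r => (μ a).reg r).tapes) size := by
  refine assignFamily (fun k => TapeName.reg (.margin k)) (fun k k' h => by simpa using h)
    (f := fun k h => DataRow.margin (F.theta (fun t c => h (.row (some t) c)) (h (.reg .eps)))
      j k fun c => h (.row none c))
    (fun k => DataRow.isQExpr_margin (F.isQExpr_theta (fun t c => .var _) (.var _))
      (fun c => .var _) j k) ?_ ?_ ?_ size
  · intro a _ S hS k
    have h : ∀ v ∉ Set.range fun k => TapeName.reg (.margin k), S.val v = (μ a).tapes.val v :=
      fun v hv => by rw [Tapes.val, hS v hv, Tapes.val]
    have h₁ := h (.reg .eps) (by simp)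
    have h₂ : ∀ s c, S.val (.row s c) = (μ a).tapes.val (.row s c) := fun s c => h _ (by simp)
    simp only [h₁, h₂]
  · intro a _ k
    simp only [Memory.val_row, Memory.val_reg]
    rw [← Function.update_self (f := (μ a).tapes) (TapeName.reg (.margin k))
      (((μ a).tapes (.reg (.margin k))).write _), Memory.update_reg]
    simp [Memory.tapes, Memory.theta]
    rfl
  · intro a _ v hv
    rcases v with r | _ | _ | _ | _
    case reg => cases r <;> first | rfl | exact absurd ⟨_, rfl⟩ hv
    all_goals rfl

-- The finite control sees signs only, and class membership is a condition on the signs of the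
-- margins (`DataRow.inClass_iff`). The margins are therefore computed into registers, tested and
-- erased again.
open Classical in
theorem ifInClass (j : Fin n) (hμ : ∀ a, pre a → ∀ k, (μ a).reg (.margin k) = none)
    (h : Does (fun a => pre a ∧ ((μ a).row none).InClass ((μ a).theta F) j)
      (fun a => (μ a).tapes) (fun a => (ν a).tapes) size) :
    Does pre (fun a => (μ a).tapes)
      (fun a => (if ((μ a).row none).InClass ((μ a).theta F) j then ν a else μ a).tapes) size := by
  have hc : ∀ a, (∀ k : Fin n, ((μ a).withReg fun
      | .margin k => some (DataRow.margin ((μ a).theta F) j k ((μ a).row none))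
      | r => (μ a).reg r).tapes.scan (.reg (.margin k)) ≠ some (-1) ∧
      (k < j → ((μ a).withReg fun
      | .margin k => some (DataRow.margin ((μ a).theta F) j k ((μ a).row none))
      | r => (μ a).reg r).tapes.scan (.reg (.margin k)) = some 1)) ↔
      ((μ a).row none).InClass ((μ a).theta F) j := by
    intro a
    simp [DataRow.inClass_iff, Tapes.scan, Memory.tapes, sign_eq_neg_one_iff, sign_eq_one_iff,
      forall_and]
  -- The margin registers were blank before, so erasing them restores the memory exactly, whichever
  -- branch is taken.
  have herase : ∀ p : A → Prop, (∀ a, p a → pre a) → Does p (fun a => ((μ a).withReg fun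
      | .margin k => some (DataRow.margin ((μ a).theta F) j k ((μ a).row none))
      | r => (μ a).reg r).tapes) (fun a => (μ a).tapes) size := by
    intro p hp
    refine (opReg (R := fun a => (μ a).reg) (fun
      | .margin _ => .erase
      | _ => .keep) p _ size fun a ha r => ?_).congr (fun _ _ => rfl) fun _ _ => rfl
    cases r <;> simp [QMachine.writeValue, hμ a (hp a ha)]
  refine (setMargins F j pre μ size).trans (ite (fun σ => ∀ k : Fin n,
    σ (.reg (.margin k)) ≠ some (-1) ∧ (k < j → σ (.reg (.margin k)) = some 1)) ?_ ?_)
  · simp_rw [hc]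
    exact ((herase _ fun a ha => ha.1).trans h).congr (fun _ _ => rfl) fun a ha => by rw [if_pos ha.2]
  · simp_rw [hc]
    exact (herase _ fun a ha => ha.1).congr (fun _ _ => rfl) fun a ha => by rw [if_neg ha.2]

end Does

namespace Memory

variable {n d m : ℕ} {KM KL : Type}

theorem row_withPos_of_ne (μ : Memory n d m KM KL) {s s' : Option (Fin m)} (h : s' ≠ s) (i : ℕ) :
    (μ.withPos (Function.update μ.pos s i)).row s' = μ.row s' := by
  simp [row, h]

theorem row_withPos_self (μ : Memory n d m KM KL) (s : Option (Fin m)) {i : ℕ}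
    (h : i < μ.rows.length) : (μ.withPos (Function.update μ.pos s i)).row s = μ.rows[i] := by
  simp [row, h]

theorem pointers_withPos_none (μ : Memory n d m KM KL) (i : ℕ) :
    (μ.withPos (Function.update μ.pos none i)).pointers = μ.pointers := by
  funext t
  exact μ.row_withPos_of_ne (by simp) i

end Memory

namespace Does

variable {n d m : ℕ} {KM KL A : Type} [DecidableEq KM] [DecidableEq KL] {pre : A → Prop}
  {μ ν : A → Memory n d m KM KL} {size : A → ℕ} (F : Candidates n d m)

/-- The size of the perturbation is a product of one factor for each row, so a single pass with the
head `none` computes it while the pointers stay where they are. -/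
theorem setEps (hpos : ∀ a, pre a → (μ a).pos none = 0) :
    Does pre (fun a => (μ a).tapes) (fun a => ((μ a).withReg (Function.update (μ a).reg .eps
      (some (F.eps (μ a).pointers (μ a).rows)))).tapes) fun a => (μ a).rows.length := by
  have h₁ := setReg (IsQExpr.const 1) .eps pre μ fun a => (μ a).rows.length
  have h₂ := forRows (pre := pre) (size := fun _ => 0) none (fun a => (μ a).rows.length)
    (fun a i => (μ a).withReg (Function.update (μ a).reg .eps
      (some (F.eps (μ a).pointers ((μ a).rows.take i))))) (fun _ _ _ _ => rfl)
    (fun a ha _ _ => hpos a ha) (by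
      refine (setReg (f := fun h => h (.reg .eps) * DataRow.scale
        (F.p fun t c => h (.row (some t) c)) (F.q fun t c => h (.row (some t) c))
        fun c => h (.row none c)) ((IsQExpr.var _).mul (F.isQExpr_scale (fun t c => .var _)
        fun c => .var _)) .eps _ _ _).congr (fun _ _ => rfl) ?_
      rintro ⟨a, i⟩ ⟨ha, hi⟩
      have e : F.eps (μ a).pointers ((μ a).rows.take (i + 1)) =
          F.eps (μ a).pointers ((μ a).rows.take i) *
            DataRow.scale (F.p (μ a).pointers) (F.q (μ a).pointers) (μ a).rows[i] := by
        rw [List.take_succ_eq_append_getElem hi, Candidates.eps, List.map_append, List.prod_append,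
          List.map_singleton, List.prod_singleton, Candidates.eps]
      simp only [e, Memory.val_row, Memory.val_reg,
        Memory.row_withPos_of_ne _ (Option.some_ne_none _), Memory.withReg_rows, hi,
        Memory.row_withPos_self, Memory.withPos_reg, Memory.withReg_reg, Function.update_self,
        Option.getD_some]
      change _ = (((μ a).withReg (Function.update (Function.update (μ a).reg .eps _) .eps _)).withPos
        _).tapes
      rw [Function.update_idem]
      rfl)
  refine (h₁.trans ((h₂.mono 1 fun a _ => by simp).congr (fun a _ => ?_) fun a _ => ?_))
  · simp [Candidates.eps]
  · simp

end Does

/-! ### Calls of the two given machines. -/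

namespace Does

variable {n d m : ℕ} {M L : QMachine} {A : Type} {pre : A → Prop}
  {μ : A → Memory n d m M.K L.K} {size : A → ℕ} (F : Candidates n d m)

theorem callSub (inp out : A → List ℚ)
    (h : ∀ a, pre a → M.OutputsWithin (inp a) (out a) (size a))
    (hs : ∀ a, pre a → (μ a).sub = M.wordOn M.inTape (inp a)) :
    Does pre (fun a => (μ a).tapes)
      (fun a => ((μ a).withSub (M.wordOn M.outTape (out a))).tapes) size := by
  refine (call M TapeName.sub (fun v => match v with
    | .sub k => some k
    | _ => none) (by rintro (_ | _ | _ | _ | _) k <;> simp [eq_comm]) inp out h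
    fun a ha k => ?_).congr (fun _ _ => rfl) fun a _ => ?_
  · rw [← hs a ha]
    rfl
  · funext v
    rcases v with _ | _ | _ | _ | _ <;> rfl

theorem callLos (inp out : A → List ℚ)
    (h : ∀ a, pre a → L.OutputsWithin (inp a) (out a) (size a))
    (hs : ∀ a, pre a → (μ a).los = L.wordOn L.inTape (inp a)) :
    Does pre (fun a => (μ a).tapes)
      (fun a => ((μ a).withLos (L.wordOn L.outTape (out a))).tapes) size := by
  refine (call L TapeName.los (fun v => match v with
    | .los k => some k
    | _ => none) (by rintro (_ | _ | _ | _ | _) k <;> simp [eq_comm]) inp out h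
    fun a ha k => ?_).congr (fun _ _ => rfl) fun a _ => ?_
  · rw [← hs a ha]
    rfl
  · funext v
    rcases v with _ | _ | _ | _ | _ <;> rfl

end Does

/-- The word that presents a list of rows. -/
def dataWord {d : ℕ} (l : List (DataRow d)) : List ℚ := l.flatMap List.ofFn

open Classical in
/-- The rows in class `j`. -/
noncomputable def rowsOfClass {n d : ℕ} (θ : Fin n → Fin (d + 1) → ℚ) (j : Fin n)
    (l : List (DataRow d)) : List (DataRow d) := l.filter fun r => r.InClass θ j

open Classical in
theorem rowsOfClass_take_succ {n d : ℕ} (θ : Fin n → Fin (d + 1) → ℚ) (j : Fin n)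
    {l : List (DataRow d)} {i : ℕ} (hi : i < l.length) :
    rowsOfClass θ j (l.take (i + 1)) =
      rowsOfClass θ j (l.take i) ++ if l[i].InClass θ j then [l[i]] else [] := by
  rw [rowsOfClass, List.take_succ_eq_append_getElem hi, List.filter_append, List.filter_singleton]
  simp [rowsOfClass]

/-- All tapes are blank. -/
def blankTapes (K : Type) : Tapes K := fun _ => wordTape [] []

theorem wordOn_eq (M : QMachine) (k : M.K) (l : List ℚ) :
    M.wordOn k l = Function.update (blankTapes M.K) k (wordTape [] l) := rfl

theorem wordOn_nil (M : QMachine) (k : M.K) : M.wordOn k [] = blankTapes M.K :=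
  Function.update_eq_self k _

theorem length_dataWord {d : ℕ} (l : List (DataRow d)) :
    (dataWord l).length = l.length * (d + 1) := by
  simp [dataWord, List.length_flatMap]

/-! ### Fitting the submodel of one class. -/

namespace Does

variable {n d m : ℕ} {M L : QMachine} {A : Type} {pre : A → Prop}
  {μ : A → Memory n d m M.K L.K} {size : A → ℕ} (F : Candidates n d m)

/-- One pass appends the rows of the class to the input tape of the regression machine, whose head
then returns to the first letter, as the machine expects. -/
theorem collectClass (j : Fin n) (hpos : ∀ a, pre a → (μ a).pos none = 0)
    (hmar : ∀ a, pre a → ∀ k, (μ a).reg (.margin k) = none)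
    (hsub : ∀ a, pre a → (μ a).sub = blankTapes M.K) :
    Does pre (fun a => (μ a).tapes) (fun a => ((μ a).withSub (M.wordOn M.inTape
      (dataWord (rowsOfClass ((μ a).theta F) j (μ a).rows)))).tapes)
      fun a => (μ a).rows.length := by
  classical
  let w : A → ℕ → List ℚ := fun a i =>
    (dataWord (rowsOfClass ((μ a).theta F) j ((μ a).rows.take i))).reverse
  let u : A → ℕ → Memory n d m M.K L.K := fun a i =>
    (μ a).withSub (Function.update (blankTapes M.K) M.inTape (wordTape (w a i) []))
  have h : Does pre (fun a => (u a 0).tapes) (fun a => (u a (μ a).rows.length).tapes)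
      fun a => (μ a).rows.length * (0 + 1) := by
    refine forRows (pre := pre) (size := fun _ => 0) none (fun a => (μ a).rows.length)
      u (fun _ _ _ _ => rfl) (fun a ha _ _ => hpos a ha) ?_
    have hrow : ∀ a, pre a → ∀ i (hi : i < (μ a).rows.length), ((u a i).withPos
        (Function.update (u a i).pos none i)).row none = (μ a).rows[i] :=
      fun a ha i hi => Memory.row_withPos_self (u a i) none hi
    have hth : ∀ a i, ((u a i).withPos (Function.update (u a i).pos none i)).theta F =
        (μ a).theta F := fun a i => by
      rw [Memory.theta, Memory.pointers_withPos_none]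
      rfl
    refine (ifInClass F j (μ := fun p : A × ℕ => (u p.1 p.2).withPos
      (Function.update (u p.1 p.2).pos none p.2)) (ν := fun p => (u p.1 (p.2 + 1)).withPos
      (Function.update (u p.1 p.2).pos none p.2)) (fun p hp k => hmar _ hp.1 k) ?_).congr
      (fun _ _ => rfl) ?_
    · refine (emit (.sub M.inTape) ((List.finRange (d + 1)).map (.row none)) (by simp)
        (fun p => w p.1 p.2) (fun p hp => by simp [u, Memory.tapes]) _).congr (fun _ _ => rfl) ?_
      rintro ⟨a, i⟩ ⟨⟨ha, hi⟩, hcl⟩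
      simp only [hrow a ha i hi, hth] at hcl
      rw [Memory.update_sub, List.map_map]
      have e : w a (i + 1) = (((List.finRange (d + 1)).map (((u a i).withPos
          (Function.update (u a i).pos none i)).tapes.val ∘ .row none)).reverse) ++ w a i := by
        simp only [w]
        rw [rowsOfClass_take_succ _ _ hi, if_pos hcl, dataWord, List.flatMap_append,
          List.reverse_append]
        congr 2
        rw [List.flatMap_singleton, List.ofFn_eq_map]
        refine List.map_congr_left fun c _ => ?_
        rw [Function.comp_apply, Memory.val_row, hrow a ha i hi]
      rw [← e]
      change _ = (((μ a).withSub (Function.update (Function.update (blankTapes M.K) M.inTape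
        (wordTape (w a i) [])) M.inTape (wordTape (w a (i + 1)) []))).withPos _).tapes
      rw [Function.update_idem]
      rfl
    · rintro ⟨a, i⟩ ⟨ha, hi⟩
      simp only [hrow a ha i hi, hth]
      split_ifs with hcl
      · rfl
      · have e : w a (i + 1) = w a i := by
          simp only [w]
          rw [rowsOfClass_take_succ _ _ hi, if_neg hcl, List.append_nil]
        simp only [u, e]
  have hrew := rewind (pre := pre) (s := fun a => (u a (μ a).rows.length).tapes)
    (fun v => v = .sub M.inTape) (.sub M.inTape) rfl (fun a => (w a (μ a).rows.length).length)
    (fun a _ => w a (μ a).rows.length) (fun _ _ => [])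
    (by
      rintro a _ _ rfl
      simp [u, Memory.tapes]) (fun _ _ _ _ => rfl)
  refine ((h.mono (size' := fun a => (μ a).rows.length) 1 fun a _ => by omega).trans
    (hrew.mono (d + 1) fun a _ => ?_)).congr (fun a ha => ?_) fun a _ => ?_
  · simp only [w, List.length_reverse, length_dataWord, List.take_length]
    have : (rowsOfClass ((μ a).theta F) j (μ a).rows).length ≤ (μ a).rows.length :=
      List.length_filter_le _ _
    nlinarith
  · have : u a 0 = μ a := by
      simp only [u, w, List.take_zero]
      have : Function.update (blankTapes M.K) M.inTape (wordTape [] []) = (μ a).sub := by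
        rw [hsub a ha]
        exact Function.update_eq_self M.inTape _
      change (μ a).withSub (Function.update (blankTapes M.K) M.inTape (wordTape [] [])) = μ a
      rw [this]
      rfl
    rw [this]
  · funext v
    by_cases hv : v = .sub M.inTape
    · subst hv
      simp [w, Memory.tapes, wordOn_eq]
    · rw [if_neg hv]
      rcases v with _ | _ | _ | k | _
      case sub =>
        have hk : k ≠ M.inTape := fun e => hv (by rw [e])
        simp [u, Memory.tapes, wordOn_eq, hk]
      all_goals rfl

open Classical in
/-- Solve the regression problem for the rows in class `j`. -/
theorem solveClass (j : Fin n) {Ok : DataRow d → Prop} {T : ℕ → ℕ} (hT : Monotone T)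
    {sol : List (DataRow d) → Fin (d + 1) → ℚ}
    (hM : ∀ l, l ≠ [] → (∀ r ∈ l, Ok r) →
      M.OutputsWithin (dataWord l) (List.ofFn (sol l)) (T l.length))
    (hok : ∀ a, pre a → ∀ r ∈ (μ a).rows, Ok r)
    (hpos : ∀ a, pre a → (μ a).pos none = 0)
    (hmar : ∀ a, pre a → ∀ k, (μ a).reg (.margin k) = none)
    (hsub : ∀ a, pre a → (μ a).sub = blankTapes M.K) :
    Does pre (fun a => (μ a).tapes) (fun a => ((μ a).withReg fun
      | .w j' c => if j' = j then some (if rowsOfClass ((μ a).theta F) j (μ a).rows = [] then 0 else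
          sol (rowsOfClass ((μ a).theta F) j (μ a).rows) c) else (μ a).reg (.w j' c)
      | r => (μ a).reg r).tapes) fun a => T (μ a).rows.length + (μ a).rows.length := by
  let C : A → List (DataRow d) := fun a => rowsOfClass ((μ a).theta F) j (μ a).rows
  have hC : ∀ a, (C a).length ≤ (μ a).rows.length := fun a => List.length_filter_le _ _
  -- The regression machine is only specified for nonempty data. A row consists of `d + 1 ≥ 1`
  -- letters, so the first cell of the input tape shows whether the class is empty.
  have hne : ∀ a, ((μ a).withSub (M.wordOn M.inTape (dataWord (C a)))).tapes.scan
      (.sub M.inTape) ≠ none ↔ C a ≠ [] := by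
    intro a
    simp only [Tapes.scan, Memory.tapes, Memory.withSub, wordOn_eq, Function.update_self,
      wordTape.head]
    rcases C a with _ | ⟨r, l⟩
    · simp [dataWord]
    · simp [dataWord, List.ofFn_succ]
  refine ((collectClass F j hpos hmar hsub).mono 1 fun a _ => by omega).trans
    (ite (fun σ => σ (.sub M.inTape) ≠ none) ?_ ?_)
  · refine (((callSub (fun a => dataWord (C a)) (fun a => List.ofFn (sol (C a)))
      (size := fun a => T (C a).length) (fun a ha => hM _ ((hne a).1 ha.2) fun r hr =>
        hok a ha.1 r (List.mem_of_mem_filter hr)) fun a _ => rfl).mono 1 fun a _ => ?_).trans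
      (absorb (.sub M.outTape) (k := d + 1) (fun v => match v with
        | .reg (.w j' c) => if j' = j then some c else none
        | _ => none) (fun a => sol (C a)) (fun _ => []) (fun a _ => ?_) _)).congr
      (fun _ _ => rfl) fun a ha => ?_
    · have := hT (hC a)
      omega
    · simp [Memory.tapes, wordOn_eq]
    · have hCa : C a ≠ [] := (hne a).1 ha.2
      funext v
      rcases v with r | _ | _ | k | _
      case sub =>
        by_cases hk : k = M.outTape
        · subst hk
          simp [Memory.tapes, hsub a ha.1, blankTapes]
        · simp [Memory.tapes, hsub a ha.1, wordOn_eq, hk]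
      case reg =>
        rcases r with _ | _ | _ | _ | _ | ⟨j', c⟩ | _ | _
        case w =>
          by_cases hj : j' = j
          · subst hj
            simp only [C] at hCa
            cases hr : (μ a).reg (.w j' c) <;> simp [Memory.tapes, hr, C, hCa]
          · simp [Memory.tapes, hj]
        all_goals rfl
      all_goals rfl
  -- For an empty class any submodel is optimal, and `0` is stored.
  · refine (opReg (fun
      | .w j' c => if j' = j then .const 0 else .keep
      | _ => .keep) _ _ _ (R := fun a => fun
        | .w j' c => if j' = j then some 0 else (μ a).reg (.w j' c)
        | r => (μ a).reg r) ?_).congr (fun _ _ => rfl) fun a ha => ?_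
    · intro a _ r
      cases r
      case w j' c => by_cases hj : j' = j <;> simp [hj, QMachine.writeValue]
      all_goals rfl
    · have hCa : C a = [] := by
        by_contra h
        exact ha.2 ((hne a).2 h)
      have h₁ : (μ a).withSub (M.wordOn M.inTape (dataWord (C a))) = μ a := by
        rw [hCa]
        change (μ a).withSub (M.wordOn M.inTape []) = μ a
        rw [wordOn_nil, ← hsub a ha.1]
        rfl
      simp only [C] at hCa h₁
      rw [h₁]
      simp only [hCa, if_true]

end Does

/-- The sum of the losses of an affine model. -/
def lossSum {d : ℕ} (loss : ℚ → ℚ) (v : Fin (d + 1) → ℚ) (l : List (DataRow d)) : ℚ :=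
  (l.map fun r => loss (r.residual v)).sum

namespace Memory

variable {n d m : ℕ} {KM KL : Type}

/-- Submodel `j` in the registers. -/
def submodel (μ : Memory n d m KM KL) (j : Fin n) : Fin (d + 1) → ℚ :=
  fun c => (μ.reg (.w j c)).getD 0

end Memory

/-! ### Accumulating the losses. -/

namespace Does

variable {n d m : ℕ} {M L : QMachine} {A : Type} {pre : A → Prop}
  {μ : A → Memory n d m M.K L.K} {size : A → ℕ} (F : Candidates n d m)

/-- Add the loss of submodel `j` on the scanned row to the cost. -/
theorem addLoss (j : Fin n) {loss : ℚ → ℚ} {t : ℕ}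
    (hL : ∀ e, L.OutputsWithin [e] [loss e] t)
    (hlos : ∀ a, pre a → (μ a).los = blankTapes L.K) (size : A → ℕ) :
    Does pre (fun a => (μ a).tapes) (fun a => ((μ a).withReg (Function.update (μ a).reg .cost
      (some (((μ a).reg .cost).getD 0 +
        loss (((μ a).row none).residual ((μ a).submodel j)))))).tapes) size := by
  let e : A → ℚ := fun a => ((μ a).row none).residual ((μ a).submodel j)
  have h₁ : Does pre (fun a => (μ a).tapes)
      (fun a => ((μ a).withLos (L.wordOn L.inTape [e a])).tapes) size := by
    refine (assign (f := fun h => DataRow.residual (fun c => h (.reg (.w j c)))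
      fun c => h (.row none c)) (DataRow.isQExpr_residual (fun c => .var _) fun c => .var _)
      (.los L.inTape) pre _ size).congr (fun _ _ => rfl) fun a ha => ?_
    rw [Memory.update_los]
    simp only [Memory.val_reg, Memory.val_row, Memory.tapes, hlos a ha, wordOn_eq]
    rw [blankTapes, wordTape.write_some]
    rfl
  have h₂ : Does pre (fun a => ((μ a).withLos (L.wordOn L.inTape [e a])).tapes)
      (fun a => ((μ a).withLos (L.wordOn L.outTape [loss (e a)])).tapes) size :=
    (callLos (μ := fun a => (μ a).withLos (L.wordOn L.inTape [e a])) (fun a => [e a])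
      (fun a => [loss (e a)]) (size := fun _ => t) (fun a _ => hL _) fun _ _ => rfl).mono t
      fun a _ => by nlinarith
  have h₃ := setReg (f := fun h => h (.reg .cost) + h (.los L.outTape))
    ((IsQExpr.var _).add (.var _)) .cost pre
    (fun a => (μ a).withLos (L.wordOn L.outTape [loss (e a)])) size
  -- After its result has been added, the output cell is erased, so that the loss machine finds
  -- blank tapes at the next call.
  refine ((h₁.trans h₂).trans h₃).trans ((op (fun v => if v = .los L.outTape then .erase else .keep)
    (fun _ => none) pre _ size).congr (fun _ _ => rfl) fun a ha => ?_)
  funext v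
  rcases v with r | _ | _ | _ | k
  case los =>
    by_cases hk : k = L.outTape
    · subst hk
      simp [Memory.tapes, Tapes.act, QMachine.moveHead, QMachine.writeValue, hlos a ha, wordOn_eq,
        blankTapes]
    · have hk' : TapeName.los k ≠ (.los L.outTape : TapeName n d m M.K L.K) := by simpa using hk
      simp [Memory.tapes, Tapes.act, QMachine.moveHead, QMachine.writeValue, hlos a ha, wordOn_eq,
        hk]
  case reg =>
    have : ((μ a).withLos (L.wordOn L.outTape [loss (e a)])).tapes.val (.los L.outTape) =
        loss (e a) := by
      simp [Tapes.val, Memory.tapes, wordOn_eq]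
    simp only [Tapes.act, QMachine.moveHead, reduceCtorEq, if_false, QMachine.writeValue,
      Turing.Tape.write_self, this, Memory.val_reg]
    rfl
  all_goals exact (Turing.Tape.write_self _).symm

/-- Add the losses of submodel `j` on the rows in class `j` to the cost. -/
theorem costClass (j : Fin n) {loss : ℚ → ℚ} {t : ℕ}
    (hL : ∀ e, L.OutputsWithin [e] [loss e] t)
    (hpos : ∀ a, pre a → (μ a).pos none = 0)
    (hmar : ∀ a, pre a → ∀ k, (μ a).reg (.margin k) = none)
    (hlos : ∀ a, pre a → (μ a).los = blankTapes L.K)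
    (hcost : ∀ a, pre a → (μ a).reg .cost ≠ none) :
    Does pre (fun a => (μ a).tapes) (fun a => ((μ a).withReg (Function.update (μ a).reg .cost
      (some (((μ a).reg .cost).getD 0 + lossSum loss ((μ a).submodel j)
        (rowsOfClass ((μ a).theta F) j (μ a).rows))))).tapes) fun a => (μ a).rows.length := by
  classical
  let x : A → ℕ → ℚ := fun a i => ((μ a).reg .cost).getD 0 + lossSum loss ((μ a).submodel j)
        (rowsOfClass ((μ a).theta F) j ((μ a).rows.take i))
  let u : A → ℕ → Memory n d m M.K L.K := fun a i =>
    (μ a).withReg (Function.update (μ a).reg .cost (some (x a i)))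
  have h : Does pre (fun a => (u a 0).tapes) (fun a => (u a (μ a).rows.length).tapes)
      fun a => (μ a).rows.length * (0 + 1) := by
    refine forRows (pre := pre) (size := fun _ => 0) none (fun a => (μ a).rows.length)
      u (fun _ _ _ _ => rfl) (fun a ha _ _ => hpos a ha) ?_
    have hrow : ∀ a, pre a → ∀ i (hi : i < (μ a).rows.length), ((u a i).withPos
        (Function.update (u a i).pos none i)).row none = (μ a).rows[i] :=
      fun a ha i hi => Memory.row_withPos_self (u a i) none hi
    have hth : ∀ a i, ((u a i).withPos (Function.update (u a i).pos none i)).theta F =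
        (μ a).theta F := fun a i => by
      rw [Memory.theta, Memory.pointers_withPos_none]
      rfl
    have hsub : ∀ a i, ((u a i).withPos (Function.update (u a i).pos none i)).submodel j =
        (μ a).submodel j := fun a i => by
      funext c
      simp [u, Memory.submodel]
    refine (ifInClass F j (μ := fun p : A × ℕ => (u p.1 p.2).withPos
      (Function.update (u p.1 p.2).pos none p.2)) (ν := fun p => (u p.1 (p.2 + 1)).withPos
      (Function.update (u p.1 p.2).pos none p.2)) (fun p hp k => by
        simpa [u] using hmar _ hp.1 k) ?_).congr (fun _ _ => rfl) ?_
    · refine (addLoss j hL (μ := fun p : A × ℕ => (u p.1 p.2).withPos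
        (Function.update (u p.1 p.2).pos none p.2)) (fun p hp => hlos _ hp.1.1) _).congr
        (fun _ _ => rfl) ?_
      rintro ⟨a, i⟩ ⟨⟨ha, hi⟩, hcl⟩
      simp only [hrow a ha i hi, hth] at hcl
      simp only [hrow a ha i hi, hsub]
      have e : x a (i + 1) = (((u a i).withPos (Function.update (u a i).pos none i)).reg
          .cost).getD 0 + loss (DataRow.residual ((μ a).submodel j) (μ a).rows[i]) := by
        simp only [u, x, Memory.withPos_reg, Memory.withReg_reg, Function.update_self,
          Option.getD_some]
        rw [rowsOfClass_take_succ _ _ hi, if_pos hcl]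
        simp [lossSum, add_assoc]
      rw [← e]
      change _ = (((μ a).withReg (Function.update (Function.update (μ a).reg .cost _) .cost
        _)).withPos _).tapes
      rw [Function.update_idem]
      rfl
    · rintro ⟨a, i⟩ ⟨ha, hi⟩
      simp only [hrow a ha i hi, hth]
      split_ifs with hcl
      · rfl
      · have e : x a (i + 1) = x a i := by
          simp only [x]
          rw [rowsOfClass_take_succ _ _ hi, if_neg hcl, List.append_nil]
        simp only [u, e]
  refine (h.mono (size' := fun a => (μ a).rows.length) 1 fun a _ => by omega).congr
    (fun a ha => ?_) fun a _ => ?_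
  · have : u a 0 = μ a := by
      -- Before the first row the memory has to be literally unchanged. A blank cost register would
      -- be confused with one containing `0`, which `hcost` excludes.
      have : Function.update (μ a).reg .cost (some (x a 0)) = (μ a).reg := by
        rw [Function.update_eq_self_iff]
        obtain ⟨q, hq⟩ := Option.ne_none_iff_exists'.1 (hcost a ha)
        simp [x, hq, lossSum, rowsOfClass]
      simp only [u, this]
      rfl
    rw [this]
  · simp [u, x]

end Does

open Classical in
/-- The piecewise affine model with classifier `θ` whose submodels solve the regression problems
of the classes. -/
noncomputable def fitModel {n d : ℕ} (loss : ℚ → ℚ) (sol : List (DataRow d) → Fin (d + 1) → ℚ)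
    (θ : Fin n → Fin (d + 1) → ℚ) (l : List (DataRow d)) : Model n d where
  w j := if rowsOfClass θ j l = [] then 0 else sol (rowsOfClass θ j l)
  cost := ∑ j, lossSum loss (if rowsOfClass θ j l = [] then 0 else sol (rowsOfClass θ j l))
    (rowsOfClass θ j l)
  θ := θ

/-- The better of two models. -/
def betterModel {n d : ℕ} (o : Option (Model n d)) (b : Model n d) : Option (Model n d) :=
  match o with
  | none => some b
  | some b' => if b.cost < b'.cost then some b else some b'

/-- The contents of the registers between two tests. -/
def registers {n d : ℕ} (eps cost : Option ℚ) (w : Fin n → Option (Fin (d + 1) → ℚ))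
    (best : Option (Model n d)) : Register n d → Option ℚ
  | .eps => eps
  | .cost => cost
  | .diff => none
  | .best => best.map fun b => b.cost
  | .margin _ => none
  | .w j c => (w j).map fun v => v c
  | .bestW j c => best.map fun b => b.w j c
  | .bestT j c => best.map fun b => b.θ j c

/-! ### Evaluating one candidate and keeping the better model. -/

namespace Does

variable {n d m : ℕ} {A : Type} {pre : A → Prop}

section

variable {KM KL : Type} [DecidableEq KM] [DecidableEq KL]

/-- Store the parameters of the classifier that is under consideration. -/
theorem storeTheta (F : Candidates n d m) (pre : A → Prop) (μ : A → Memory n d m KM KL)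
    (size : A → ℕ) :
    Does pre (fun a => (μ a).tapes) (fun a => ((μ a).withReg fun
      | .bestT j c => some ((μ a).theta F j c)
      | r => (μ a).reg r).tapes) size := by
  refine assignFamily (fun i : Fin n × Fin (d + 1) => TapeName.reg (.bestT i.1 i.2))
    (fun i i' h => by
      obtain ⟨h₁, h₂⟩ : i.1 = i'.1 ∧ i.2 = i'.2 := by simpa using h
      exact Prod.ext h₁ h₂)
    (f := fun i h => F.theta (fun t c => h (.row (some t) c)) (h (.reg .eps)) i.1 i.2)
    (fun i => F.isQExpr_theta (fun t c => .var _) (.var _) i.1 i.2) ?_ ?_ ?_ size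
  · intro a _ S hS k
    have h : ∀ v ∉ Set.range fun i : Fin n × Fin (d + 1) => TapeName.reg (.bestT i.1 i.2),
        S.val v = (μ a).tapes.val v :=
      fun v hv => by rw [Tapes.val, hS v hv, Tapes.val]
    have h₁ := h (.reg .eps) (by simp)
    have h₂ : ∀ s c, S.val (.row s c) = (μ a).tapes.val (.row s c) := fun s c => h _ (by simp)
    simp only [h₁, h₂]
  · rintro a _ ⟨j, c⟩
    simp only [Memory.val_row, Memory.val_reg]
    rw [← Function.update_self (f := (μ a).tapes) (TapeName.reg (.bestT j c))
      (((μ a).tapes (.reg (.bestT j c))).write _), Memory.update_reg]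
    simp [Memory.tapes, Memory.theta]
    rfl
  · intro a _ v hv
    rcases v with r | _ | _ | _ | _
    case reg => cases r <;> first | rfl | exact absurd ⟨(_, _), rfl⟩ hv
    all_goals rfl

/-- Replace the best model by the model in the registers if that is better. -/
theorem compareBest (F : Candidates n d m) (μ : A → Memory n d m KM KL)
    (eps cost : A → ℚ) (w : A → Fin n → Fin (d + 1) → ℚ) (best : A → Option (Model n d))
    (size : A → ℕ) :
    Does pre (fun a => ((μ a).withReg (registers (some (eps a)) (some (cost a))
        (fun j => some (w a j)) (best a))).tapes)
      (fun a => ((μ a).withReg (registers none none (fun _ => none)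
        (betterModel (best a) ⟨cost a, w a, F.theta (μ a).pointers (eps a)⟩))).tapes) size := by
  let R : A → Register n d → Option ℚ := fun a =>
    registers (some (eps a)) (some (cost a)) (fun j => some (w a j)) (best a)
  let R' : A → Register n d → Option ℚ := fun a => Function.update (R a) .diff
    (some (cost a - ((best a).map fun b => b.cost).getD 0))
  have h₁ : Does pre (fun a => ((μ a).withReg (R a)).tapes)
      (fun a => ((μ a).withReg (R' a)).tapes) size := by
    refine (setReg (f := fun h => h (.reg .cost) - h (.reg .best)) ((IsQExpr.var _).sub (.var _))
      .diff pre _ size).congr (fun _ _ => rfl) fun a _ => ?_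
    rw [Memory.val_reg, Memory.val_reg]
    rfl
  -- If there is no best model yet, its cost is blank and the difference is meaningless; the first
  -- disjunct covers this case.
  have hc : ∀ a, (((μ a).withReg (R' a)).tapes.scan (.reg .best) = none ∨
      ((μ a).withReg (R' a)).tapes.scan (.reg .diff) = some (-1)) ↔
      ∀ b, best a = some b → cost a < b.cost := by
    intro a
    rcases hb : best a with _ | b <;>
      simp [Tapes.scan, Memory.tapes, Memory.withReg, R', R, registers, hb, sign_eq_neg_one_iff]
  refine h₁.trans (ite (fun σ => σ (.reg .best) = none ∨ σ (.reg .diff) = some (-1)) ?_ ?_)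
  -- The parameters of the classifier are recomputed from the pointers and the perturbation size,
  -- which must happen before that register is erased.
  · refine (storeTheta F _ _ size).trans ((opReg (R := fun a => registers none none
      (fun _ => none) (betterModel (best a) ⟨cost a, w a, F.theta (μ a).pointers (eps a)⟩)) (fun
      | .best => .copy .cost
      | .bestW j c => .copy (.w j c)
      | .bestT _ _ => .keep
      | _ => .erase) _ _ size ?_).congr (fun _ _ => rfl) fun _ _ => rfl)
    rintro a ⟨_, ha⟩ r
    rw [hc] at ha
    have hb : betterModel (best a) ⟨cost a, w a, F.theta (μ a).pointers (eps a)⟩ =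
        some ⟨cost a, w a, F.theta (μ a).pointers (eps a)⟩ := by
      rcases hb : best a with _ | b
      · rfl
      · exact if_pos (ha b hb)
    rw [hb]
    cases r <;> rfl
  · refine (opReg (R := fun a => registers none none
      (fun _ => none) (betterModel (best a) ⟨cost a, w a, F.theta (μ a).pointers (eps a)⟩)) (fun
      | .best => .keep
      | .bestW _ _ => .keep
      | .bestT _ _ => .keep
      | _ => .erase) _ _ size ?_).congr (fun _ _ => rfl) fun _ _ => rfl
    rintro a ⟨_, ha⟩ r
    rw [hc] at ha
    have hb : betterModel (best a) ⟨cost a, w a, F.theta (μ a).pointers (eps a)⟩ = best a := by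
      rcases hb : best a with _ | b
      · simp [hb] at ha
      · exact if_neg fun h => ha fun b' hb' => by
          obtain rfl : b = b' := by simpa [hb] using hb'
          exact h
    rw [hb]
    cases r <;> rfl

end

/-- Evaluate a candidate classifier. -/
theorem evalCandidate {M L : QMachine} (F : Candidates n d m) {Ok : DataRow d → Prop} {T : ℕ → ℕ}
    (hT : Monotone T) {sol : List (DataRow d) → Fin (d + 1) → ℚ}
    (hM : ∀ l, l ≠ [] → (∀ r ∈ l, Ok r) →
      M.OutputsWithin (dataWord l) (List.ofFn (sol l)) (T l.length))
    {loss : ℚ → ℚ} {t : ℕ} (hL : ∀ e, L.OutputsWithin [e] [loss e] t)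
    (μ : A → Memory n d m M.K L.K) (best : A → Option (Model n d))
    (hok : ∀ a, pre a → ∀ r ∈ (μ a).rows, Ok r)
    (hpos : ∀ a, pre a → (μ a).pos none = 0)
    (hsub : ∀ a, pre a → (μ a).sub = blankTapes M.K)
    (hlos : ∀ a, pre a → (μ a).los = blankTapes L.K) :
    Does pre (fun a => ((μ a).withReg (registers none none (fun _ => none) (best a))).tapes)
      (fun a => ((μ a).withReg (registers none none (fun _ => none) (betterModel (best a)
        (fitModel loss sol (F.theta (μ a).pointers (F.eps (μ a).pointers (μ a).rows))
          (μ a).rows)))).tapes) fun a => T (μ a).rows.length + (μ a).rows.length := by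
  classical
  let ε : A → ℚ := fun a => F.eps (μ a).pointers (μ a).rows
  let θ : A → Fin n → Fin (d + 1) → ℚ := fun a => F.theta (μ a).pointers (ε a)
  let C : A → Fin n → List (DataRow d) := fun a j => rowsOfClass (θ a) j (μ a).rows
  let w : A → Fin n → Fin (d + 1) → ℚ := fun a j => if C a j = [] then 0 else sol (C a j)
  -- The intermediate states `u i` are those in which the classes of index less than `i` have been
  -- fitted and their losses added.
  let x : A → ℕ → ℚ := fun a i =>
    ∑ j : Fin n, if (j : ℕ) < i then lossSum loss (w a j) (C a j) else 0
  let u : ℕ → A → Memory n d m M.K L.K := fun i a => (μ a).withReg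
    (registers (some (ε a)) (some (x a i)) (fun j => if (j : ℕ) < i then some (w a j) else none)
      (best a))
  have h₁ : Does pre (fun a => ((μ a).withReg (registers none none (fun _ => none)
      (best a))).tapes) (fun a => (u 0 a).tapes)
      fun a => T (μ a).rows.length + (μ a).rows.length := by
    refine ((setEps F (pre := pre) (μ := fun a => (μ a).withReg (registers none none (fun _ => none)
      (best a))) hpos).mono 1 fun a _ => ?_).trans
      ((setReg (IsQExpr.const 0) .cost pre _ _).congr (fun _ _ => rfl) fun a _ => ?_)
    · simp only [Memory.withReg_rows]
      omega
    · change ((μ a).withReg _).tapes = ((μ a).withReg (Function.update (Function.update (registers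
        none none (fun _ => none) (best a)) .eps (some (ε a))) .cost (some 0))).tapes
      congr 2
      funext r
      cases r <;> simp [registers, x]
  have hstep : ∀ i < n, Does pre (fun a => (u i a).tapes) (fun a => (u (i + 1) a).tapes)
      fun a => T (μ a).rows.length + (μ a).rows.length := by
    intro i hi
    have hθ : ∀ a, (u i a).theta F = θ a := fun a => rfl
    have hs := solveClass F ⟨i, hi⟩ hT hM (pre := pre) (μ := u i) hok hpos (fun _ _ _ => rfl) hsub
    refine hs.trans ((((costClass F ⟨i, hi⟩ hL (pre := pre) (μ := fun a => (u i a).withReg fun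
      | .w j' c => if j' = ⟨i, hi⟩ then some (w a ⟨i, hi⟩ c) else (u i a).reg (.w j' c)
      | r => (u i a).reg r) hpos (fun _ _ _ => rfl) hlos fun a _ => by
        simp [u, registers]).mono 1 fun a _ => ?_)).congr (fun a _ => ?_) fun a _ => ?_)
    · simp only [u, Memory.withReg_rows]
      omega
    · congr 2
      funext r
      cases r
      case w j c =>
        simp only [w, hθ, C, u, Memory.withReg_rows]
        by_cases hj : j = ⟨i, hi⟩
        · rw [if_pos hj, if_pos hj]
          split_ifs <;> rfl
        · rw [if_neg hj, if_neg hj]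
      all_goals rfl
    · have hxi : x a (i + 1) = x a i + lossSum loss (w a ⟨i, hi⟩) (C a ⟨i, hi⟩) := by
        have hf : ∀ j : Fin n, (if (j : ℕ) < i + 1 then lossSum loss (w a j) (C a j) else 0) =
            (if (j : ℕ) < i then lossSum loss (w a j) (C a j) else 0) +
              if j = ⟨i, hi⟩ then lossSum loss (w a j) (C a j) else 0 := by
          intro j
          by_cases hj : j = ⟨i, hi⟩
          · subst hj
            simp
          · have hj' : (j : ℕ) ≠ i := fun e => hj (Fin.ext e)
            have : (j : ℕ) < i + 1 ↔ (j : ℕ) < i := by omega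
            simp only [this, if_neg hj, add_zero]
        simp only [x, hf, Finset.sum_add_distrib, Finset.sum_ite_eq', Finset.mem_univ, if_true]
      have hw : (((u i a).withReg fun
          | .w j' c => if j' = ⟨i, hi⟩ then some (w a ⟨i, hi⟩ c) else (u i a).reg (.w j' c)
          | r => (u i a).reg r) : Memory n d m M.K L.K).submodel ⟨i, hi⟩ = w a ⟨i, hi⟩ := by
        funext c
        simp [Memory.submodel]
      rw [hw]
      change (u (i + 1) a).tapes = ((μ a).withReg (Function.update _ .cost
        (some (x a i + lossSum loss (w a ⟨i, hi⟩) (C a ⟨i, hi⟩))))).tapes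
      rw [← hxi]
      change ((μ a).withReg _).tapes = _
      congr 2
      funext r
      cases r
      case w j c =>
        by_cases hj : j = ⟨i, hi⟩
        · subst hj
          simp [registers]
        · have hj' : (j : ℕ) ≠ i := fun e => hj (Fin.ext e)
          have : (j : ℕ) < i + 1 ↔ (j : ℕ) < i := by omega
          simp only [registers, this, reduceCtorEq, ne_eq, not_false_eq_true,
            Function.update_of_ne]
          change _ = if j = ⟨i, hi⟩ then some (w a ⟨i, hi⟩ c) else (u i a).reg (.w j c)
          rw [if_neg hj]
          rfl
      all_goals simp [registers, u]
  have h₂ := iterate n (fun i a => (u i a).tapes) hstep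
  refine (h₁.trans h₂).trans ((compareBest F μ ε (fun a => x a n) w best _).congr
    (fun a _ => ?_) fun a _ => ?_)
  · simp only [u, Fin.is_lt, if_true]
  · congr 4
    simp only [fitModel, x, Fin.is_lt, if_true]
    rfl

end Does

/-- The models for the candidate classifiers, the first `k` pointers ranging over all rows. -/
noncomputable def sweepModels {n d m : ℕ} (F : Candidates n d m) (loss : ℚ → ℚ)
    (sol : List (DataRow d) → Fin (d + 1) → ℚ) (l : List (DataRow d)) :
    ℕ → (Fin m → DataRow d) → List (Model n d)
  | 0, z => [fitModel loss sol (F.theta z (F.eps z l)) l]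
  | k + 1, z => l.flatMap fun r => sweepModels F loss sol l k fun t => if t = k then r else z t

theorem fitModel_mem_sweepModels {n d m : ℕ} (F : Candidates n d m) (loss : ℚ → ℚ)
    (sol : List (DataRow d) → Fin (d + 1) → ℚ) (l : List (DataRow d)) (k : ℕ)
    (z z' : Fin m → DataRow d) (h : ∀ t : Fin m, (t : ℕ) < k → z' t ∈ l)
    (h' : ∀ t : Fin m, k ≤ (t : ℕ) → z' t = z t) (hk : k ≤ m) :
    fitModel loss sol (F.theta z' (F.eps z' l)) l ∈ sweepModels F loss sol l k z := by
  induction k generalizing z with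
  | zero =>
    obtain rfl : z' = z := funext fun t => h' t (Nat.zero_le _)
    simp [sweepModels]
  | succ k ih =>
    refine List.mem_flatMap.2 ⟨z' ⟨k, hk⟩, h _ (Nat.lt_succ_self k),
      ih _ (fun t ht => h t (by omega)) (fun t ht => ?_) (by omega)⟩
    split_ifs with e
    · exact congrArg z' (Fin.ext e)
    · exact h' t (by omega)

theorem exists_eq_fitModel {n d m : ℕ} (F : Candidates n d m) (loss : ℚ → ℚ)
    (sol : List (DataRow d) → Fin (d + 1) → ℚ) (l : List (DataRow d)) (k : ℕ)
    (z : Fin m → DataRow d) {b : Model n d} (hb : b ∈ sweepModels F loss sol l k z) :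
    ∃ θ, b = fitModel loss sol θ l := by
  induction k generalizing z with
  | zero => exact ⟨_, by simpa [sweepModels] using hb⟩
  | succ k ih =>
    obtain ⟨r, -, h⟩ := List.mem_flatMap.1 hb
    exact ih _ h

/-! ### Nested loops over all candidates. -/

namespace Does

variable {n d m : ℕ} {M L : QMachine}

/-- The `k` nested loops are built by recursion, pointer `k` running in the outermost of `k + 1`
loops. The inner loops have to work for every position of that pointer, so the induction hypothesis
is applied with parameters in `A × ℕ`; hence the quantification over `A`. -/
theorem sweep (F : Candidates n d m) {Ok : DataRow d → Prop} {T : ℕ → ℕ}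
    (hT : Monotone T) {sol : List (DataRow d) → Fin (d + 1) → ℚ}
    (hM : ∀ l, l ≠ [] → (∀ r ∈ l, Ok r) →
      M.OutputsWithin (dataWord l) (List.ofFn (sol l)) (T l.length))
    {loss : ℚ → ℚ} {t : ℕ} (hL : ∀ e, L.OutputsWithin [e] [loss e] t) (k : ℕ) (hk : k ≤ m) :
    ∀ {A : Type} {pre : A → Prop} (μ : A → Memory n d m M.K L.K) (best : A → Option (Model n d))
      (_ : ∀ a, pre a → ∀ r ∈ (μ a).rows, Ok r)
      (_ : ∀ a, pre a → (μ a).pos none = 0)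
      (_ : ∀ a, pre a → ∀ t : Fin m, (t : ℕ) < k → (μ a).pos (some t) = 0)
      (_ : ∀ a, pre a → (μ a).sub = blankTapes M.K)
      (_ : ∀ a, pre a → (μ a).los = blankTapes L.K),
      Does pre (fun a => ((μ a).withReg (registers none none (fun _ => none) (best a))).tapes)
        (fun a => ((μ a).withReg (registers none none (fun _ => none)
          ((sweepModels F loss sol (μ a).rows k (μ a).pointers).foldl betterModel
            (best a)))).tapes)
        fun a => (T (μ a).rows.length + (μ a).rows.length) * (μ a).rows.length ^ k := by
  induction k with
  | zero =>
    intro A pre μ best hok hpos _ hsub hlos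
    exact (evalCandidate F hT hM hL μ best hok hpos hsub hlos).mono 1 fun a _ => by simp
  | succ k ih =>
    intro A pre μ best hok hpos hpos' hsub hlos
    let s : Option (Fin m) := some ⟨k, hk⟩
    let b : A → ℕ → Option (Model n d) := fun a i => (((μ a).rows.take i).flatMap fun r =>
      sweepModels F loss sol (μ a).rows k fun t =>
        if t = k then r else (μ a).pointers t).foldl betterModel (best a)
    let u : A → ℕ → Memory n d m M.K L.K := fun a i =>
      (μ a).withReg (registers none none (fun _ => none) (b a i))
    have h := forRows (pre := pre) (size := fun a =>
      (T (μ a).rows.length + (μ a).rows.length) * (μ a).rows.length ^ k) s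
      (fun a => (μ a).rows.length) u (fun _ _ _ _ => rfl)
      (fun a ha _ _ => hpos' a ha ⟨k, hk⟩ (Nat.lt_succ_self k)) (by
        refine (ih (by omega) (pre := fun p : A × ℕ => pre p.1 ∧ p.2 < (μ p.1).rows.length)
          (fun p => (μ p.1).withPos (Function.update (μ p.1).pos s p.2)) (fun p => b p.1 p.2)
          (fun p hp => hok _ hp.1) (fun p hp => ?_) (fun p hp t ht => ?_)
          (fun p hp => hsub _ hp.1) fun p hp => hlos _ hp.1).congr (fun _ _ => rfl) ?_
        · simpa [s] using hpos _ hp.1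
        · have : t ≠ ⟨k, hk⟩ := fun e => by simp [e] at ht
          simpa [s, this] using hpos' _ hp.1 t (by omega)
        · rintro ⟨a, i⟩ ⟨ha, hi⟩
          have hz : ((μ a).withPos (Function.update (μ a).pos s i)).pointers =
              fun t : Fin m => if t = k then (μ a).rows[i] else (μ a).pointers t := by
            funext t
            by_cases ht : (t : ℕ) = k
            · obtain rfl : t = ⟨k, hk⟩ := Fin.ext ht
              rw [if_pos rfl]
              exact Memory.row_withPos_self (μ a) _ hi
            · rw [if_neg ht]
              exact Memory.row_withPos_of_ne (μ a) (by simpa [s, Fin.ext_iff] using ht) i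
          have hb : b a (i + 1) = (sweepModels F loss sol (μ a).rows k
              ((μ a).withPos (Function.update (μ a).pos s i)).pointers).foldl betterModel
                (b a i) := by
            simp only [b]
            rw [List.take_succ_eq_append_getElem hi, List.flatMap_append, List.foldl_append,
              List.flatMap_singleton, hz]
          change (((μ a).withReg (registers none none (fun _ => none) (b a (i + 1)))).withPos
            (Function.update (μ a).pos s i)).tapes = _
          rw [hb]
          rfl)
    refine (h.mono 2 fun a _ => ?_).congr (fun a _ => ?_) fun a _ => ?_
    -- The factor `2` covers the overhead of one step per round: for nonempty data the body costs at
    -- least `1`.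
    · rw [pow_succ]
      rcases Nat.eq_zero_or_pos (μ a).rows.length with h0 | h0
      · simp [h0]
      · have h1 : 1 ≤ (μ a).rows.length ^ k := Nat.one_le_pow _ _ h0
        have h2 : 1 ≤ (T (μ a).rows.length + (μ a).rows.length) * (μ a).rows.length ^ k :=
          Nat.mul_pos (by omega) h1
        nlinarith
    · simp [u, b]
    · simp only [u, b, List.take_length]
      rfl

/-- Try the candidates of several families. -/
theorem sweepAll (Fs : List (Candidates n d m)) {Ok : DataRow d → Prop} {T : ℕ → ℕ}
    (hT : Monotone T) {sol : List (DataRow d) → Fin (d + 1) → ℚ}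
    (hM : ∀ l, l ≠ [] → (∀ r ∈ l, Ok r) →
      M.OutputsWithin (dataWord l) (List.ofFn (sol l)) (T l.length))
    {loss : ℚ → ℚ} {t : ℕ} (hL : ∀ e, L.OutputsWithin [e] [loss e] t)
    {A : Type} {pre : A → Prop} (μ : A → Memory n d m M.K L.K) (best : A → Option (Model n d))
    (hok : ∀ a, pre a → ∀ r ∈ (μ a).rows, Ok r)
    (hpos : ∀ a, pre a → (μ a).pos = fun _ => 0)
    (hsub : ∀ a, pre a → (μ a).sub = blankTapes M.K)
    (hlos : ∀ a, pre a → (μ a).los = blankTapes L.K) :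
    Does pre (fun a => ((μ a).withReg (registers none none (fun _ => none) (best a))).tapes)
      (fun a => ((μ a).withReg (registers none none (fun _ => none)
        ((Fs.flatMap fun F => sweepModels F loss sol (μ a).rows m (μ a).pointers).foldl
          betterModel (best a)))).tapes)
      fun a => (T (μ a).rows.length + (μ a).rows.length) * (μ a).rows.length ^ m := by
  induction Fs generalizing best with
  | nil => exact refl _ _ _
  | cons F Fs ih =>
    simp_rw [List.flatMap_cons, List.foldl_append]
    exact (sweep F hT hM hL m le_rfl μ best hok (fun a ha => by rw [hpos a ha])
      (fun a ha _ _ => by rw [hpos a ha]) hsub hlos).trans (ih _)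

end Does

/-- The word that presents a model. -/
def modelWord {n d : ℕ} (b : Model n d) : List ℚ :=
  ((List.finRange n).flatMap fun j => List.ofFn (b.w j)) ++
    (List.finRange n).flatMap fun j => List.ofFn (b.θ j)

/-! ### Reading the input and writing the output. -/

namespace Does

variable {n d m : ℕ} {KM KL A : Type} [DecidableEq KM] [DecidableEq KL] {pre : A → Prop}

/-- Distribute the input word to all copies of the data set. -/
theorem load (R : Register n d → Option ℚ) (U : Tapes KM) (W : Tapes KL)
    (l : A → List (DataRow d)) :
    Does pre (fun a => (⟨[], fun _ => 0, R, U, W, wordTape [] (dataWord (l a))⟩ :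
        Memory n d m KM KL).tapes)
      (fun a => (⟨l a, fun _ => 0, R, U, W, wordTape [] []⟩ : Memory n d m KM KL).tapes)
      fun a => (l a).length := by
  let u : A → ℕ → Memory n d m KM KL := fun a i =>
    ⟨(l a).take i, fun _ => i, R, U, W, wordTape [] (dataWord ((l a).drop i))⟩
  have h : Does pre (fun a => (u a 0).tapes) (fun a => (u a (l a).length).tapes)
      fun a => (l a).length * (0 + 1) := by
    refine loop (size := fun _ => 0) (fun σ => σ .io ≠ none) (fun a => (l a).length)
      (fun a i => (u a i).tapes) ?_ (fun a _ i hi => ?_) fun a _ => ?_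
    · refine ((absorb (pre := fun p : A × ℕ => pre p.1 ∧ p.2 < (l p.1).length) .io (k := d + 1)
        (fun v => match v with
          | .row _ c => some c
          | _ => none) (fun p => ((l p.1)[p.2]?).getD 0)
        (fun p => dataWord ((l p.1).drop (p.2 + 1))) ?_ _).trans
        (op (fun _ => .keep) (fun v => match v with
          | .row _ _ => some .right
          | _ => none) _ _ _)).congr (fun _ _ => rfl) ?_
      · rintro ⟨a, i⟩ ⟨_, hi⟩
        simp only [u, Memory.tapes]
        rw [List.drop_eq_getElem_cons hi, List.getElem?_eq_getElem hi]
        rfl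
      · rintro ⟨a, i⟩ ⟨_, hi⟩
        funext v
        rw [Tapes.act_keep]
        rcases v with _ | ⟨s, c⟩ | _ | _ | _
        case row =>
          simp only [u, Memory.tapes, QMachine.moveHead, List.take_take, min_self,
            List.getElem?_eq_getElem hi, Option.getD_some, Option.elim_some, ne_eq, reduceCtorEq,
            not_false_eq_true, Function.update_of_ne]
          rw [List.drop_eq_nil_of_le (by simp), List.drop_eq_nil_of_le (by simp), List.map_nil,
            wordTape.write_some, List.tail_nil, wordTape.move_right,
            List.take_succ_eq_append_getElem hi, List.map_append, List.reverse_append]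
          rfl
        all_goals rfl
    · simp only [Tapes.scan, u, Memory.tapes, wordTape.head]
      rw [List.drop_eq_getElem_cons hi, dataWord, List.flatMap_cons, List.ofFn_succ]
      simp
    · simp [Tapes.scan, u, Memory.tapes, dataWord]
  have hrew := rewind (pre := pre) (s := fun a => (u a (l a).length).tapes)
    (fun v => ∃ s c, v = .row s c) (.row none 0) ⟨_, _, rfl⟩ (fun a => (l a).length)
    (fun a v => match v with
      | .row _ c => ((l a).map fun r => r c).reverse
      | _ => []) (fun _ _ => [])
    (by
      rintro a _ _ ⟨s, c, rfl⟩
      simp [u, Memory.tapes])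
    (by
      rintro a _ _ ⟨s, c, rfl⟩
      simp)
  refine ((h.mono 1 fun a _ => by simp).trans hrew).congr (fun a _ => ?_) fun a _ => ?_
  · simp [u]
  · funext v
    rcases v with _ | _ | _ | _ | _ <;> simp [u, Memory.tapes, dataWord]

/-- Erase everything except for the best model, which is written on the output tape. -/
theorem unload (U : Tapes KM) (W : Tapes KL) (l : A → List (DataRow d)) (b : A → Model n d) :
    Does pre (fun a => (⟨l a, fun _ => 0, registers none none (fun _ => none) (some (b a)), U, W,
        wordTape [] []⟩ : Memory n d m KM KL).tapes)
      (fun a => (⟨[], fun _ => 0, fun _ => none, U, W, wordTape [] (modelWord (b a))⟩ :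
        Memory n d m KM KL).tapes) fun a => (l a).length := by
  let u : A → ℕ → Memory n d m KM KL := fun a i => ⟨(l a).drop i, fun _ => 0,
    registers none none (fun _ => none) (some (b a)), U, W, wordTape [] []⟩
  have h : Does pre (fun a => (u a 0).tapes) (fun a => (u a (l a).length).tapes)
      fun a => (l a).length * (0 + 1) := by
    refine loop (size := fun _ => 0) (fun σ => σ (.row none 0) ≠ none) (fun a => (l a).length)
      (fun a i => (u a i).tapes) ?_ (fun a _ i hi => ?_) fun a _ => ?_
    · refine (op (fun v => match v with
        | .row _ _ => .erase
        | _ => .keep) (fun v => match v with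
        | .row _ _ => some .right
        | _ => none) _ _ _).congr (fun _ _ => rfl) ?_
      rintro ⟨a, i⟩ ⟨_, hi⟩
      funext v
      rcases v with _ | ⟨s, c⟩ | _ | _ | _
      case row =>
        simp only [u, Memory.tapes, Tapes.act, QMachine.moveHead, QMachine.writeValue,
          List.take_zero, List.drop_zero]
        rw [List.drop_eq_getElem_cons hi, List.map_cons, List.map_nil, List.reverse_nil,
          wordTape.erase_move_right]
      all_goals exact (Turing.Tape.write_self _).symm
    · simp only [Tapes.scan, u, Memory.tapes, wordTape.head]
      rw [List.drop_eq_getElem_cons hi]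
      simp [hi]
    · simp [Tapes.scan, u, Memory.tapes]
  let src : List (TapeName n d m KM KL) :=
    ((List.finRange n).flatMap fun j => (List.finRange (d + 1)).map fun c => .reg (.bestW j c)) ++
    (List.finRange n).flatMap fun j => (List.finRange (d + 1)).map fun c => .reg (.bestT j c)
  have hsrc : ∀ a, src.map (u a (l a).length).tapes.val = modelWord (b a) := by
    intro a
    simp only [src, modelWord, List.map_append, List.map_flatMap, List.map_map,
      List.ofFn_eq_map]
    congr 2
  have hemit := emit (pre := pre) (s := fun a => (u a (l a).length).tapes) .io src
    (by simp [src]) (fun _ => []) (fun _ _ => rfl) (fun a => (l a).length)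
  let s' : A → Tapes (TapeName n d m KM KL) := fun a => (⟨[], fun _ => 0,
    registers none none (fun _ => none) (some (b a)), U, W,
    wordTape (modelWord (b a)).reverse []⟩ : Memory n d m KM KL).tapes
  have h₂ : Does pre (fun a => (u a (l a).length).tapes) s' fun a => (l a).length := by
    refine hemit.congr (fun _ _ => rfl) fun a _ => ?_
    rw [hsrc]
    funext v
    rcases v with _ | _ | _ | _ | _
    case row => simp [s', u, Memory.tapes]
    case io => simp [s', Memory.tapes]
    all_goals rfl
  have hlen : ∀ a, (modelWord (b a)).length = src.length := fun a => by
    rw [← hsrc, List.length_map]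
  have hrew := rewind (pre := pre) (s := s') (fun v => v = .io) .io rfl (fun _ => src.length)
    (fun a _ => (modelWord (b a)).reverse) (fun _ _ => [])
    (by rintro a _ _ rfl; rfl) (by rintro a _ _ rfl; simp [hlen])
  refine (((h.mono 1 fun a _ => by simp).trans h₂).trans
    ((hrew.mono src.length fun a _ => Nat.le_mul_of_pos_right _ (by omega)).trans
    (op (fun v => match v with
      | .reg _ => .erase
      | _ => .keep) (fun _ => none) _ _ _))).congr (fun a _ => ?_) fun a _ => ?_
  · simp [u]
  · funext v
    rcases v with r | _ | _ | _ | _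
    case reg =>
      simp only [Tapes.act, QMachine.moveHead, QMachine.writeValue, reduceCtorEq, if_false, s',
        Memory.tapes]
      cases registers none none (fun _ => none) (some (b a)) r <;> simp
    case io =>
      simp only [Tapes.act, QMachine.moveHead, QMachine.writeValue, Memory.tapes, if_true,
        Turing.Tape.write_self]
      simp
    all_goals
      simp only [Tapes.act, QMachine.moveHead, QMachine.writeValue, reduceCtorEq, if_false,
        Turing.Tape.write_self]
      rfl

end Does

/-! ### Vertices of perturbed polyhedra -/

section vertex

open scoped Matrix

variable {m : ℕ} {R : Type} (A : R → Fin (m + 1) → ℚ)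

/-- The normal vector of a constraint: a row of `A` or a coordinate. -/
def constraintVec (s : R ⊕ Fin (m + 1)) : Fin (m + 1) → ℚ := s.elim A fun c => Pi.single c 1

/-- The right-hand side of a constraint for a perturbation of size `1`. -/
def constraintRhs (s : R ⊕ Fin (m + 1)) : ℚ := s.elim (fun _ => 1) fun _ => 0

/-- Move along a line until another constraint becomes tight. -/
theorem exists_tight_on_line [Finite R] {ε : ℚ} {η v : Fin (m + 1) → ℚ} (hv : v ≠ 0)
    (h : ∀ r, ε ≤ A r ⬝ᵥ η) :
    ∃ (t : ℚ) (s : R ⊕ Fin (m + 1)), (∀ r, ε ≤ A r ⬝ᵥ (η + t • v)) ∧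
      constraintVec A s ⬝ᵥ (η + t • v) = ε * constraintRhs s ∧ constraintVec A s ⬝ᵥ v ≠ 0 := by
  have := Fintype.ofFinite R
  -- Coordinate `j` varies along the line and vanishes somewhere on it. Hence a tight constraint is
  -- found even if the whole line satisfies the inequalities.
  obtain ⟨j, hj⟩ := Function.ne_iff.1 hv
  rw [Pi.zero_apply] at hj
  wlog hs : 0 ≤ -η j / v j generalizing v
  · obtain ⟨t, s, h₁, h₂, h₃⟩ := this (v := -v) (by simpa using hv) (by simpa using hj) (by
      rw [Pi.neg_apply, div_neg]
      linarith)
    refine ⟨-t, s, ?_, ?_, by simpa using h₃⟩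
    · simpa using h₁
    · simpa using h₂
  -- Either all inequalities still hold where coordinate `j` vanishes, or one of them fails there,
  -- and then the ratio test stops at the first inequality to become tight.
  by_cases hall : ∀ r, ε ≤ A r ⬝ᵥ (η + (-η j / v j) • v)
  · refine ⟨_, .inr j, hall, ?_, by simpa [constraintVec] using hj⟩
    simp only [constraintVec, constraintRhs, Sum.elim_inr, single_dotProduct, Pi.add_apply,
      Pi.smul_apply, smul_eq_mul]
    field_simp
    ring
  · push Not at hall
    obtain ⟨r₀, hr₀⟩ := hall
    rw [dotProduct_add, dotProduct_smul, smul_eq_mul] at hr₀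
    have hneg : A r₀ ⬝ᵥ v < 0 := by
      by_contra hn
      have := mul_nonneg hs (not_lt.1 hn)
      linarith [h r₀]
    obtain ⟨r₁, hr₁, hmin⟩ := Finset.exists_min_image (Finset.univ.filter fun r => A r ⬝ᵥ v < 0)
      (fun r => (A r ⬝ᵥ η - ε) / (-(A r ⬝ᵥ v))) ⟨r₀, by simpa using hneg⟩
    simp only [Finset.mem_filter, Finset.mem_univ, true_and] at hr₁ hmin
    have ht : 0 ≤ (A r₁ ⬝ᵥ η - ε) / (-(A r₁ ⬝ᵥ v)) :=
      div_nonneg (by linarith [h r₁]) (by linarith)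
    refine ⟨(A r₁ ⬝ᵥ η - ε) / (-(A r₁ ⬝ᵥ v)), .inl r₁, fun r => ?_, ?_, hr₁.ne⟩
    · rw [dotProduct_add, dotProduct_smul, smul_eq_mul]
      by_cases hr : A r ⬝ᵥ v < 0
      · have := hmin r hr
        rw [le_div_iff₀ (by linarith)] at this
        linarith
      · have := mul_nonneg ht (not_lt.1 hr)
        linarith [h r]
    · simp only [constraintVec, constraintRhs, Sum.elim_inl, dotProduct_add, dotProduct_smul,
        smul_eq_mul]
      have := hr₁.ne
      field_simp
      ring

/-- Induction on the number of tight constraints. As long as there are fewer than `m`, some nonzero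
`v` is orthogonal to their normal vectors and to the unit vector of `c₀`. Moving along `v` keeps
what has been achieved, and the new normal vector is not orthogonal to `v`, hence independent of the
earlier ones. -/
theorem exists_tight_family [Finite R] {ε σ : ℚ} {c₀ : Fin (m + 1)} {η : Fin (m + 1) → ℚ}
    (h : ∀ r, ε ≤ A r ⬝ᵥ η) (h₀ : η c₀ = σ) (k : ℕ) (hk : k ≤ m) :
    ∃ (η' : Fin (m + 1) → ℚ) (f : Fin k → R ⊕ Fin (m + 1)),
      LinearIndependent ℚ (Fin.cons (Pi.single c₀ 1) fun t => constraintVec A (f t) :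
        Fin (k + 1) → Fin (m + 1) → ℚ) ∧
      (∀ r, ε ≤ A r ⬝ᵥ η') ∧ η' c₀ = σ ∧
      ∀ t, constraintVec A (f t) ⬝ᵥ η' = ε * constraintRhs (f t) := by
  induction k with
  | zero =>
    refine ⟨η, Fin.elim0, ?_, h, h₀, fun t => t.elim0⟩
    rw [linearIndependent_finCons]
    refine ⟨linearIndependent_empty_type, ?_⟩
    simp
  | succ k ih =>
    obtain ⟨η', f, hf, h', h₀', ht⟩ := ih (by omega)
    let B : Matrix (Fin (k + 1)) (Fin (m + 1)) ℚ :=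
      Matrix.of (Fin.cons (Pi.single c₀ 1) fun t => constraintVec A (f t))
    obtain ⟨v, hv, hv0⟩ : ∃ v ∈ LinearMap.ker B.mulVecLin, v ≠ 0 :=
      (Submodule.ne_bot_iff _).1 (LinearMap.ker_ne_bot_of_finrank_lt (by simpa using hk))
    rw [LinearMap.mem_ker, Matrix.mulVecLin_apply] at hv
    have hB : ∀ i, B i ⬝ᵥ v = 0 := fun i => congrFun hv i
    have hc : v c₀ = 0 := by
      have : Pi.single c₀ 1 ⬝ᵥ v = 0 := hB 0
      simpa using this
    have hf' : ∀ t, constraintVec A (f t) ⬝ᵥ v = 0 := fun t => hB t.succ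
    obtain ⟨t, s, h₁, h₂, h₃⟩ := exists_tight_on_line A hv0 h'
    refine ⟨η' + t • v, Fin.snoc f s, ?_, h₁, by simp [hc, h₀'], fun i => ?_⟩
    · have e : (Fin.cons (Pi.single c₀ 1) fun t => constraintVec A (Fin.snoc (α := fun _ => _) f s t) :
          Fin (k + 1 + 1) → Fin (m + 1) → ℚ) = Fin.snoc (α := fun _ => Fin (m + 1) → ℚ)
            (Fin.cons (Pi.single c₀ 1) fun t => constraintVec A (f t)) (constraintVec A s) := by
        rw [← Fin.cons_snoc_eq_snoc_cons]
        congr 1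
        funext i
        induction i using Fin.lastCases <;> simp
      rw [e, linearIndependent_finSnoc]
      have hspan : ∀ x ∈ Submodule.span ℚ (Set.range (Fin.cons (Pi.single c₀ 1) fun t =>
          constraintVec A (f t) : Fin (k + 1) → Fin (m + 1) → ℚ)), x ⬝ᵥ v = 0 := by
        intro x hx
        induction hx using Submodule.span_induction with
        | mem x hx =>
          obtain ⟨i, rfl⟩ := hx
          exact hB i
        | zero => simp
        | add x y _ _ hx hy => rw [add_dotProduct, hx, hy, add_zero]
        | smul a x _ hx => rw [smul_dotProduct, hx, smul_zero]
      exact ⟨hf, fun hs => h₃ (hspan _ hs)⟩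
    · induction i using Fin.lastCases with
      | last => simpa using h₂
      | cast i => simp [ht, hf']

/-- The constraints of a vertex as a square matrix. -/
def vertexMatrix (V : Fin m → Fin (m + 1) → ℚ) (c₀ : Fin (m + 1)) :
    Matrix (Fin (m + 1)) (Fin (m + 1)) ℚ :=
  Matrix.of (Fin.cons (Pi.single c₀ 1) V)

/-- The vertex for a tight family is `p + ε q`, where `p` and `q` are the two products with the
inverse matrix and do not involve `ε`. If one family is tight for arbitrarily small `ε`, the
inequalities `ε ≤ A r ⬝ᵥ p + ε * (A r ⬝ᵥ q)` force lexicographic positivity of the pair. Fixing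
coordinate `c₀` to `±1` makes the right-hand side a constant. -/
theorem exists_lexPositive_vertex [Finite R] [Nonempty R] {η₀ : Fin (m + 1) → ℚ}
    (h : ∀ r, 0 < A r ⬝ᵥ η₀) :
    ∃ (c₀ : Fin (m + 1)) (σ : ℚ) (f : Fin m → R ⊕ Fin (m + 1)), (σ = 1 ∨ σ = -1) ∧
      ∀ r, 0 < A r ⬝ᵥ ((vertexMatrix (fun t => constraintVec A (f t)) c₀)⁻¹ *ᵥ Fin.cons σ 0) ∨
        A r ⬝ᵥ ((vertexMatrix (fun t => constraintVec A (f t)) c₀)⁻¹ *ᵥ Fin.cons σ 0) = 0 ∧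
        0 < A r ⬝ᵥ ((vertexMatrix (fun t => constraintVec A (f t)) c₀)⁻¹ *ᵥ
          Fin.cons 0 fun t => constraintRhs (f t)) := by
  have := Fintype.ofFinite R
  obtain ⟨c₀, hc₀⟩ : ∃ c, η₀ c ≠ 0 := by
    by_contra! hn
    have : η₀ = 0 := funext hn
    simpa [this] using h (Classical.arbitrary R)
  have hpos : 0 < |η₀ c₀|⁻¹ := inv_pos.2 (abs_pos.2 hc₀)
  obtain ⟨σ, hσ, hσ'⟩ : ∃ σ : ℚ, (σ = 1 ∨ σ = -1) ∧ |η₀ c₀|⁻¹ * η₀ c₀ = σ := by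
    rcases abs_choice (η₀ c₀) with e | e
    · exact ⟨1, .inl rfl, by rw [e, inv_mul_cancel₀ hc₀]⟩
    · exact ⟨-1, .inr rfl, by rw [e, inv_neg, neg_mul, inv_mul_cancel₀ hc₀]⟩
  obtain ⟨r₁, hr₁⟩ := Finite.exists_min fun r => A r ⬝ᵥ (|η₀ c₀|⁻¹ • η₀)
  set ε₀ := A r₁ ⬝ᵥ (|η₀ c₀|⁻¹ • η₀) with hε₀
  have hε₀pos : 0 < ε₀ := by
    rw [hε₀, dotProduct_smul, smul_eq_mul]
    exact mul_pos hpos (h r₁)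
  -- A sequence tending to `0` and bounded by `ε₀`, so the rescaled `η₀` satisfies all the
  -- inequalities for every `i`.
  let ε : ℕ → ℚ := fun i => ε₀ / (i + 1)
  have hεpos : ∀ i, 0 < ε i := fun i => by positivity
  have hex : ∀ i, ∃ (η : Fin (m + 1) → ℚ) (f : Fin m → R ⊕ Fin (m + 1)),
      LinearIndependent ℚ (Fin.cons (Pi.single c₀ 1) fun t => constraintVec A (f t) :
        Fin (m + 1) → Fin (m + 1) → ℚ) ∧
      (∀ r, ε i ≤ A r ⬝ᵥ η) ∧ η c₀ = σ ∧
      ∀ t, constraintVec A (f t) ⬝ᵥ η = ε i * constraintRhs (f t) := by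
    intro i
    refine exists_tight_family A (η := |η₀ c₀|⁻¹ • η₀) (fun r => le_trans ?_ (hr₁ r)) (by simpa) m
      le_rfl
    exact div_le_self hε₀pos.le (by linarith [(Nat.cast_nonneg i : (0 : ℚ) ≤ i)])
  choose η f hind hle hc ht using hex
  -- There are only finitely many families of constraints, so one of them occurs for infinitely many
  -- `i`.
  obtain ⟨g, hg⟩ := Finite.exists_infinite_fiber f
  rw [Set.infinite_coe_iff] at hg
  refine ⟨c₀, σ, g, hσ, fun r => ?_⟩
  set B := vertexMatrix (fun t => constraintVec A (g t)) c₀ with hB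
  set α := A r ⬝ᵥ (B⁻¹ *ᵥ Fin.cons σ 0)
  set β := A r ⬝ᵥ (B⁻¹ *ᵥ Fin.cons 0 fun t => constraintRhs (g t))
  have key : ∀ i ∈ f ⁻¹' {g}, ε i ≤ α + ε i * β := by
    rintro i rfl
    have hu : IsUnit B := Matrix.linearIndependent_rows_iff_isUnit.1 (hind i)
    have hη : η i = B⁻¹ *ᵥ Fin.cons σ 0 +
        ε i • (B⁻¹ *ᵥ Fin.cons 0 fun t => constraintRhs (f i t)) := by
      have hBη : B *ᵥ η i = Fin.cons σ 0 +
          ε i • (Fin.cons 0 fun t => constraintRhs (f i t) : Fin (m + 1) → ℚ) := by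
        funext j
        induction j using Fin.cases with
        | zero =>
          have : (B *ᵥ η i) 0 = Pi.single c₀ 1 ⬝ᵥ η i := rfl
          simp [this, hc]
        | succ t =>
          have : (B *ᵥ η i) t.succ = constraintVec A (f i t) ⬝ᵥ η i := rfl
          simp [this, ht]
      rw [← Matrix.mulVec_smul, ← Matrix.mulVec_add, ← hBη, Matrix.mulVec_mulVec,
        Matrix.nonsing_inv_mul B ((Matrix.isUnit_iff_isUnit_det B).1 hu), Matrix.one_mulVec]
    have := hle i r
    rwa [hη, dotProduct_add, dotProduct_smul, smul_eq_mul] at this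
  -- A negative `α` contradicts `key` for large `i`, where `ε i * β` is smaller than `-α`; for `α =
  -- 0` division by `ε i` even gives `1 ≤ β`, of which only positivity is kept.
  rcases lt_trichotomy α 0 with hα | hα | hα
  · exfalso
    obtain ⟨N, hN⟩ := exists_nat_gt (ε₀ * β / -α)
    obtain ⟨i, hi, hNi⟩ := hg.exists_gt N
    have h₁ := key i hi
    have h₂ : ε₀ * β < -α * (i + 1) := by
      rw [div_lt_iff₀ (by linarith)] at hN
      have : (N : ℚ) < i := by exact_mod_cast hNi
      nlinarith
    have h₃ : ε i * β < -α := by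
      have hi1 : (0 : ℚ) < i + 1 := by positivity
      rw [show ε i * β = ε₀ * β / (i + 1) by simp only [ε]; ring, div_lt_iff₀ hi1]
      exact h₂
    linarith [hεpos i]
  · right
    obtain ⟨i, hi⟩ := hg.nonempty
    have h₁ := key i hi
    rw [hα, zero_add] at h₁
    exact ⟨hα, (mul_pos_iff_of_pos_left (hεpos i)).1 ((hεpos i).trans_le h₁)⟩
  · exact .inl hα

end vertex

/-! ### An explicit size of the perturbation. -/

namespace DataRow

variable {d n : ℕ}

theorem damp_pos (a b : ℚ) : 0 < damp a b := by
  by_cases ha : a = 0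
  · simp [damp, ha]
  · have : 0 < a ^ 2 := by positivity
    rw [damp, div_self ha]
    have : 0 < a ^ 2 / (a ^ 2 + b ^ 2 + 1) := by positivity
    linarith

theorem damp_le_one (a b : ℚ) : damp a b ≤ 1 := by
  by_cases ha : a = 0
  · simp [damp, ha]
  · rw [damp, div_self ha]
    have : a ^ 2 / (a ^ 2 + b ^ 2 + 1) ≤ 1 := by
      rw [div_le_one (by positivity)]
      nlinarith [sq_nonneg b]
    linarith

/-- For `a > 0` the factor is `a² / (a² + b² + 1)`, and the claim reduces to `a |b| < a² + b² + 1`.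
-/
theorem damp_mul_abs_lt {a : ℚ} (b : ℚ) (ha : 0 < a) : damp a b * |b| < a := by
  rw [damp, div_self ha.ne', one_mul, sub_self, add_zero, div_mul_eq_mul_div,
    div_lt_iff₀ (by positivity)]
  have : |b| ^ 2 = b ^ 2 := sq_abs b
  nlinarith [sq_nonneg (a - |b|), abs_nonneg b, sq_nonneg a, mul_nonneg ha.le (abs_nonneg b)]

theorem scale_pos (p q : Fin n → Fin (d + 1) → ℚ) (r : DataRow d) : 0 < scale p q r :=
  Finset.prod_pos fun _ _ => Finset.prod_pos fun _ _ => damp_pos _ _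

/-- All factors lie in `(0, 1]`, so the product is at most any one of them. This lets one number be
small enough for all pairs of classes at once. -/
theorem scale_le_damp (p q : Fin n → Fin (d + 1) → ℚ) (r : DataRow d) (j k : Fin n) :
    scale p q r ≤ damp (margin p j k r) (margin q j k r) := by
  have h₁ : ∀ j, ∏ k, damp (margin p j k r) (margin q j k r) ≤ 1 := fun j =>
    Finset.prod_le_one (fun _ _ => (damp_pos _ _).le) fun _ _ => damp_le_one _ _
  have h₂ : scale p q r ≤ ∏ k, damp (margin p j k r) (margin q j k r) := by
    rw [scale, ← Finset.mul_prod_erase _ _ (Finset.mem_univ j)]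
    exact mul_le_of_le_one_right (Finset.prod_nonneg fun _ _ => (damp_pos _ _).le)
      (Finset.prod_le_one (fun _ _ => Finset.prod_nonneg fun _ _ => (damp_pos _ _).le)
        fun j _ => h₁ j)
  refine h₂.trans ?_
  rw [← Finset.mul_prod_erase _ _ (Finset.mem_univ k)]
  exact mul_le_of_le_one_right (damp_pos _ _).le
    (Finset.prod_le_one (fun _ _ => (damp_pos _ _).le) fun _ _ => damp_le_one _ _)

theorem scale_le_one (p q : Fin n → Fin (d + 1) → ℚ) (r : DataRow d) : scale p q r ≤ 1 :=
  Finset.prod_le_one (fun _ _ => Finset.prod_nonneg fun _ _ => (damp_pos _ _).le) fun _ _ =>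
    Finset.prod_le_one (fun _ _ => (damp_pos _ _).le) fun _ _ => damp_le_one _ _

end DataRow

namespace Candidates

variable {n d m : ℕ} (F : Candidates n d m) (z : Fin m → DataRow d)

theorem eps_pos (l : List (DataRow d)) : 0 < F.eps z l := by
  induction l with
  | nil => simp [eps]
  | cons r l ih =>
    rw [eps, List.map_cons, List.prod_cons]
    exact mul_pos (DataRow.scale_pos _ _ _) ih

theorem eps_le_one (l : List (DataRow d)) : F.eps z l ≤ 1 := by
  induction l with
  | nil => simp [eps]
  | cons r l ih =>
    rw [eps, List.map_cons, List.prod_cons]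
    exact mul_le_one₀ (DataRow.scale_le_one _ _ _) (F.eps_pos z l).le ih

theorem eps_le_scale {l : List (DataRow d)} {r : DataRow d} (hr : r ∈ l) :
    F.eps z l ≤ DataRow.scale (F.p z) (F.q z) r := by
  induction l with
  | nil => simp at hr
  | cons r' l ih =>
    rw [eps, List.map_cons, List.prod_cons]
    rcases List.mem_cons.1 hr with rfl | hr
    · exact mul_le_of_le_one_right (DataRow.scale_pos _ _ _).le (F.eps_le_one z l)
    · exact (mul_le_of_le_one_left (F.eps_pos z l).le (DataRow.scale_le_one _ _ _)).trans (ih hr)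

theorem margin_theta (ε : ℚ) (j k : Fin n) (r : DataRow d) :
    DataRow.margin (F.theta z ε) j k r =
      DataRow.margin (F.p z) j k r + ε * DataRow.margin (F.q z) j k r := by
  have h : ∀ j, F.theta z ε j = F.p z j + ε • F.q z j := fun j => rfl
  simp only [DataRow.margin, h, add_dotProduct, smul_dotProduct, smul_eq_mul]
  ring

/-- A perturbation of size `eps` decides ties and changes nothing else. -/
theorem margin_theta_pos {l : List (DataRow d)} {r : DataRow d} (hr : r ∈ l) {j k : Fin n}
    (h : 0 < DataRow.margin (F.p z) j k r ∨ DataRow.margin (F.p z) j k r = 0 ∧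
      0 < DataRow.margin (F.q z) j k r) :
    0 < DataRow.margin (F.theta z (F.eps z l)) j k r := by
  rw [margin_theta]
  have hε := F.eps_pos z l
  rcases h with h | ⟨h, h'⟩
  · have h₁ := (F.eps_le_scale z hr).trans (DataRow.scale_le_damp (F.p z) (F.q z) r j k)
    have h₂ := DataRow.damp_mul_abs_lt (DataRow.margin (F.q z) j k r) h
    have h₃ := mul_le_mul_of_nonneg_right h₁ (abs_nonneg (DataRow.margin (F.q z) j k r))
    have h₄ := mul_le_mul_of_nonneg_left (neg_abs_le (DataRow.margin (F.q z) j k r)) hε.le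
    linarith
  · rw [h, zero_add]
    exact mul_pos hε h'

end Candidates

theorem PWA.exists_isFirstArgmax {n : ℕ} [NeZero n] (u : Fin n → ℚ) :
    ∃ j, PWA.IsFirstArgmax u j := by
  obtain ⟨j₀, hj₀⟩ := Finite.exists_max u
  obtain ⟨j, hj, hmin⟩ := Finset.exists_min_image (Finset.univ.filter fun j => u j = u j₀) id
    ⟨j₀, by simp⟩
  simp only [Finset.mem_filter, Finset.mem_univ, true_and, id] at hj hmin
  refine ⟨j, fun k => (hj₀ k).trans hj.ge, fun k hk => ?_⟩
  refine lt_of_le_of_ne ((hj₀ k).trans hj.ge) fun e => ?_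
  exact absurd (hmin k (e.trans hj)) (not_le.2 hk)

theorem PWA.IsFirstArgmax.unique {n : ℕ} {u : Fin n → ℚ} {j j' : Fin n}
    (h : PWA.IsFirstArgmax u j) (h' : PWA.IsFirstArgmax u j') : j = j' := by
  rcases lt_trichotomy j j' with e | e | e
  · exact absurd (h'.2 j e) (not_lt.2 (h.1 j'))
  · exact e
  · exact absurd (h.2 j' e) (not_lt.2 (h'.1 j))

/-! ### Finitely many families of candidates suffice -/

section families

open scoped Matrix

variable {n d m : ℕ} (hm : n * (d + 1) = m + 1)

/-- The coordinates of the parameters of the classes other than class `0`. -/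
def paramEquiv : Fin n × Fin (d + 1) ≃ Fin (m + 1) := finProdFinEquiv.trans (finCongr hm)

/-- The classifier whose parameters for class `0` vanish. -/
def classifierOf (η : Fin (m + 1) → ℚ) : Fin (n + 1) → Fin (d + 1) → ℚ :=
  Fin.cons 0 fun j c => η (paramEquiv hm (j, c))

/-- The margin of class `j` over class `k` as a linear functional. -/
def marginVec (r : DataRow d) (jk : Fin (n + 1) × Fin (n + 1)) : Fin (m + 1) → ℚ := fun i =>
  ((if jk.1 = ((paramEquiv hm).symm i).1.succ then 1 else 0) -
    if jk.2 = ((paramEquiv hm).symm i).1.succ then 1 else 0) * r.ext ((paramEquiv hm).symm i).2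

theorem classifierOf_dotProduct (η : Fin (m + 1) → ℚ) (j : Fin (n + 1)) (v : Fin (d + 1) → ℚ) :
    classifierOf hm η j ⬝ᵥ v = ∑ i, ((if j = ((paramEquiv hm).symm i).1.succ then 1 else 0) *
      v ((paramEquiv hm).symm i).2) * η i := by
  rw [← (paramEquiv hm).sum_comp, Fintype.sum_prod_type]
  simp only [Equiv.symm_apply_apply]
  induction j using Fin.cases with
  | zero => simp [classifierOf, (Fin.succ_ne_zero _).symm]
  | succ j =>
    rw [Finset.sum_eq_single j]
    · simp [classifierOf, dotProduct, mul_comm]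
    · intro k _ hk
      simp [hk.symm]
    · simp

theorem marginVec_dotProduct (η : Fin (m + 1) → ℚ) (r : DataRow d)
    (jk : Fin (n + 1) × Fin (n + 1)) :
    marginVec hm r jk ⬝ᵥ η = DataRow.margin (classifierOf hm η) jk.1 jk.2 r := by
  rw [DataRow.margin, classifierOf_dotProduct, classifierOf_dotProduct, ← Finset.sum_sub_distrib]
  refine Finset.sum_congr rfl fun i _ => ?_
  rw [marginVec]
  ring

theorem isQExpr_classifierOf {V : Type} {η : (V → ℚ) → Fin (m + 1) → ℚ}
    (hη : ∀ i, IsQExpr fun h => η h i) (k : Fin (n + 1)) (c : Fin (d + 1)) :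
    IsQExpr fun h => classifierOf hm (η h) k c := by
  induction k using Fin.cases with
  | zero => exact .const 0
  | succ k => exact hη _

/-- The entries of the matrix are constants or constant multiples of entries of extended rows, and
the inverse is an expression in them. -/
theorem isQExpr_vertex {V : Type} {z : (V → ℚ) → Fin m → DataRow d}
    (hz : ∀ t c, IsQExpr fun h => z h t c) (c₀ : Fin (m + 1))
    (f : Fin m → (Fin (n + 1) × Fin (n + 1)) ⊕ Fin (m + 1)) (u : Fin (m + 1) → ℚ)
    (i : Fin (m + 1)) : IsQExpr fun h =>
      ((vertexMatrix (fun t => constraintVec (marginVec hm (z h t)) (f t)) c₀)⁻¹ *ᵥ u) i := by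
  refine IsQExpr.dotProduct (fun j => IsQExpr.inv (fun i j => ?_) i j) fun _ => .const _
  induction i using Fin.cases with
  | zero => exact .const _
  | succ t =>
    rcases ht : f t with jk | c
    · simpa [vertexMatrix, constraintVec, ht, marginVec] using
        (IsQExpr.const _).mul (DataRow.isQExpr_ext (hz t) _)
    · simpa [vertexMatrix, constraintVec, ht] using IsQExpr.const _

/-- The candidates that satisfy given constraints with equality. -/
noncomputable def vertexCandidates (c₀ : Fin (m + 1)) (σ : ℚ)
    (f : Fin m → (Fin (n + 1) × Fin (n + 1)) ⊕ Fin (m + 1)) : Candidates (n + 1) d m where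
  p z := classifierOf hm ((vertexMatrix (fun t => constraintVec (marginVec hm (z t)) (f t)) c₀)⁻¹ *ᵥ
    Fin.cons σ 0)
  q z := classifierOf hm ((vertexMatrix (fun t => constraintVec (marginVec hm (z t)) (f t)) c₀)⁻¹ *ᵥ
    Fin.cons 0 fun t => constraintRhs (f t))
  isQExpr_p k c := isQExpr_classifierOf hm (isQExpr_vertex hm (fun _ _ => .var _) c₀ f _) k c
  isQExpr_q k c := isQExpr_classifierOf hm (isQExpr_vertex hm (fun _ _ => .var _) c₀ f _) k c

/-- The classifier `θ`, ties being broken in favour of the smallest index. -/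
def tieBreak (θ : Fin n → Fin (d + 1) → ℚ) : Candidates n d 0 where
  p _ := θ
  q _ k := Fin.snoc 0 (-(k : ℚ))
  isQExpr_p _ _ := .const _
  isQExpr_q _ _ := .const _

/-- The perturbation lowers the intercept of class `k` by a multiple of `k`. In a tie the smallest
index wins strictly, and strict inequalities survive because the multiple is small. -/
theorem exists_strict_classifier (θ : Fin n → Fin (d + 1) → ℚ) (l : List (DataRow d)) :
    ∃ θ' : Fin n → Fin (d + 1) → ℚ, ∀ r ∈ l, ∀ j, r.InClass θ j → ∀ k ≠ j,
      0 < DataRow.margin θ' j k r := by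
  refine ⟨(tieBreak θ).theta (fun t => t.elim0) ((tieBreak θ).eps (fun t => t.elim0) l),
    fun r hr j hj k hk => Candidates.margin_theta_pos _ _ hr ?_⟩
  rw [DataRow.inClass_iff] at hj
  rcases (hj.1 k).lt_or_eq with h | h
  · exact .inl h
  · refine .inr ⟨h.symm, ?_⟩
    have hjk : j < k := by
      rcases lt_trichotomy j k with e | e | e
      · exact e
      · exact absurd e.symm hk
      · exact absurd (hj.2 k e) (by rw [← h]; exact lt_irrefl _)
    have : (j : ℚ) < k := by exact_mod_cast hjk
    simpa [DataRow.margin, tieBreak, dotProduct, Fin.sum_univ_castSucc, DataRow.ext, PWA.extend]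

-- A family is given by the coordinate `c₀`, the sign `σ`, and, for each of the `m` tight
-- constraints, either a pair of classes or a coordinate. These data do not refer to the rows, so
-- finitely many families serve all data sets; the rows enter only through the `m` pointers.
include hm in
theorem exists_candidates (hn : 1 ≤ n) :
    ∃ Fs : List (Candidates (n + 1) d m), ∀ l : List (DataRow d), l ≠ [] →
      ∀ θ : Fin (n + 1) → Fin (d + 1) → ℚ, ∃ F ∈ Fs, ∃ z : Fin m → DataRow d, (∀ t, z t ∈ l) ∧
        ∀ r ∈ l, ∀ j, r.InClass θ j → r.InClass (F.theta z (F.eps z l)) j := by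
  classical
  refine ⟨(Finset.univ : Finset (Fin (m + 1) × Bool ×
    (Fin m → (Fin (n + 1) × Fin (n + 1)) ⊕ Fin (m + 1)))).toList.map fun s =>
      vertexCandidates hm s.1 (if s.2.1 then 1 else -1) s.2.2, fun l hl θ => ?_⟩
  obtain ⟨θ', hθ'⟩ := exists_strict_classifier θ l
  -- One strict inequality for each row, its class `j` under `θ`, and each competitor `k ≠ j`.
  let R : Type := {p : Fin l.length × Fin (n + 1) × Fin (n + 1) //
    DataRow.InClass θ p.2.1 l[p.1] ∧ p.2.2 ≠ p.2.1}
  let A : R → Fin (m + 1) → ℚ := fun p => marginVec hm l[p.1.1] p.1.2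
  have hlen : 0 < l.length := List.length_pos_iff.2 hl
  have : Nonempty R := by
    obtain ⟨j, hj⟩ := PWA.exists_isFirstArgmax fun k => θ k ⬝ᵥ l[0].ext
    have : Nontrivial (Fin (n + 1)) := Fin.nontrivial_iff_two_le.2 (by omega)
    obtain ⟨k, hk⟩ := exists_ne j
    exact ⟨⟨(⟨0, hlen⟩, j, k), hj, hk⟩⟩
  -- Normalization: the parameters of class `0` are subtracted, which leaves the margins unchanged.
  let η₀ : Fin (m + 1) → ℚ := fun i =>
    θ' ((paramEquiv hm).symm i).1.succ ((paramEquiv hm).symm i).2 -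
      θ' 0 ((paramEquiv hm).symm i).2
  have hη₀ : ∀ j, classifierOf hm η₀ j = θ' j - θ' 0 := by
    intro j
    funext c
    induction j using Fin.cases <;> simp [classifierOf, η₀]
  obtain ⟨c₀, σ, f, hσ, hf⟩ := exists_lexPositive_vertex A (η₀ := η₀) (by
    rintro ⟨⟨i, j, k⟩, hj, hk⟩
    have := hθ' _ (List.getElem_mem i.2) j hj k hk
    simp only [A, marginVec_dotProduct, DataRow.margin, hη₀, sub_dotProduct]
    simp only [DataRow.margin] at this
    linarith!)
  -- A coordinate constraint involves no row, so its pointer may be on any row, here the first.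
  let z : Fin m → DataRow d := fun t => (f t).elim (fun p => l[p.1.1]) fun _ => l[0]
  let g : Fin m → (Fin (n + 1) × Fin (n + 1)) ⊕ Fin (m + 1) := fun t =>
    (f t).map (fun p => p.1.2) id
  have hvec : (fun t => constraintVec (marginVec hm (z t)) (g t)) =
      fun t => constraintVec A (f t) := by
    funext t
    rcases ht : f t with p | c <;> simp [g, z, ht, constraintVec, A]
  have hrhs : (fun t => constraintRhs (g t)) = fun t => constraintRhs (f t) := by
    funext t
    rcases ht : f t with p | c <;> simp [g, ht, constraintRhs]
  refine ⟨vertexCandidates hm c₀ σ g, ?_, z, fun t => ?_, fun r hr j hj => ?_⟩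
  · rcases hσ with rfl | rfl
    · exact List.mem_map.2 ⟨(c₀, true, g), by simp, by simp⟩
    · exact List.mem_map.2 ⟨(c₀, false, g), by simp, by simp⟩
  · simp only [z]
    rcases f t with p | c <;> exact List.getElem_mem _
  · obtain ⟨i, hi, rfl⟩ := List.getElem_of_mem hr
    have key : ∀ k ≠ j, 0 < DataRow.margin ((vertexCandidates hm c₀ σ g).theta z
        ((vertexCandidates hm c₀ σ g).eps z l)) j k l[i] := by
      intro k hk
      refine Candidates.margin_theta_pos _ _ hr ?_
      have := hf ⟨(⟨i, hi⟩, j, k), hj, hk⟩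
      have hA : ∀ η, A ⟨(⟨i, hi⟩, j, k), hj, hk⟩ ⬝ᵥ η =
          DataRow.margin (classifierOf hm η) j k l[i] := fun η => marginVec_dotProduct hm η _ _
      rw [hA, hA] at this
      simpa only [vertexCandidates, hvec, hrhs] using this
    rw [DataRow.inClass_iff]
    refine ⟨fun k => ?_, fun k hk => key k hk.ne⟩
    by_cases hk : k = j
    · subst hk
      simp [DataRow.margin]
    · exact (key k hk).le

end families

/-! ### A machine cannot be faster than its input is long -/

/-- The nonblank cells of a tape. -/
def Turing.Tape.cells (t : Turing.Tape (Option ℚ)) : Set ℤ := {i | t.nth i ≠ none}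

/-- Only the scanned cell is overwritten. Positions are counted from the head, so a move merely
translates the set of nonblank cells. -/
theorem Turing.Tape.encard_cells_le (t : Turing.Tape (Option ℚ)) (a : Option ℚ)
    (mv : Option Turing.Dir) :
    t.cells.encard ≤ (QMachine.moveHead mv (t.write a)).cells.encard + 1 := by
  have h₁ : t.cells ⊆ insert 0 (t.write a).cells := by
    intro i hi
    by_cases h : i = 0
    · exact .inl h
    · refine .inr ?_
      simpa [cells, Turing.Tape.write_nth, h] using hi
  have h₂ : (t.write a).cells.encard ≤ (QMachine.moveHead mv (t.write a)).cells.encard := by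
    rcases mv with _ | _ | _
    · exact le_rfl
    · refine (Set.encard_le_encard fun i hi => ?_).trans (Set.encard_image_le (· - 1) _)
      exact ⟨i + 1, by simpa [cells, QMachine.moveHead] using hi, by simp⟩
    · refine (Set.encard_le_encard fun i hi => ?_).trans (Set.encard_image_le (· + 1) _)
      exact ⟨i - 1, by simpa [cells, QMachine.moveHead] using hi, by simp⟩
  calc t.cells.encard ≤ (insert 0 (t.write a).cells).encard := Set.encard_le_encard h₁
    _ ≤ (t.write a).cells.encard + 1 := Set.encard_insert_le _ _
    _ ≤ _ := by gcongr

theorem wordTape.encard_cells (l : List ℚ) : (wordTape [] l).cells.encard = l.length := by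
  have : (wordTape [] l).cells = ((Finset.range l.length).map Nat.castEmbedding : Finset ℤ) := by
    ext i
    rcases i with i | i
    · have : (wordTape [] l).nth (Int.ofNat i) = (l.map some).getI i := Turing.Tape.mk'_nth_nat _ _ i
      simp only [Turing.Tape.cells, Set.mem_ofPred_eq, this]
      by_cases hi : i < l.length
      · simp [List.getI_eq_getElem, hi]
      · simp only [List.getI_eq_default (l.map some) (by simpa using hi)]
        exact iff_of_false (fun h => h rfl) (by simpa using hi)
    · have : (wordTape [] l).nth (Int.negSucc i) = none := by
        change (Turing.ListBlank.mk _).nth i = none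
        simp only [Turing.ListBlank.nth_mk]
        rfl
      simp [Turing.Tape.cells, this]
  rw [this, Set.encard_coe_eq_coe_finsetCard, Finset.card_map, Finset.card_range]

theorem QProg.Reaches.encard_cells_le {K : Type} {P : QProg K} {m : ℕ} {q q' : P.State}
    {S S' : Tapes K} (h : P.Reaches m q S q' S') (k : K) :
    (S k).cells.encard ≤ (S' k).cells.encard + m := by
  induction h with
  | refl => simp
  | @head m q q₁ q₂ S S₂ w mv _ _ ih =>
    refine ((S k).encard_cells_le _ (mv k)).trans ((add_le_add_left ih 1).trans ?_)
    rw [Nat.cast_add, Nat.cast_one, add_assoc]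

/-- At the end at most `out.length` cells of the input tape may be nonblank. The remaining letters
of the input have to be erased, at most one in each step. -/
theorem QMachine.OutputsWithin.length_le {M : QMachine} {inp out : List ℚ} {t : ℕ}
    (h : M.OutputsWithin inp out t) : inp.length ≤ out.length + t := by
  obtain ⟨m, hm, q, hr, -⟩ := QProg.runs_ofMachine h
  have h₁ := hr.encard_cells_le M.inTape
  have h₂ : (M.wordOn M.inTape inp M.inTape).cells.encard = inp.length := by
    rw [wordOn_eq, Function.update_self, wordTape.encard_cells]
  have h₃ : (M.wordOn M.outTape out M.inTape).cells.encard ≤ out.length := by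
    rw [wordOn_eq]
    by_cases e : M.inTape = M.outTape
    · rw [e, Function.update_self, wordTape.encard_cells]
    · rw [Function.update_of_ne e, blankTapes, wordTape.encard_cells]
      simp
  have h₄ : (inp.length : ℕ∞) ≤ out.length + m := by
    rw [← h₂]
    exact h₁.trans (by gcongr)
  have : inp.length ≤ out.length + m := by exact_mod_cast h₄
  omega

/-! ### The value of the best model -/

theorem foldl_betterModel {n d : ℕ} (L : List (Model n d)) (o : Option (Model n d))
    (h : L ≠ [] ∨ o ≠ none) : ∃ b, L.foldl betterModel o = some b ∧ (b ∈ L ∨ o = some b) ∧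
      (∀ c ∈ L, b.cost ≤ c.cost) ∧ ∀ c, o = some c → b.cost ≤ c.cost := by
  induction L generalizing o with
  | nil =>
    obtain ⟨b, hb⟩ := Option.ne_none_iff_exists'.1 (h.resolve_left (by simp))
    exact ⟨b, hb, .inr hb, by simp, fun c hc => by
      obtain rfl : b = c := by simpa [hb] using hc
      exact le_rfl⟩
  | cons a L ih =>
    have hb : ∃ c, betterModel o a = some c ∧ (c = a ∨ o = some c) ∧ c.cost ≤ a.cost ∧
        ∀ c', o = some c' → c.cost ≤ c'.cost := by
      rcases o with _ | o
      · exact ⟨a, rfl, .inl rfl, le_rfl, by simp⟩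
      · by_cases hlt : a.cost < o.cost
        · exact ⟨a, if_pos hlt, .inl rfl, le_rfl, by simpa using hlt.le⟩
        · exact ⟨o, if_neg hlt, .inr rfl, not_lt.1 hlt, by simp⟩
    obtain ⟨c, hc, hc₁, hc₂, hc₃⟩ := hb
    obtain ⟨b, hb, hb₁, hb₂, hb₃⟩ := ih (betterModel o a) (.inr (by simp [hc]))
    have hbc := hb₃ c hc
    refine ⟨b, hb, ?_, ?_, fun c' hc' => hbc.trans (hc₃ c' hc')⟩
    · rcases hb₁ with hb₁ | hb₁
      · exact .inl (List.mem_cons_of_mem _ hb₁)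
      · obtain rfl : c = b := by simpa [hc] using hb₁
        rcases hc₁ with rfl | hc₁
        · exact .inl List.mem_cons_self
        · exact .inr hc₁
    · intro c' hc'
      rcases List.mem_cons.1 hc' with rfl | hc'
      · exact hbc.trans hc₂
      · exact hb₂ c' hc'

/-- Ties are broken, so every row lies in exactly one class; sorting the rows by class only
rearranges the sum. -/
theorem lossSum_rowsOfClass {n d N : ℕ} (loss : ℚ → ℚ) (θ : Fin n → Fin (d + 1) → ℚ)
    (w : Fin n → Fin (d + 1) → ℚ) (r : Fin N → DataRow d) (g : Fin N → Fin n)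
    (hg : ∀ i, (r i).InClass θ (g i)) :
    ∑ j, lossSum loss (w j) (rowsOfClass θ j (List.ofFn r)) =
      ∑ i, ∑ j, if g i = j then loss ((r i).residual (w j)) else 0 := by
  classical
  rw [Finset.sum_comm]
  refine Finset.sum_congr rfl fun j _ => ?_
  have key : ∀ l : List (DataRow d), lossSum loss (w j) (rowsOfClass θ j l) =
      (l.map fun r => if r.InClass θ j then loss (r.residual (w j)) else 0).sum := by
    intro l
    induction l with
    | nil => rfl
    | cons r l ih =>
      rw [List.map_cons, List.sum_cons, ← ih, lossSum, lossSum, rowsOfClass, rowsOfClass,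
        List.filter_cons]
      by_cases h : r.InClass θ j <;> simp [h]
  rw [key, List.map_ofFn, List.sum_ofFn]
  refine Finset.sum_congr rfl fun i _ => ?_
  have : (r i).InClass θ j ↔ g i = j := ⟨fun h => (hg i).unique h, fun h => h ▸ hg i⟩
  simp [this]

theorem fitModel_cost_le {n d : ℕ} (loss : ℚ → ℚ) {sol : List (DataRow d) → Fin (d + 1) → ℚ}
    (θ : Fin n → Fin (d + 1) → ℚ) (l : List (DataRow d))
    (hsol : ∀ j, rowsOfClass θ j l ≠ [] → ∀ v, lossSum loss (sol (rowsOfClass θ j l))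
      (rowsOfClass θ j l) ≤ lossSum loss v (rowsOfClass θ j l)) (w : Fin n → Fin (d + 1) → ℚ) :
    (fitModel loss sol θ l).cost ≤ ∑ j, lossSum loss (w j) (rowsOfClass θ j l) := by
  classical
  refine Finset.sum_le_sum (f := fun j => lossSum loss (if rowsOfClass θ j l = [] then 0 else
    sol (rowsOfClass θ j l)) (rowsOfClass θ j l)) fun j _ => ?_
  split_ifs with h
  · simp [h, lossSum]
  · exact hsol j h _

/-! ### Words -/

theorem ofFn_init_append_last {d : ℕ} (r : Fin (d + 1) → ℚ) :
    List.ofFn (Fin.init r) ++ [r (Fin.last d)] = List.ofFn r := by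
  rw [List.ofFn_succ', List.concat_eq_append]
  rfl

theorem encodeData_eq {d N : ℕ} (r : Fin N → DataRow d) :
    PWA.encodeData (fun i => Fin.init (r i)) (fun i => r i (Fin.last d)) =
      dataWord (List.ofFn r) := by
  simp only [PWA.encodeData, ofFn_init_append_last, dataWord]
  rw [List.flatMap_def, List.map_ofFn]
  rfl

theorem encodeModel_eq {n d : ℕ} (b : Model n d) :
    PWA.encodeModel b.w (fun k => Fin.init (b.θ k)) (fun k => b.θ k (Fin.last d)) =
      modelWord b := by
  simp_rw [PWA.encodeModel, ofFn_init_append_last, modelWord, List.flatMap_def,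
    List.ofFn_eq_map (n := n)]

theorem dotProduct_extend {d : ℕ} (v : Fin (d + 1) → ℚ) (x : Fin d → ℚ) :
    v ⬝ᵥ PWA.extend x = Fin.init v ⬝ᵥ x + v (Fin.last d) := by
  simp [dotProduct, Fin.sum_univ_castSucc, PWA.extend, Fin.init]

theorem DataRow.ext_snoc {d : ℕ} (x : Fin d → ℚ) (y : ℚ) :
    DataRow.ext (Fin.snoc (α := fun _ => ℚ) x y) = PWA.extend x := by
  rw [DataRow.ext, Fin.init_snoc]

theorem DataRow.residual_snoc {d : ℕ} (v : Fin (d + 1) → ℚ) (x : Fin d → ℚ) (y : ℚ) :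
    DataRow.residual v (Fin.snoc (α := fun _ => ℚ) x y) = y - v ⬝ᵥ PWA.extend x := by
  rw [DataRow.residual, DataRow.ext_snoc, Fin.snoc_last]

/-! ### The main theorem -/

/-- The best one of the models for the candidate classifiers. -/
noncomputable def bestModel {n d m : ℕ} (Fs : List (Candidates n d m)) (loss : ℚ → ℚ)
    (sol : List (DataRow d) → Fin (d + 1) → ℚ) (l : List (DataRow d)) : Option (Model n d) :=
  (Fs.flatMap fun F => sweepModels F loss sol l m fun _ => l.head?.getD 0).foldl betterModel none

/-- Any `θ` agrees on the data with a candidate `θ'`. The best model costs at most as much as the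
one fitted to `θ'`, which is optimal for its labels. -/
theorem exists_bestModel {n d m : ℕ} {Fs : List (Candidates n d m)} {loss : ℚ → ℚ}
    {sol : List (DataRow d) → Fin (d + 1) → ℚ} {l : List (DataRow d)}
    (hFs : ∀ θ : Fin n → Fin (d + 1) → ℚ, ∃ F ∈ Fs, ∃ z : Fin m → DataRow d, (∀ t, z t ∈ l) ∧
      ∀ r ∈ l, ∀ j, r.InClass θ j → r.InClass (F.theta z (F.eps z l)) j)
    (hsol : ∀ l' ⊆ l, l' ≠ [] → ∀ v, lossSum loss (sol l') l' ≤ lossSum loss v l') :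
    ∃ b, bestModel Fs loss sol l = some b ∧ (∃ θ, b = fitModel loss sol θ l) ∧
      ∀ θ : Fin n → Fin (d + 1) → ℚ, ∃ θ', (∀ r ∈ l, ∀ j, r.InClass θ j → r.InClass θ' j) ∧
        ∀ w : Fin n → Fin (d + 1) → ℚ, b.cost ≤ ∑ j, lossSum loss (w j) (rowsOfClass θ' j l) := by
  have hmem : ∀ θ : Fin n → Fin (d + 1) → ℚ, ∃ θ',
      (∀ r ∈ l, ∀ j, r.InClass θ j → r.InClass θ' j) ∧ fitModel loss sol θ' l ∈
        Fs.flatMap fun F => sweepModels F loss sol l m fun _ => l.head?.getD 0 := by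
    intro θ
    obtain ⟨F, hF, z, hz, h⟩ := hFs θ
    exact ⟨_, h, List.mem_flatMap.2 ⟨F, hF, fitModel_mem_sweepModels F loss sol l m _ z
      (fun t _ => hz t) (fun t ht => absurd t.2 (not_lt.2 ht)) le_rfl⟩⟩
  obtain ⟨b, hb, hb₁, hb₂, -⟩ := foldl_betterModel
    (Fs.flatMap fun F => sweepModels F loss sol l m fun _ => l.head?.getD 0) none
    (.inl (List.ne_nil_of_mem (hmem 0).choose_spec.2))
  refine ⟨b, hb, ?_, fun θ => ?_⟩
  · obtain ⟨F, -, h⟩ := List.mem_flatMap.1 (hb₁.resolve_right (by simp))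
    exact exists_eq_fitModel _ _ _ _ _ _ h
  · obtain ⟨θ', h, h'⟩ := hmem θ
    exact ⟨θ', h, fun w => (hb₂ _ h').trans (fitModel_cost_le loss θ' l
      (fun j hj => hsol _ (List.filter_subset_self _) hj) w)⟩

theorem exists_machine_bestModel {n d m : ℕ} {M L : QMachine} (Fs : List (Candidates n d m))
    {Ok : DataRow d → Prop} {T : ℕ → ℕ} (hT : Monotone T)
    {sol : List (DataRow d) → Fin (d + 1) → ℚ}
    (hM : ∀ l, l ≠ [] → (∀ r ∈ l, Ok r) →
      M.OutputsWithin (dataWord l) (List.ofFn (sol l)) (T l.length))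
    {loss : ℚ → ℚ} {t : ℕ} (hL : ∀ e, L.OutputsWithin [e] [loss e] t) :
    ∃ (M' : QMachine) (C : ℕ), ∀ l, l ≠ [] → (∀ r ∈ l, Ok r) →
      ∀ b, bestModel Fs loss sol l = some b → M'.OutputsWithin (dataWord l) (modelWord b)
        (C * ((T l.length + l.length) * l.length ^ m + 1)) := by
  -- The parameters comprise the data set and its best model with all hypotheses, so that the
  -- precondition can be trivial.
  let A := {p : List (DataRow d) × Model n d //
    p.1 ≠ [] ∧ (∀ r ∈ p.1, Ok r) ∧ bestModel Fs loss sol p.1 = some p.2}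
  let size : A → ℕ := fun a => (T a.1.1.length + a.1.1.length) * a.1.1.length ^ m
  let μ : A → Memory n d m M.K L.K := fun a =>
    ⟨a.1.1, fun _ => 0, fun _ => none, blankTapes _, blankTapes _, wordTape [] []⟩
  have hsize : ∀ a : A, a.1.1.length ≤ 1 * (size a + 1) := by
    intro a
    have : 1 ≤ a.1.1.length ^ m := Nat.one_le_pow _ _ (List.length_pos_iff.2 a.2.1)
    simp only [size]
    nlinarith
  have h₁ := (Does.load (pre := fun _ : A => True) (m := m)
    (registers (n := n) (d := d) none none (fun _ => none) none)
    (blankTapes M.K) (blankTapes L.K) fun a => a.1.1).mono 1 fun a _ => hsize a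
  have h₂ := Does.sweepAll (pre := fun _ : A => True) Fs hT hM hL μ (fun _ => none)
    (fun a _ => a.2.2.1) (fun _ _ => rfl) (fun _ _ => rfl) fun _ _ => rfl
  have h₃ := (Does.unload (pre := fun _ : A => True) (m := m) (blankTapes M.K) (blankTapes L.K)
    (fun a => a.1.1) fun a => a.1.2).mono 1 fun a _ => hsize a
  obtain ⟨P, C, h⟩ := h₁.trans (h₂.trans (h₃.congr (fun a _ => by
    -- In position `0` all pointers scan the first row, which is the initial value of the pointers
    -- in `bestModel`.
    have : (Fs.flatMap fun F => sweepModels F loss sol (μ a).rows m (μ a).pointers).foldl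
      betterModel none = some a.1.2 := a.2.2.2
    rw [this]
    rfl) fun _ _ => rfl))
  refine ⟨P.toMachine (.inl .io), C, fun l hl hok b hb => QProg.Runs.toMachine ?_⟩
  have hfull : ∀ (R : Register n d → Option ℚ) (hR : R = fun _ => none) (x : List ℚ),
      ((⟨[], fun _ => 0, R, blankTapes M.K, blankTapes L.K, wordTape [] x⟩ :
        Memory n d m M.K L.K).tapes).full [] none =
        (Function.update (fun _ => Turing.Tape.mk₁ []) (.inl .io) (Turing.Tape.mk₁ (x.map some)) :
          Tapes (TapeName n d m M.K L.K ⊕ Bool)) := by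
    rintro _ rfl x
    funext v
    rcases v with (_ | _ | _ | _ | _) | _ | _ <;> rfl
  have hrun := h ⟨(l, b), hl, hok, hb⟩ trivial
  rwa [hfull _ (by funext r; cases r <;> rfl), hfull _ rfl] at hrun

theorem risk_eq {d n N : ℕ} {X : Set (Fin d → ℚ)} (loss : ℚ → ℚ) (x : Fin N → X) (y : Fin N → ℚ)
    (w : Fin n → Fin (d + 1) → ℚ) (h : X → Fin n) (θ : Fin n → Fin (d + 1) → ℚ)
    (hθ : ∀ i, DataRow.InClass θ (h (x i)) (Fin.snoc (x i : Fin d → ℚ) (y i) : DataRow d)) :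
    PWA.risk loss x y w h = 1 / (N : ℚ) * ∑ j, lossSum loss (w j) (rowsOfClass θ j
      (List.ofFn fun i => (Fin.snoc (x i : Fin d → ℚ) (y i) : DataRow d))) := by
  rw [lossSum_rowsOfClass loss θ w _ _ hθ]
  simp_rw [DataRow.residual_snoc]
  rfl

/-- Only the labels of the data points enter the risk. A competing classifier `h'` may thus be
replaced by the candidate `θ'` with the same labels on the data. -/
theorem isGlobalSolution_of_cost_le {d n N : ℕ} [NeZero n] {X : Set (Fin d → ℚ)} {loss : ℚ → ℚ}
    {sol : List (DataRow d) → Fin (d + 1) → ℚ}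
    (x : Fin N → X) (y : Fin N → ℚ) {l : List (DataRow d)}
    (hl : l = List.ofFn fun i => (Fin.snoc (x i : Fin d → ℚ) (y i) : DataRow d)) {b : Model n d}
    {θ₀ : Fin n → Fin (d + 1) → ℚ} (hb : b = fitModel loss sol θ₀ l)
    (hmin : ∀ θ : Fin n → Fin (d + 1) → ℚ, ∃ θ', (∀ r ∈ l, ∀ j, r.InClass θ j → r.InClass θ' j) ∧
        ∀ w : Fin n → Fin (d + 1) → ℚ, b.cost ≤ ∑ j, lossSum loss (w j) (rowsOfClass θ' j l)) :
    PWA.IsGlobalSolution loss x y b.w (fun k => Fin.init (b.θ k))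
      fun k => b.θ k (Fin.last d) := by
  classical
  have hcost : b.cost = ∑ j, lossSum loss (b.w j) (rowsOfClass b.θ j l) := by
    subst hb
    rfl
  choose h hh using fun x : X => PWA.exists_isFirstArgmax
    fun k => Fin.init (b.θ k) ⬝ᵥ (x : Fin d → ℚ) + b.θ k (Fin.last d)
  refine ⟨h, hh, ?_⟩
  rintro w' h' ⟨a', b', hh'⟩
  obtain ⟨θ', hθ', hle⟩ := hmin fun k => Fin.snoc (a' k) (b' k)
  have hr : ∀ i, (Fin.snoc (x i : Fin d → ℚ) (y i) : DataRow d) ∈ l := fun i => by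
    rw [hl, List.mem_ofFn]
    exact ⟨i, rfl⟩
  rw [risk_eq loss x y b.w h b.θ fun i => ?_, risk_eq loss x y w' h' θ' fun i => ?_, ← hl, ← hcost]
  · exact mul_le_mul_of_nonneg_left (hle w') (by positivity)
  · refine hθ' _ (hr i) _ ?_
    have := hh' (x i)
    simpa [DataRow.InClass, DataRow.ext_snoc, dotProduct_extend] using this
  · have := hh (x i)
    simpa [DataRow.InClass, DataRow.ext_snoc, dotProduct_extend] using this

/-- Choosing one solution for each list makes the output of the machine a function of the rows,
which the programs can refer to. -/
theorem exists_solver {d : ℕ} {X : Set (Fin d → ℚ)} {loss : ℚ → ℚ} {T : ℕ → ℕ}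
    (hreg : PWA.RegressionSolvableInTime X loss T) :
    ∃ (M : QMachine) (sol : List (DataRow d) → Fin (d + 1) → ℚ),
      ∀ l, l ≠ [] → (∀ r ∈ l, (Fin.init r : Fin d → ℚ) ∈ X) →
        (∀ v, lossSum loss (sol l) l ≤ lossSum loss v l) ∧
        M.OutputsWithin (dataWord l) (List.ofFn (sol l)) (T l.length) := by
  obtain ⟨M, hM⟩ := hreg
  have : ∀ l : List (DataRow d), ∃ v, l ≠ [] → (∀ r ∈ l, (Fin.init r : Fin d → ℚ) ∈ X) →
      (∀ v', lossSum loss v l ≤ lossSum loss v' l) ∧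
      M.OutputsWithin (dataWord l) (List.ofFn v) (T l.length) := by
    intro l
    by_cases h : l ≠ [] ∧ ∀ r ∈ l, (Fin.init r : Fin d → ℚ) ∈ X
    · obtain ⟨hl, hX⟩ := h
      obtain ⟨v, hv, hout⟩ := hM l.length (List.length_pos_iff.2 hl)
        (fun i => ⟨Fin.init l[i], hX _ (List.getElem_mem _)⟩) fun i => l[i] (Fin.last d)
      refine ⟨v, fun _ _ => ⟨fun v' => ?_, ?_⟩⟩
      · have key : ∀ v, ∑ i : Fin l.length, loss (l[i] (Fin.last d) -
            v ⬝ᵥ PWA.extend (Fin.init l[i])) = lossSum loss v l := by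
          intro v
          rw [lossSum, ← List.sum_ofFn]
          conv_rhs => rw [← List.ofFn_getElem (xs := l), List.map_ofFn]
          rfl
        have := hv v'
        rwa [key, key] at this
      · rw [encodeData_eq fun i : Fin l.length => l[i]] at hout
        simpa using hout
    · exact ⟨0, fun h₁ h₂ => absurd ⟨h₁, h₂⟩ h⟩
  choose sol hsol using this
  exact ⟨M, sol, hsol⟩

theorem mainTheorem8 (d n : ℕ) (hd : 1 ≤ d) (hn : 3 ≤ n) (X : Set (Fin d → ℚ))
    (loss : ℚ → ℚ) (hloss_nonneg : ∀ e, 0 ≤ loss e) (hloss : PWA.LossComputable loss)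
    (T : ℕ → ℕ) (hT_mono : Monotone T) (hT_poly : ∃ p : Polynomial ℕ, ∀ N, T N ≤ p.eval N)
    (hreg : PWA.RegressionSolvableInTime X loss T) :
    ∃ (M : QMachine) (C : ℕ),
      (∃ P : Polynomial ℕ, ∀ N, C * T N * N ^ (d * n * (n - 1) / 2) ≤ P.eval N) ∧
      ∀ N : ℕ, n * (d + 1) ≤ N → ∀ (x : Fin N → X) (y : Fin N → ℚ),
        PWA.GeneralPosition (fun i => (x i : Fin d → ℚ)) →
        ∃ (w : Fin n → Fin (d + 1) → ℚ) (a : Fin n → Fin d → ℚ) (b : Fin n → ℚ),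
          PWA.IsGlobalSolution loss x y w a b ∧
          M.OutputsWithin (PWA.encodeData (fun i => (x i : Fin d → ℚ)) y)
            (PWA.encodeModel w a b) (C * T N * N ^ (d * n * (n - 1) / 2)) := by
  obtain ⟨n, rfl⟩ : ∃ n', n = n' + 1 := ⟨n - 1, by omega⟩
  obtain ⟨m, hm⟩ : ∃ m, n * (d + 1) = m + 1 :=
    ⟨n * (d + 1) - 1, (Nat.sub_add_cancel (Nat.mul_pos (by omega) (by omega))).symm⟩
  obtain ⟨p, hp⟩ := hT_poly
  obtain ⟨M, sol, hsol⟩ := exists_solver hreg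
  obtain ⟨L, t, hL⟩ := hloss
  obtain ⟨Fs, hFs⟩ := exists_candidates hm (by omega)
  obtain ⟨M', C, hM'⟩ := exists_machine_bestModel Fs hT_mono
    (fun l hl hX => (hsol l hl hX).2) hL
  set e := d * (n + 1) * (n + 1 - 1) / 2 with he
  -- With `n + 1` classes this says `2 (n (d + 1) - 1) ≤ d n (n + 1)`; equality holds for three
  -- classes and `d = 1`.
  have hme : m ≤ e := by
    rw [he, Nat.le_div_iff_mul_le two_pos, Nat.add_sub_cancel]
    obtain ⟨k, rfl⟩ : ∃ k, n = k + 2 := ⟨n - 2, by omega⟩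
    obtain ⟨c, rfl⟩ : ∃ c, d = c + 1 := ⟨d - 1, by omega⟩
    nlinarith [Nat.zero_le (c * k), Nat.zero_le (c * k * k), Nat.zero_le (k * k)]
  refine ⟨M', 4 * C, ⟨Polynomial.C (4 * C) * p * Polynomial.X ^ e, fun N => ?_⟩,
    fun N hN x y _ => ?_⟩
  · simp only [Polynomial.eval_mul, Polynomial.eval_C, Polynomial.eval_pow, Polynomial.eval_X]
    gcongr
    exact hp N
  let r : Fin N → DataRow d := fun i => Fin.snoc (x i : Fin d → ℚ) (y i)
  have hd' : 6 ≤ (n + 1) * (d + 1) := by nlinarith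
  have hl : List.ofFn r ≠ [] := fun h => by
    have := congrArg List.length h
    simp at this
    omega
  have hX : ∀ r' ∈ List.ofFn r, (Fin.init r' : Fin d → ℚ) ∈ X := by
    intro r' hr'
    obtain ⟨i, rfl⟩ := List.mem_ofFn.1 hr'
    simp [r]
  obtain ⟨b, hb, ⟨θ, hθ⟩, hmin⟩ := exists_bestModel (hFs _ hl) fun l' hl' h0 =>
    (hsol l' h0 fun r' hr' => hX r' (hl' hr')).1
  refine ⟨b.w, fun k => Fin.init (b.θ k), fun k => b.θ k (Fin.last d),
    isGlobalSolution_of_cost_le x y rfl hθ hmin, ?_⟩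
  have hdata : PWA.encodeData (fun i => (x i : Fin d → ℚ)) y = dataWord (List.ofFn r) := by
    rw [← encodeData_eq]
    simp [r]
  rw [hdata, encodeModel_eq]
  obtain ⟨k, hk, h⟩ := hM' _ hl hX b hb
  refine ⟨k, hk.trans ?_, h⟩
  -- The regression machine, run on the data set itself, turns `N (d + 1)` letters into `d + 1`, so
  -- `(N - 1)(d + 1) ≤ T N`; here `N ≥ 6`.
  have hT : N ≤ 2 * T N := by
    have := (hsol _ hl hX).2.length_le
    rw [length_dataWord, List.length_ofFn, List.length_ofFn] at this
    nlinarith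
  rw [List.length_ofFn]
  have hN0 : 1 ≤ N := by omega
  have hpow : N ^ m ≤ N ^ e := Nat.pow_le_pow_right hN0 hme
  have hpow' : 1 ≤ N ^ e := Nat.one_le_pow _ _ hN0
  -- The constant `4` is `3 + 1`: `T N + N ≤ 3 * T N`, and the additive `1` is at most `T N * N ^
  -- e`.
  calc C * ((T N + N) * N ^ m + 1) ≤ C * (3 * T N * N ^ e + T N * N ^ e) := by
        refine Nat.mul_le_mul_left _ (Nat.add_le_add (Nat.mul_le_mul (by omega) hpow) ?_)
        exact Nat.mul_pos (by omega) hpow'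
    _ = 4 * C * T N * N ^ e := by ring
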